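/- Let $X$ be a topological space, $A\subseteq X$, and $n\ge 0$. A singular $n$-manifold $(M,\partial M;f)$ in $(X,A)$ is a compact smooth $n$-manifold $M$ with (possibly empty) boundary together with a continuous map $f\colon M\to X$ with $f(\partial M)\subseteq A$. Let $(M_0,\partial M_0;f_0)$ and $(M_1,\partial M_1;f_1)$ be singular $n$-manifolds in $(X,A)$ and let $(W,\partial W;F)$ be an (unoriented) bordism between them: $W$ is a compact smooth $(n+1)$-manifold with boundary, $F\colon W\to X$ is continuous, $\partial W=M_0\cup M_1\cup M'$ with smoothly embedded compact $n$-manifolds with boundary $M_0,M_1,M'$ such that $\partial M'=\partial M_0\sqcup\partial M_1$ and $M_i\cap M'=\partial M_i$ for $i=0,1$, $F|_{M_i}=f_i$ for $i=0,1$, and $F(M')\subseteq A$. Let $\tau$ denote the involution $(x,y)\mapsto(y,x)$ on every product of a space with itself, and let $U_\Delta$ be a neighbourhood of the diagonal in $X\times X$. Products of manifolds with boundary, and codimension-zero subsets with corners of them, are regarded as smooth manifolds with boundary by straightening angles: a smooth structure on such a subset $C$ is obtained in this way if around each point of $C$ there is a chart of that structure which is the composite of a corner chart of $C$ (a diffeomorphism,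 with respect to the product smooth structure, of an open subset of $C$ onto a relatively open subset of $[0,\infty)^k\times\mathbb R^{m-k}$, $m=\dim C$) with the homeomorphism that, for $k\ge2$, successively straightens the angle between the last two of the non-negative coordinates by $(r,\theta)\mapsto(r,2\theta)$ in polar coordinates, until at most one non-negative coordinate is left. In particular, away from its corners such a $C$ has the smooth structure induced from the product. Then there is a neighbourhood $V_\Delta$ of the diagonal in $W\times W$ with the following properties. - **D1.** The complement $(W\times W)\setminus V_\Delta$ is a smooth compact manifold with boundary of dimension $2n+2$ (with the smooth structure inherited from $W\times W$ after straightening angles). - **D2.** $V_\Delta$ is $\tau$-invariant, and the quotient $((W\times W)\setminus V_\Delta)/\tau$ is again a smooth compact manifold with boundary, such that the projection from $(W\times W)\setminus V_\Delta$ is a local diffeomorphism. - **D3.** $(F\times F)(V_\Delta)\subseteq U_\Delta$. - **D4.** For $i=0,1$, the set $V_i:=V_\Delta\cap(M_i\times M_i)$ is a neighbourhood of the diagonal in $M_i\times M_i$ with the analogous properties: $V_i$ is $\tau$-invariant, $(M_i\times M_i)\setminus V_i$ is a smooth compact $2n$-manifold with boundary (with the smooth structure inherited from $M_i\times M_i$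 after straightening angles), so is its quotient by $\tau$, with the projection a local diffeomorphism, and $(f_i\times f_i)(V_i)\subseteq U_\Delta$. -/

import Mathlib

open Set Topology Manifold
open scoped ContDiff

noncomputable section

/-- The local model of an `n`-dimensional manifold with boundary, for every `n`: the Euclidean
half-space `{x | 0 ≤ x 0}` for positive `n`, and a point for `n = 0`. -/
def HalfSpace : ℕ → Type
  | 0 => EuclideanSpace ℝ (Fin 0)
  | n + 1 => EuclideanHalfSpace (n + 1)

instance instTopologicalSpaceHalfSpace : (n : ℕ) → TopologicalSpace (HalfSpace n)
  | 0 => inferInstanceAs (TopologicalSpace (EuclideanSpace ℝ (Fin 0)))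
  | n + 1 => inferInstanceAs (TopologicalSpace (EuclideanHalfSpace (n + 1)))

/-- The model with corners of `n`-dimensional manifolds with boundary: Mathlib's `𝓡∂ n` if `n` is
positive, and Mathlib's `𝓡 0` for `n = 0`. -/
def halfModel : (n : ℕ) → ModelWithCorners ℝ (EuclideanSpace ℝ (Fin n)) (HalfSpace n)
  | 0 => modelWithCornersSelf ℝ (EuclideanSpace ℝ (Fin 0))
  | n + 1 => modelWithCornersEuclideanHalfSpace (n + 1)

/-- A compact smooth `n`-dimensional manifold with (possibly empty) boundary. (Second countability
follows from compactness.) -/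
structure CompactManifold.{u} (n : ℕ) where
  carrier : Type u
  [topologicalSpace : TopologicalSpace carrier]
  [chartedSpace : ChartedSpace (HalfSpace n) carrier]
  [isManifold : IsManifold (halfModel n) ∞ carrier]
  [compactSpace : CompactSpace carrier]
  [t2Space : T2Space carrier]

namespace CompactManifold

instance (n : ℕ) : CoeSort (CompactManifold n) (Type _) := ⟨CompactManifold.carrier⟩

attribute [instance] topologicalSpace chartedSpace isManifold compactSpace t2Space

/-- The boundary `∂M`, as a subset of `M`. -/
def bdry {n : ℕ} (M : CompactManifold n) : Set M := (halfModel n).boundary M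

end CompactManifold

/-- A singular `n`-manifold `(M, ∂M; f)` in the pair `(X, A)`: a compact smooth `n`-manifold with
boundary and a continuous map of pairs `f : (M, ∂M) → (X, A)`. -/
structure RelSingularManifold.{u, v} (n : ℕ) (X : Type v) [TopologicalSpace X] (A : Set X) where
  M : CompactManifold.{u} n
  f : M → X
  continuous_f : Continuous f
  mapsTo_bdry : MapsTo f M.bdry A

set_option linter.checkUnivs false in
/-- An (unoriented) bordism `(W, ∂W; F)` between the singular `n`-manifolds `(M₀, ∂M₀; f₀)` and
`(M₁, ∂M₁; f₁)` in `(X, A)`. The identification of `M₀`, `M₁` and of the remaining part `M'` with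
parts of `∂W` is recorded by the smooth embeddings `incl₀`, `incl₁`, `incl'` into `W`. -/
structure RelBordism.{u₀, u₁, v, w, w'} {n : ℕ} {X : Type v} [TopologicalSpace X] {A : Set X}
    (S₀ : RelSingularManifold.{u₀, v} n X A) (S₁ : RelSingularManifold.{u₁, v} n X A) where
  W : CompactManifold.{w} (n + 1)
  M' : CompactManifold.{w'} n
  F : W → X
  continuous_F : Continuous F
  incl₀ : S₀.M → W
  incl₁ : S₁.M → W
  incl' : M' → W
  isSmoothEmbedding_incl₀ : IsSmoothEmbedding (halfModel n) (halfModel (n + 1)) ∞ incl₀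
  isSmoothEmbedding_incl₁ : IsSmoothEmbedding (halfModel n) (halfModel (n + 1)) ∞ incl₁
  isSmoothEmbedding_incl' : IsSmoothEmbedding (halfModel n) (halfModel (n + 1)) ∞ incl'
  /-- `∂W = M₀ ∪ M₁ ∪ M'`. -/
  bdry_W : W.bdry = range incl₀ ∪ range incl₁ ∪ range incl'
  /-- `∂M' = ∂M₀ ∪ ∂M₁`, -/
  bdry_M' : incl' '' M'.bdry = incl₀ '' S₀.M.bdry ∪ incl₁ '' S₁.M.bdry
  /-- and this union is disjoint. -/
  disjoint_bdry : Disjoint (incl₀ '' S₀.M.bdry) (incl₁ '' S₁.M.bdry)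
  /-- `M₀ ∩ M' = ∂M₀`. -/
  inter₀ : range incl₀ ∩ range incl' = incl₀ '' S₀.M.bdry
  /-- `M₁ ∩ M' = ∂M₁`. -/
  inter₁ : range incl₁ ∩ range incl' = incl₁ '' S₁.M.bdry
  /-- `F` restricts to `f₀` on `M₀`. -/
  F_incl₀ : F ∘ incl₀ = S₀.f
  /-- `F` restricts to `f₁` on `M₁`. -/
  F_incl₁ : F ∘ incl₁ = S₁.f
  /-- `F(M') ⊆ A`. -/
  F_incl' : ∀ x, F (incl' x) ∈ A

/-! ### Straightening of angles -/

/-- The sector in `ℝᵐ` in which the first `k` coordinates are non-negative: the model of a corner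
of codimension `k`. -/
def cornerSector (m k : ℕ) : Set (EuclideanSpace ℝ (Fin m)) :=
  {x | ∀ i : Fin m, (i : ℕ) < k → 0 ≤ x i}

/-- Straightening of the angle between the coordinates `k` and `k + 1` (nothing if there are no such
coordinates): the map which doubles the angle, `(r, θ) ↦ (r, 2θ)` in polar coordinates, sends the
quarter plane of all `(a, b)` with `a, b ≥ 0` to the half plane of all
`(r cos 2θ, r sin 2θ) = ((a² - b²) / r, 2ab / r)` with `r = √(a² + b²)`, and `(0, 0)` to `(0, 0)`.
The non-negative new coordinate `r sin 2θ` is put at place `k`, the other one at place `k + 1`. -/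
def straightenPair {m : ℕ} (k : ℕ) (x : EuclideanSpace ℝ (Fin m)) : EuclideanSpace ℝ (Fin m) :=
  if h : k + 1 < m then
    let a : ℝ := x ⟨k, (Nat.lt_succ_self k).trans h⟩
    let b : ℝ := x ⟨k + 1, h⟩
    WithLp.toLp 2 fun l =>
      if (l : ℕ) = k then 2 * a * b / √(a ^ 2 + b ^ 2)
      else if (l : ℕ) = k + 1 then (a ^ 2 - b ^ 2) / √(a ^ 2 + b ^ 2)
      else x l
  else x

/-- The iterated straightening of angles, a homeomorphism of `cornerSector m k` with the half-space
`cornerSector m 1` (for `k ≥ 1`): it is the identity for `k ≤ 1`; for larger `k`, first the angle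
between the last two of the `k` non-negative coordinates is straightened, which leaves a corner of
codimension `k - 1`, and so on. -/
def straighten {m : ℕ} : ℕ → EuclideanSpace ℝ (Fin m) → EuclideanSpace ℝ (Fin m)
  | 0 => id
  | 1 => id
  | k + 2 => straighten (k + 1) ∘ straightenPair k

section

variable {E : Type*} [NormedAddCommGroup E] [NormedSpace ℝ E] {H : Type*} [TopologicalSpace H]
  {P : Type*} [TopologicalSpace P] [ChartedSpace H P]

/-- `φ`, on the open subset `O` of `P`, is an `m`-dimensional corner chart of codimension `k` for the
subset `C` of `P`: it is a diffeomorphism (for the smooth structure of `P`) of `C ∩ O` with a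
relatively open subset of the sector of points of `ℝᵐ` whose first `k` coordinates
are non-negative. -/
structure IsCornerChart (J : ModelWithCorners ℝ E H) (m k : ℕ) (C O : Set P)
    (φ : P → EuclideanSpace ℝ (Fin m)) : Prop where
  isOpen_domain : IsOpen O
  contMDiffOn : ContMDiffOn J 𝓘(ℝ, EuclideanSpace ℝ (Fin m)) ∞ φ (C ∩ O)
  image_eq : ∃ T : Set (EuclideanSpace ℝ (Fin m)), IsOpen T ∧ φ '' (C ∩ O) = T ∩ cornerSector m k
  inverse : ∃ χ : EuclideanSpace ℝ (Fin m) → P, LeftInvOn χ φ (C ∩ O) ∧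
    ContMDiffOn 𝓘(ℝ, EuclideanSpace ℝ (Fin m)) J ∞ χ (φ '' (C ∩ O))

/-- The given structure of an `m`-dimensional smooth manifold with boundary on the subset `C` of the
manifold with corners `P` is the one which `C` inherits from `P` after straightening angles: around
every point of `C` there is a corner chart for `C` in `P` (of some codimension `k`) such that
following it by the straightening of angles gives a chart of the smooth structure of `C`.
For `k ≤ 1` nothing is straightened, so that away from the corners of `C` the smooth structure is
just the one induced from `P`. -/
def IsStraightenedStructure (J : ModelWithCorners ℝ E H) (m : ℕ) (C : Set P)
    [ChartedSpace (HalfSpace m) C] : Prop :=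
  ∀ p : C, ∃ (k : ℕ) (O : Set P) (φ : P → EuclideanSpace ℝ (Fin m)),
    (p : P) ∈ O ∧ IsCornerChart J m k C O φ ∧
      ∃ ψ ∈ IsManifold.maximalAtlas (halfModel m) ∞ C, ψ.source = Subtype.val ⁻¹' O ∧
        ∀ q ∈ ψ.source, halfModel m (ψ q) = straighten k (φ q)

end

/-! ### Neighbourhoods of the diagonal -/

/-- The equivalence relation on a subset `C` of `P × P` whose classes are the intersections of `C`
with the orbits of the involution `τ (x, y) = (y, x)`. -/
def swapSetoid {P : Type*} (C : Set (P × P)) : Setoid C where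
  r p q := p = q ∨ (p : P × P) = Prod.swap (q : P × P)
  iseqv :=
    { refl := fun _ => Or.inl rfl
      symm := by
        rintro p q (h | h)
        · exact Or.inl h.symm
        · exact Or.inr (by rw [h, Prod.swap_swap])
      trans := by
        rintro p q r (rfl | h) (rfl | h')
        · exact Or.inl rfl
        · exact Or.inr h'
        · exact Or.inr h
        · exact Or.inl (Subtype.ext (by rw [h, h', Prod.swap_swap])) }

/-- The quotient `C / τ`, with the quotient topology. -/
abbrev SwapQuotient {P : Type*} (C : Set (P × P)) : Type _ := Quotient (swapSetoid C)

/-- `C ⊆ M × M` and its quotient `C / τ` are smooth compact `2n`-manifolds with boundary: `C` is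
compact and has a smooth structure that it inherits from the product `M × M` after straightening
angles, and `C / τ` is compact and Hausdorff and has a smooth structure for which the
projection `C → C / τ` is a local diffeomorphism. -/
def HasSmoothQuotient {n : ℕ} (M : CompactManifold n) (C : Set (M × M)) : Prop :=
  IsCompact C ∧
  ∃ _ : ChartedSpace (HalfSpace (2 * n)) C,
    IsManifold (halfModel (2 * n)) ∞ C ∧
    IsStraightenedStructure ((halfModel n).prod (halfModel n)) (2 * n) C ∧
    CompactSpace (SwapQuotient C) ∧ T2Space (SwapQuotient C) ∧
    ∃ _ : ChartedSpace (HalfSpace (2 * n)) (SwapQuotient C),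
      IsManifold (halfModel (2 * n)) ∞ (SwapQuotient C) ∧
      IsLocalDiffeomorph (halfModel (2 * n)) (halfModel (2 * n)) ∞
        (Quotient.mk (swapSetoid C) : C → SwapQuotient C)

/-- `V` is a `τ`-invariant neighbourhood of the diagonal in `M × M` which `f × f` maps into `U`, and
the complement of `V` as well as its quotient by `τ` are smooth compact manifolds with boundary. -/
structure IsAdmissibleNhd {n : ℕ} {X : Type*} (M : CompactManifold n) (f : M → X)
    (U : Set (X × X)) (V : Set (M × M)) : Prop where
  mem_nhdsSet : V ∈ 𝓝ˢ (diagonal M)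
  hasSmoothQuotient : HasSmoothQuotient M Vᶜ
  swap_mem : ∀ p ∈ V, Prod.swap p ∈ V
  mapsTo : MapsTo (Prod.map f f) V U

end

/-! Embed `W` in a Euclidean space by an injective immersion `e`, put `D (x, y) = ‖e x - e y‖²`, and
let `V` be the sublevel set `D < c` for a small `c > 0`. It is open, symmetric and contains the
diagonal, and by compactness `F × F` maps it into `U` once `c` is small. Its preimages in `M₀ × M₀`
and `M₁ × M₁` are the sublevel sets for the injective immersions `e ∘ incl₀` and `e ∘ incl₁`. So one
statement about a compact manifold with an injective immersion, `exists_hasSmoothQuotient`, serves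
all three claims, with `c` below all the bounds involved.

For this statement let `C` be the set `c ≤ D`, let `ρ` be a boundary defining function, and put `h =
D - c`, `a = ρ x`, `b = ρ y`. Near the diagonal, pushing one point away from the other along a
segment in a chart increases `D`, and this can be done tangentially to the boundary
(`exists_direction_near_diagonal`). Hence those of `h`, `a`, `b` that vanish at a point of `C` have
independent differentials there, and an inverse function theorem on wedges (`exists_inverse_wedge`)
turns them into the boundary coordinates of corner charts (`exists_isProductSmooth`).

The main difficulty is the straightening. Doubling the angle is not smooth along the edge, so
straightening arbitrary corner charts does not give compatible charts. It does if the two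
coordinates at the edge are functions on the whole space and the remaining coordinates are pulled
back from the edge by one fixed smooth retraction `r` (`IsStraightenable.smoothVia`). If `r`
commutes with the involution `τ`, then `τ` stays smooth: it interchanges `a` and `b`, which fixes `r
sin 2θ` and changes the sign of `r cos 2θ`. Equivariant retractions are composed of local shrinkings
(`exists_local_stratumMap`, `exists_retraction`), which is possible because `τ` is free on `C`.

Corners have codimension at most three. The edge `a = b = 0` is straightened first, then the edge `h
= u = 0` with `u = r sin 2θ`. Near `h = a = b = 0` one chart has to undergo both steps; this is
arranged by letting both retractions preserve a retraction `r₃` onto this deepest stratum and the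
coordinate transverse to the edge (`IsTripleChart`, `exists_compatible_retraction`). Finally, the
charts are pushed down along the free smooth involution (`exists_quotient_manifold`). -/

noncomputable section

/-! ### Inverse functions on wedges -/

section Wedge

variable {G G' : Type*} [NormedAddCommGroup G] [NormedSpace ℝ G]
  [NormedAddCommGroup G'] [NormedSpace ℝ G'] {ι : Type*} [Fintype ι]

/-- The wedge on which all the functionals `ℓ i` are non-negative. -/
def wedge (ℓ : ι → G →L[ℝ] ℝ) : Set G := {t | ∀ i, 0 ≤ ℓ i t}

/-- A Lipschitz retraction onto `wedge ℓ`, if `v` is a dual system of `ℓ`. -/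
def wedgeRetr (ℓ : ι → G →L[ℝ] ℝ) (v : ι → G) (t : G) : G := t + ∑ i, max (-ℓ i t) 0 • v i

omit [Fintype ι] in
theorem convex_wedge (ℓ : ι → G →L[ℝ] ℝ) : Convex ℝ (wedge ℓ) := by
  intro x hx y hy a b ha hb _ i
  simpa using add_nonneg (mul_nonneg ha (hx i)) (mul_nonneg hb (hy i))

variable {ℓ : ι → G →L[ℝ] ℝ} {v : ι → G}

theorem apply_sum_dual [DecidableEq ι] (hv : ∀ i j, ℓ i (v j) = if i = j then 1 else 0)
    (w : ι → ℝ) (i : ι) : ℓ i (∑ j, w j • v j) = w i := by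
  simp [map_sum, hv]

/-- By convexity an interior point suffices, and the sum of the dual vectors is one: every
functional takes the value 1 there. -/
theorem uniqueDiffOn_wedge [DecidableEq ι]
    (hv : ∀ i j, ℓ i (v j) = if i = j then 1 else 0) : UniqueDiffOn ℝ (wedge ℓ) := by
  refine uniqueDiffOn_convex (convex_wedge ℓ) ⟨∑ j, (1 : ℝ) • v j, ?_⟩
  have ho : IsOpen {t : G | ∀ i, 0 < ℓ i t} := by
    simp only [ofPred_forall]
    exact isOpen_iInter_of_finite fun i => isOpen_lt continuous_const (ℓ i).continuous
  refine interior_maximal (fun t ht i => (ht i).le) ho ?_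
  intro i
  rw [apply_sum_dual hv]
  exact one_pos

theorem apply_wedgeRetr [DecidableEq ι] (hv : ∀ i j, ℓ i (v j) = if i = j then 1 else 0)
    (t : G) (i : ι) : ℓ i (wedgeRetr ℓ v t) = max (ℓ i t) 0 := by
  rw [wedgeRetr, map_add, apply_sum_dual hv (fun i => max (-ℓ i t) 0)]
  rcases le_total (ℓ i t) 0 with h | h
  · rw [max_eq_left (by linarith), max_eq_right h]; ring
  · rw [max_eq_right (by linarith), max_eq_left h]; ring

theorem wedgeRetr_mem [DecidableEq ι] (hv : ∀ i j, ℓ i (v j) = if i = j then 1 else 0)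
    (t : G) : wedgeRetr ℓ v t ∈ wedge ℓ := fun i => by
  rw [apply_wedgeRetr hv]; exact le_max_right _ _

theorem wedgeRetr_of_mem {t : G} (ht : t ∈ wedge ℓ) : wedgeRetr ℓ v t = t := by
  have : ∀ i, max (-ℓ i t) 0 = 0 := fun i => max_eq_right (by linarith [ht i])
  simp [wedgeRetr, this]

theorem exists_lipschitz_wedgeRetr (ℓ : ι → G →L[ℝ] ℝ) (v : ι → G) :
    ∃ K : NNReal, LipschitzWith K (wedgeRetr ℓ v) := by
  have h : ∀ i, LipschitzWith (‖v i‖₊ * ‖ℓ i‖₊) fun t : G => max (-ℓ i t) 0 • v i := by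
    intro i
    refine LipschitzWith.of_dist_le_mul fun x y => ?_
    rw [dist_eq_norm, ← sub_smul, norm_smul, NNReal.coe_mul, coe_nnnorm, coe_nnnorm, mul_comm,
      mul_assoc]
    refine mul_le_mul_of_nonneg_left ?_ (norm_nonneg _)
    refine (abs_max_sub_max_le_abs _ _ _).trans ?_
    have : -ℓ i x - -ℓ i y = -ℓ i (x - y) := by rw [map_sub]; ring
    rw [this, abs_neg, dist_eq_norm]
    exact (ℓ i).le_opNorm _
  have h2 : ∀ s : Finset ι, ∃ K : NNReal,
      LipschitzWith K fun t : G => ∑ i ∈ s, max (-ℓ i t) 0 • v i := by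
    classical
    intro s
    induction s using Finset.induction_on with
    | empty => exact ⟨0, by simp⟩
    | insert i s his ih =>
      obtain ⟨K, hK⟩ := ih
      exact ⟨_, by simpa [Finset.sum_insert his] using (h i).add hK⟩
  obtain ⟨K, hK⟩ := h2 Finset.univ
  exact ⟨_, LipschitzWith.id.add hK⟩

end Wedge

section Inverse

variable {E F : Type*} [NormedAddCommGroup E] [NormedSpace ℝ E] [CompleteSpace E]
  [NormedAddCommGroup F] [NormedSpace ℝ F]

/-- A continuous right inverse of a smooth map with invertible derivatives is smooth, on sets with
unique differentials. -/
theorem ContDiffOn.of_rightInverse {f : E → F} {g : F → E} {s : Set E} {t : Set F}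
    (hs : UniqueDiffOn ℝ s) (hf : ContDiffOn ℝ ∞ f s) (hg : ContinuousOn g t)
    (hgs : MapsTo g t s) (hfg : ∀ y ∈ t, f (g y) = y)
    (hA : ∀ x ∈ s, ∃ A : E ≃L[ℝ] F, fderivWithin ℝ f s x = A) : ContDiffOn ℝ ∞ g t := by
  have hf' : ContDiffOn ℝ ∞ (fderivWithin ℝ f s) s := hf.fderivWithin hs (by simp)
  have hder : ∀ y ∈ t, HasFDerivWithinAt g
      (ContinuousLinearMap.inverse (fderivWithin ℝ f s (g y))) t y := by
    intro y hy
    obtain ⟨A, hA⟩ := hA (g y) (hgs hy)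
    have h1 : HasFDerivWithinAt f (A : E →L[ℝ] F) s (g y) := by
      rw [← hA]
      exact ((hf _ (hgs hy)).differentiableWithinAt (by simp)).hasFDerivWithinAt
    rw [hA, ContinuousLinearMap.inverse_equiv]
    refine h1.of_local_left_inverse ?_ hy ?_
    · exact tendsto_nhdsWithin_iff.2 ⟨hg y hy, eventually_nhdsWithin_of_forall fun z hz => hgs hz⟩
    · exact eventually_nhdsWithin_of_forall fun z hz => hfg z hz
  -- Bootstrapping: the derivative of `g` is inversion composed with `f'` composed with `g`, so each
  -- order of smoothness of `g` yields the next.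
  rw [contDiffOn_infty]
  intro n
  induction n with
  | zero => simpa using hg
  | succ n ih =>
    intro y hy
    have := (contDiffWithinAt_succ_iff_hasFDerivWithinAt (𝕜 := ℝ) (n := (n : ℕ)) (f := g) (s := t)
      (x := y) (by simp)).2
    refine this ⟨t, by rw [insert_eq_of_mem hy]; exact self_mem_nhdsWithin, by simp, fun z =>
      ContinuousLinearMap.inverse (fderivWithin ℝ f s (g z)), fun z hz => hder z hz, ?_⟩
    obtain ⟨A, hA⟩ := hA (g y) (hgs hy)
    have h2 : ContDiffAt ℝ n (ContinuousLinearMap.inverse : (E →L[ℝ] F) → F →L[ℝ] E)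
        (fderivWithin ℝ f s (g y)) := by
      rw [hA]; exact contDiffAt_map_inverse A
    exact h2.comp_contDiffWithinAt y (((hf' (g y) (hgs hy)).of_le (by exact_mod_cast le_top)).comp y
      (ih y hy) hgs)

end Inverse

/-! ### Inverse functions between wedges -/

section WedgeInverse

variable {G G' : Type*} [NormedAddCommGroup G] [NormedSpace ℝ G] [CompleteSpace G]
  [NormedAddCommGroup G'] [NormedSpace ℝ G'] {ι : Type*} [Fintype ι] [DecidableEq ι]
  {ℓ : ι → G →L[ℝ] ℝ} {v : ι → G} {m : ι → G' →L[ℝ] ℝ}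

-- At an apex of the wedge only one-sided difference quotients make sense: a ray in a direction of
-- the wedge stays in the wedge, its opposite need not.
omit [CompleteSpace G] [Fintype ι] [DecidableEq ι] in
theorem tendsto_slope_wedge {T : Set G} (hT : IsOpen T) {t₀ : G} (ht₀ : t₀ ∈ T)
    (hℓ : ∀ i, ℓ i t₀ = 0) {Ψ : G → G'} {A : G →L[ℝ] G'}
    (hΨ : HasFDerivWithinAt Ψ A (T ∩ wedge ℓ) t₀) {d : G} (hd : d ∈ wedge ℓ) (i : ι)
    (h0 : m i (Ψ t₀) = 0) :
    (∀ᶠ ε : ℝ in 𝓝[>] 0, t₀ + ε • d ∈ T ∩ wedge ℓ) ∧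
    Filter.Tendsto (fun ε : ℝ => ε⁻¹ * m i (Ψ (t₀ + ε • d))) (𝓝[>] 0) (𝓝 (m i (A d))) := by
  have hcont : Continuous fun ε : ℝ => t₀ + ε • d := by fun_prop
  have h1 : ∀ᶠ ε : ℝ in 𝓝[>] 0, t₀ + ε • d ∈ T ∩ wedge ℓ := by
    have h2 : ∀ᶠ ε : ℝ in 𝓝 0, t₀ + ε • d ∈ T :=
      hcont.continuousAt.eventually_mem (hT.mem_nhds (by simpa using ht₀))
    filter_upwards [nhdsWithin_le_nhds h2, self_mem_nhdsWithin] with ε hε hpos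
    refine ⟨hε, fun j => ?_⟩
    simpa [hℓ] using mul_nonneg (le_of_lt hpos) (hd j)
  refine ⟨h1, ?_⟩
  have h2 : HasFDerivWithinAt (fun t => m i (Ψ t)) ((m i).comp A) (T ∩ wedge ℓ) t₀ :=
    (m i).hasFDerivAt.comp_hasFDerivWithinAt t₀ hΨ
  have h3 := h2.lim (α := ℝ) (l := 𝓝[>] (0 : ℝ)) (c := fun ε => ε⁻¹) (d := fun ε => ε • d) (v := d)
    ?_ ?_ ?_
  · simpa [h0] using h3
  · have h4 : Continuous fun ε : ℝ => ε • d := by fun_prop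
    simpa using h4.continuousAt.tendsto.mono_left (nhdsWithin_le_nhds (s := Ioi 0) (a := (0 : ℝ)))
  · exact h1
  · refine tendsto_const_nhds.congr' ?_
    filter_upwards [self_mem_nhdsWithin] with ε hε
    rw [smul_smul, inv_mul_cancel₀ (ne_of_gt hε), one_smul]

-- The map sends the `i`-th face into the zero set of `m i`, so `m i ∘ A` kills all directions of
-- the wedge on which `ℓ i` vanishes. These span the kernel of `ℓ i`, so `m i ∘ A` is a multiple of
-- `ℓ i`. The factor is a limit of non-negative quotients; were it zero, surjectivity of `A` would
-- give `m i = 0`, and `m i ∘ Ψ` would vanish off the face as well.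
omit [CompleteSpace G] in
theorem exists_pos_smul_of_wedge (hv : ∀ i j, ℓ i (v j) = if i = j then 1 else 0)
    {T : Set G} (hT : IsOpen T) {t₀ : G} (ht₀ : t₀ ∈ T)
    (hℓ : ∀ i, ℓ i t₀ = 0) {Ψ : G → G'} {A : G ≃L[ℝ] G'}
    (hΨ : HasFDerivWithinAt Ψ (A : G →L[ℝ] G') (T ∩ wedge ℓ) t₀)
    (hm : ∀ t ∈ T ∩ wedge ℓ, ∀ i, 0 ≤ m i (Ψ t) ∧ (m i (Ψ t) = 0 ↔ ℓ i t = 0)) (i : ι) :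
    ∃ c : ℝ, 0 < c ∧ ∀ t, m i (A t) = c * ℓ i t := by
  have hS : t₀ ∈ T ∩ wedge ℓ := ⟨ht₀, fun i => (hℓ i).ge⟩
  have h0 : m i (Ψ t₀) = 0 := ((hm t₀ hS i).2).2 (hℓ i)
  have hvS : ∀ j, v j ∈ wedge ℓ := fun j i => by rw [hv]; split_ifs <;> norm_num
  have key : ∀ d ∈ wedge ℓ, ℓ i d = 0 → m i (A d) = 0 := by
    intro d hd hdi
    obtain ⟨h1, h2⟩ := tendsto_slope_wedge hT ht₀ hℓ hΨ hd i h0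
    refine tendsto_nhds_unique h2 (tendsto_const_nhds.congr' ?_)
    filter_upwards [h1] with ε hε
    rw [((hm _ hε i).2).2 (by simp [hℓ, hdi]), mul_zero]
  have hker : ∀ t, m i (A t) = m i (A (v i)) * ℓ i t := by
    intro t
    have e1 : t = (t - ∑ j, ℓ j t • v j) + ∑ j, ℓ j t • v j := by abel
    have e2 : m i (A (t - ∑ j, ℓ j t • v j)) = 0 := by
      have hz : ∀ k, ℓ k (t - ∑ j, ℓ j t • v j) = 0 := fun k => by
        rw [map_sub, apply_sum_dual hv (fun j => ℓ j t), sub_self]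
      exact key _ (fun k => (hz k).ge) (hz i)
    have e3 : m i (A (∑ j, ℓ j t • v j)) = m i (A (v i)) * ℓ i t := by
      rw [map_sum, map_sum, Finset.sum_eq_single i]
      · simp [mul_comm]
      · intro j _ hj
        rw [map_smul, map_smul, key (v j) (hvS j) (by rw [hv]; simp [hj.symm]), smul_zero]
      · simp
    conv_lhs => rw [e1]
    rw [map_add, map_add, e2, e3, zero_add]
  refine ⟨m i (A (v i)), lt_of_le_of_ne ?_ fun h => ?_, hker⟩
  · obtain ⟨h1, h2⟩ := tendsto_slope_wedge hT ht₀ hℓ hΨ (hvS i) i h0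
    refine ge_of_tendsto h2 ?_
    filter_upwards [h1, self_mem_nhdsWithin] with ε hε hpos
    exact mul_nonneg (inv_nonneg.2 (le_of_lt hpos)) (hm _ hε i).1
  · obtain ⟨h1, -⟩ := tendsto_slope_wedge hT ht₀ hℓ hΨ (hvS i) i h0
    obtain ⟨ε, hε, hpos⟩ := (h1.and self_mem_nhdsWithin).exists
    have hmz : ∀ y, m i y = 0 := fun y => by
      obtain ⟨t, rfl⟩ := A.surjective y
      rw [hker, ← h, zero_mul]
    have := ((hm _ hε i).2).1 (hmz _)
    rw [map_add, hℓ, map_smul, hv] at this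
    simp at this
    exact absurd this (ne_of_gt hpos)

/-- **Inverse function theorem on wedges.** -/
theorem exists_inverse_wedge (hv : ∀ i j, ℓ i (v j) = if i = j then 1 else 0)
    {T : Set G} (hT : IsOpen T) {t₀ : G} (ht₀ : t₀ ∈ T)
    (hℓ : ∀ i, ℓ i t₀ = 0) {Ψ : G → G'} {A : G ≃L[ℝ] G'}
    (hsm : ContDiffOn ℝ ∞ Ψ (T ∩ wedge ℓ))
    (hΨ : HasFDerivWithinAt Ψ (A : G →L[ℝ] G') (T ∩ wedge ℓ) t₀)
    (hm : ∀ t ∈ T ∩ wedge ℓ, ∀ i, 0 ≤ m i (Ψ t) ∧ (m i (Ψ t) = 0 ↔ ℓ i t = 0)) :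
    ∃ (T₀ : Set G) (T' : Set G') (χ : G' → G), IsOpen T₀ ∧ IsOpen T' ∧ t₀ ∈ T₀ ∧ T₀ ⊆ T ∧
      (∀ t ∈ T₀ ∩ wedge ℓ, Ψ t ∈ T' ∩ wedge m ∧ χ (Ψ t) = t) ∧
      (∀ y ∈ T' ∩ wedge m, χ y ∈ T₀ ∩ wedge ℓ ∧ Ψ (χ y) = y) ∧
      ContDiffOn ℝ ∞ χ (T' ∩ wedge m) := by
  have hS : t₀ ∈ T ∩ wedge ℓ := ⟨ht₀, fun i => (hℓ i).ge⟩
  have huS : UniqueDiffOn ℝ (T ∩ wedge ℓ) := by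
    rw [inter_comm]; exact (uniqueDiffOn_wedge hv).inter hT
  choose c hc hcA using fun i => exists_pos_smul_of_wedge hv hT ht₀ hℓ hΨ hm i
  obtain ⟨K, hK⟩ := exists_lipschitz_wedgeRetr ℓ v
  have hA0 : fderivWithin ℝ Ψ (T ∩ wedge ℓ) t₀ = A := hΨ.fderivWithin (huS _ hS)
  have hcont : ContinuousWithinAt (fderivWithin ℝ Ψ (T ∩ wedge ℓ)) (T ∩ wedge ℓ) t₀ :=
    (hsm.continuousOn_fderivWithin huS (by simp)) t₀ hS
  -- a constant for the approximation by the linear map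
  obtain ⟨κ, hκ, hκN⟩ : ∃ κ : NNReal, 0 < κ ∧
      (Subsingleton G ∨ κ * K < ‖(A.symm : G' →L[ℝ] G)‖₊⁻¹) := by
    rcases subsingleton_or_nontrivial G with h | h
    · exact ⟨1, one_pos, Or.inl h⟩
    · have hN : 0 < ‖(A.symm : G' →L[ℝ] G)‖₊⁻¹ := by
        have : Nontrivial G := h
        exact inv_pos.2 A.nnnorm_symm_pos
      refine ⟨‖(A.symm : G' →L[ℝ] G)‖₊⁻¹ / (2 * (K + 1)), by positivity, Or.inr ?_⟩
      rw [div_mul_eq_mul_div, div_lt_iff₀ (by positivity)]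
      refine mul_lt_mul_of_pos_left ?_ hN
      have : (0 : NNReal) ≤ K := zero_le
      calc K < K + 1 := lt_add_one K
        _ ≤ 2 * (K + 1) := by rw [two_mul]; exact le_add_of_nonneg_left (by positivity)
  have hev : ∀ᶠ t in 𝓝[T ∩ wedge ℓ] t₀, ‖fderivWithin ℝ Ψ (T ∩ wedge ℓ) t - A‖ ≤ κ ∧
      fderivWithin ℝ Ψ (T ∩ wedge ℓ) t ∈ range ((↑) : (G ≃L[ℝ] G') → G →L[ℝ] G') := by
    refine Filter.Eventually.and ?_ ?_
    · have := hcont.sub (continuousWithinAt_const (b := (A : G →L[ℝ] G')))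
      have := this.norm
      exact Filter.Tendsto.eventually_le_const (by simpa [hA0] using hκ) this
    · refine hcont.eventually ?_
      rw [hA0]
      exact ContinuousLinearEquiv.isOpen.mem_nhds ⟨A, rfl⟩
  obtain ⟨δ, hδ, hball⟩ := Metric.mem_nhdsWithin_iff.1 hev
  obtain ⟨δ', hδ', hball'⟩ := Metric.isOpen_iff.1 hT t₀ ht₀
  set r := min δ δ' with hr
  have hr0 : 0 < r := lt_min hδ hδ'
  have hrT : Metric.ball t₀ r ⊆ T := (Metric.ball_subset_ball (min_le_right _ _)).trans hball'
  have hgood : ∀ t ∈ Metric.ball t₀ r ∩ wedge ℓ,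
      ‖fderivWithin ℝ Ψ (T ∩ wedge ℓ) t - A‖ ≤ κ ∧
      fderivWithin ℝ Ψ (T ∩ wedge ℓ) t ∈ range ((↑) : (G ≃L[ℝ] G') → G →L[ℝ] G') := fun t ht =>
    hball ⟨Metric.ball_subset_ball (min_le_left _ _) ht.1, hrT ht.1, ht.2⟩
  set pos := wedgeRetr ℓ v with hpos
  have hpos0 : pos t₀ = t₀ := wedgeRetr_of_mem hS.2
  -- Both a point and its retraction have to lie in the ball where the derivative is close to `A`.
  set U := Metric.ball t₀ r ∩ pos ⁻¹' Metric.ball t₀ r with hU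
  have hUo : IsOpen U := Metric.isOpen_ball.inter (Metric.isOpen_ball.preimage hK.continuous)
  have ht₀U : t₀ ∈ U := ⟨Metric.mem_ball_self hr0, by
    rw [mem_preimage, hpos0]; exact Metric.mem_ball_self hr0⟩
  have hlin : ∀ x ∈ Metric.ball t₀ r ∩ wedge ℓ, ∀ y ∈ Metric.ball t₀ r ∩ wedge ℓ,
      ‖Ψ y - Ψ x - A (y - x)‖ ≤ κ * ‖y - x‖ := by
    intro x hx y hy
    refine Convex.norm_image_sub_le_of_norm_hasFDerivWithin_le' (𝕜 := ℝ)
      (s := Metric.ball t₀ r ∩ wedge ℓ) (f' := fun t => fderivWithin ℝ Ψ (T ∩ wedge ℓ) t)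
      (fun t ht => ?_) (fun t ht => (hgood t ht).1) ((convex_ball _ _).inter (convex_wedge ℓ)) hx hy
    exact ((hsm t ⟨hrT ht.1, ht.2⟩).differentiableWithinAt (by simp)).hasFDerivWithinAt.mono
      (inter_subset_inter_left _ hrT)
  -- `Ψ` is defined usefully only on the wedge. Extending just the error `Ψ - A` by the Lipschitz
  -- retraction gives a map near `t₀` that differs from `A` by a small Lipschitz constant, hence a
  -- local homeomorphism, and that agrees with `Ψ` on the wedge.
  set Φ : G → G' := fun t => A t + (Ψ (pos t) - A (pos t)) with hΦ
  have hΦS : ∀ t ∈ wedge ℓ, Φ t = Ψ t := fun t ht => by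
    simp only [hΦ, hpos, wedgeRetr_of_mem ht]; abel
  have happ : ApproximatesLinearOn Φ (A : G →L[ℝ] G') U (κ * K) := by
    intro x hx y hy
    have h1 : Φ x - Φ y - (A : G →L[ℝ] G') (x - y)
        = Ψ (pos x) - Ψ (pos y) - A (pos x - pos y) := by
      simp only [hΦ, ContinuousLinearEquiv.coe_coe, map_sub]; abel
    rw [h1]
    refine (hlin _ ⟨hy.2, wedgeRetr_mem hv _⟩ _ ⟨hx.2, wedgeRetr_mem hv _⟩).trans ?_
    rw [NNReal.coe_mul, mul_assoc]
    refine mul_le_mul_of_nonneg_left ?_ κ.2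
    simpa [dist_eq_norm] using hK.dist_le_mul x y
  set e := happ.toOpenPartialHomeomorph Φ U hκN hUo with he
  have hes : e.source = U := rfl
  have heΦ : ∀ t, e t = Φ t := fun t => rfl
  -- No point outside the wedge is sent into the target wedge: if `ℓ i t < 0`, the retraction puts
  -- `t` on the `i`-th face, and what remains of `m i (Φ t)` is `c i * ℓ i t < 0`.
  have hsign : ∀ t ∈ U, Φ t ∈ wedge m → t ∈ wedge ℓ := by
    intro t ht htm i
    by_contra hlt
    push Not at hlt
    have h1 : ℓ i (pos t) = 0 := by rw [hpos, apply_wedgeRetr hv, max_eq_right hlt.le]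
    have h2 : m i (Ψ (pos t)) = 0 := (hm _ ⟨hrT ht.2, wedgeRetr_mem hv _⟩ i).2.2 h1
    have h3 : m i (Φ t) = c i * ℓ i t := by
      simp only [hΦ, map_add, map_sub, h2, hcA, h1]; ring
    have h4 := htm i
    rw [h3] at h4
    nlinarith [hc i]
  refine ⟨U, e.target, e.symm, hUo, e.open_target, ht₀U, fun t ht => hrT ht.1, ?_, ?_, ?_⟩
  · intro t ht
    have h1 : e t = Ψ t := hΦS t ht.2
    refine ⟨⟨?_, fun i => (hm t ⟨hrT ht.1.1, ht.2⟩ i).1⟩, ?_⟩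
    · rw [← h1]; exact e.map_source ht.1
    · rw [← h1]; exact e.left_inv ht.1
  · intro y hy
    have h1 : e.symm y ∈ U := e.map_target hy.1
    have h2 : Φ (e.symm y) = y := e.right_inv hy.1
    have h3 : e.symm y ∈ wedge ℓ := hsign _ h1 (by rw [h2]; exact hy.2)
    exact ⟨⟨h1, h3⟩, by rw [← hΦS _ h3, h2]⟩
  · have hu2 : UniqueDiffOn ℝ (U ∩ wedge ℓ) := by
      rw [inter_comm]; exact (uniqueDiffOn_wedge hv).inter hUo
    -- `Φ` is not known to be smooth off the wedge, so the local homeomorphism theorem gives only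
    -- continuity of the inverse. On the target wedge the inverse is also a right inverse of the
    -- smooth map `Ψ`, which upgrades it.
    refine ContDiffOn.of_rightInverse hu2 (hsm.mono (inter_subset_inter_left _ fun t ht => hrT ht.1))
      (e.continuousOn_symm.mono inter_subset_left) ?_ ?_ ?_
    · intro y hy
      have h1 : e.symm y ∈ U := e.map_target hy.1
      exact ⟨h1, hsign _ h1 (by rw [← heΦ, e.right_inv hy.1]; exact hy.2)⟩
    · intro y hy
      have h1 : e.symm y ∈ U := e.map_target hy.1
      have h2 : Φ (e.symm y) = y := e.right_inv hy.1
      rw [← hΦS _ (hsign _ h1 (by rw [h2]; exact hy.2)), h2]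
    · intro t ht
      obtain ⟨B, hB⟩ := (hgood t ⟨ht.1.1, ht.2⟩).2
      refine ⟨B, ?_⟩
      rw [hB]
      refine fderivWithin_congr_set ?_
      filter_upwards [hUo.mem_nhds ht.1, hT.mem_nhds (hrT ht.1.1)] with z hz1 hz2
      exact propext ⟨fun h => ⟨hz2, h.2⟩, fun h => ⟨hz1, h.2⟩⟩

end WedgeInverse

/-! ### Doubling the angle of a pair of coordinates -/

section PlaneAngle

/-- The coordinate `r sin 2θ` of the point of the plane with polar coordinates `(r, 2θ)`. -/
def dblSin (a b : ℝ) : ℝ := 2 * a * b / √(a ^ 2 + b ^ 2)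

/-- The coordinate `r cos 2θ` of the point of the plane with polar coordinates `(r, 2θ)`. -/
def dblCos (a b : ℝ) : ℝ := (a ^ 2 - b ^ 2) / √(a ^ 2 + b ^ 2)

/-- The coordinate `r cos (θ / 2)` of the point with Cartesian coordinates `(v, u)`. -/
def halfCos (u v : ℝ) : ℝ := √(√(u ^ 2 + v ^ 2) * (√(u ^ 2 + v ^ 2) + v) / 2)

/-- The coordinate `r sin (θ / 2)` of the point with Cartesian coordinates `(v, u)`. -/
def halfSin (u v : ℝ) : ℝ := √(√(u ^ 2 + v ^ 2) * (√(u ^ 2 + v ^ 2) - v) / 2)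

theorem dblSin_comm (a b : ℝ) : dblSin a b = dblSin b a := by
  simp only [dblSin, add_comm (b ^ 2)]; ring

theorem dblCos_comm (a b : ℝ) : dblCos a b = -dblCos b a := by
  simp only [dblCos, add_comm (b ^ 2)]; ring

theorem dblSin_nonneg {a b : ℝ} (ha : 0 ≤ a) (hb : 0 ≤ b) : 0 ≤ dblSin a b := by
  unfold dblSin; positivity

theorem sq_add_sq_pos {a b : ℝ} (h : ¬(a = 0 ∧ b = 0)) : 0 < a ^ 2 + b ^ 2 := by
  rcases eq_or_ne a 0 with rfl | ha
  · have : b ≠ 0 := fun hb => h ⟨rfl, hb⟩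
    positivity
  · positivity

theorem dbl_sq_add_sq (a b : ℝ) : dblSin a b ^ 2 + dblCos a b ^ 2 = a ^ 2 + b ^ 2 := by
  by_cases h : a = 0 ∧ b = 0
  · simp [dblSin, dblCos, h.1, h.2]
  · have h2 := sq_add_sq_pos h
    rw [dblSin, dblCos, div_pow, div_pow, Real.sq_sqrt h2.le]
    field_simp
    ring

theorem dblSin_eq_zero_iff (a b : ℝ) : dblSin a b = 0 ↔ a = 0 ∨ b = 0 := by
  by_cases h : a = 0 ∧ b = 0
  · simp [dblSin, h.1, h.2]
  · have h2 := Real.sqrt_pos.2 (sq_add_sq_pos h)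
    simp [dblSin, h2.ne']

theorem dbl_eq_zero_iff (a b : ℝ) : dblSin a b = 0 ∧ dblCos a b = 0 ↔ a = 0 ∧ b = 0 := by
  constructor
  · rintro ⟨h1, h2⟩
    have := dbl_sq_add_sq a b
    rw [h1, h2] at this
    constructor <;> nlinarith [sq_nonneg a, sq_nonneg b]
  · rintro ⟨rfl, rfl⟩
    simp [dblSin, dblCos]

theorem abs_le_sqrt_sq_add_sq (u v : ℝ) : |v| ≤ √(u ^ 2 + v ^ 2) :=
  Real.abs_le_sqrt (by nlinarith [sq_nonneg u])

theorem halfCos_nonneg (u v : ℝ) : 0 ≤ halfCos u v := Real.sqrt_nonneg _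

theorem halfSin_nonneg (u v : ℝ) : 0 ≤ halfSin u v := Real.sqrt_nonneg _

theorem halfCos_sq (u v : ℝ) :
    halfCos u v ^ 2 = √(u ^ 2 + v ^ 2) * (√(u ^ 2 + v ^ 2) + v) / 2 := by
  have := abs_le.1 (abs_le_sqrt_sq_add_sq u v)
  exact Real.sq_sqrt (div_nonneg (mul_nonneg (Real.sqrt_nonneg _) (by linarith)) (by norm_num))

theorem halfSin_sq (u v : ℝ) :
    halfSin u v ^ 2 = √(u ^ 2 + v ^ 2) * (√(u ^ 2 + v ^ 2) - v) / 2 := by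
  have := abs_le.1 (abs_le_sqrt_sq_add_sq u v)
  exact Real.sq_sqrt (div_nonneg (mul_nonneg (Real.sqrt_nonneg _) (by linarith)) (by norm_num))

theorem half_sq_add_sq (u v : ℝ) : halfCos u v ^ 2 + halfSin u v ^ 2 = u ^ 2 + v ^ 2 := by
  rw [halfCos_sq, halfSin_sq]
  have := Real.sq_sqrt (show 0 ≤ u ^ 2 + v ^ 2 by positivity)
  nlinarith

theorem two_mul_halfCos_mul_halfSin {u : ℝ} (hu : 0 ≤ u) (v : ℝ) :
    2 * halfCos u v * halfSin u v = √(u ^ 2 + v ^ 2) * u := by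
  have h0 := Real.sq_sqrt (show 0 ≤ u ^ 2 + v ^ 2 by positivity)
  refine (pow_left_inj₀ (mul_nonneg (mul_nonneg zero_le_two (halfCos_nonneg _ _))
    (halfSin_nonneg _ _)) (mul_nonneg (Real.sqrt_nonneg _) hu) two_ne_zero).1 ?_
  rw [mul_pow, mul_pow, halfCos_sq, halfSin_sq, mul_pow]
  have : (√(u ^ 2 + v ^ 2) + v) * (√(u ^ 2 + v ^ 2) - v) = u ^ 2 := by nlinarith
  calc _ = √(u ^ 2 + v ^ 2) ^ 2 * ((√(u ^ 2 + v ^ 2) + v) * (√(u ^ 2 + v ^ 2) - v)) := by ring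
    _ = _ := by rw [this]

theorem dblSin_half {u : ℝ} (hu : 0 ≤ u) (v : ℝ) : dblSin (halfCos u v) (halfSin u v) = u := by
  rw [dblSin, half_sq_add_sq, two_mul_halfCos_mul_halfSin hu]
  by_cases h : u = 0 ∧ v = 0
  · simp [h.1, h.2]
  · have h2 := Real.sqrt_pos.2 (sq_add_sq_pos h)
    field_simp

theorem dblCos_half (u v : ℝ) : dblCos (halfCos u v) (halfSin u v) = v := by
  rw [dblCos, half_sq_add_sq, halfCos_sq, halfSin_sq]
  by_cases h : u = 0 ∧ v = 0
  · simp [h.1, h.2]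
  · have h2 := Real.sqrt_pos.2 (sq_add_sq_pos h)
    field_simp
    ring

theorem halfCos_dbl {a : ℝ} (ha : 0 ≤ a) (b : ℝ) : halfCos (dblSin a b) (dblCos a b) = a := by
  rw [halfCos, dbl_sq_add_sq]
  by_cases h : a = 0 ∧ b = 0
  · simp [h.1, h.2]
  · have h2 := Real.sqrt_pos.2 (sq_add_sq_pos h)
    have h3 := Real.sq_sqrt (sq_add_sq_pos h).le
    rw [Real.sqrt_eq_iff_mul_self_eq]
    · rw [dblCos]; field_simp; nlinarith
    · rw [dblCos]
      have : √(a ^ 2 + b ^ 2) * (√(a ^ 2 + b ^ 2) + (a ^ 2 - b ^ 2) / √(a ^ 2 + b ^ 2)) / 2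
        = a ^ 2 := by field_simp; nlinarith
      rw [this]; positivity
    · exact ha

theorem halfSin_dbl {b : ℝ} (a : ℝ) (hb : 0 ≤ b) : halfSin (dblSin a b) (dblCos a b) = b := by
  have : halfSin (dblSin a b) (dblCos a b) = halfCos (dblSin b a) (dblCos b a) := by
    rw [halfSin, halfCos, dblSin_comm, dblCos_comm a b]
    congr 3
    · simp
    · simp
  rw [this, halfCos_dbl hb]

theorem continuous_halfCos : Continuous fun p : ℝ × ℝ => halfCos p.1 p.2 := by
  unfold halfCos; fun_prop

theorem continuous_halfSin : Continuous fun p : ℝ × ℝ => halfSin p.1 p.2 := by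
  unfold halfSin; fun_prop

theorem contDiffAt_dblSin {a b : ℝ} (h : ¬(a = 0 ∧ b = 0)) :
    ContDiffAt ℝ ∞ (fun p : ℝ × ℝ => dblSin p.1 p.2) (a, b) := by
  have h2 := sq_add_sq_pos h
  unfold dblSin
  refine ContDiffAt.div (by fun_prop) ?_ (Real.sqrt_pos.2 h2).ne'
  exact ContDiffAt.sqrt (by fun_prop) h2.ne'

theorem contDiffAt_dblCos {a b : ℝ} (h : ¬(a = 0 ∧ b = 0)) :
    ContDiffAt ℝ ∞ (fun p : ℝ × ℝ => dblCos p.1 p.2) (a, b) := by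
  have h2 := sq_add_sq_pos h
  unfold dblCos
  refine ContDiffAt.div (by fun_prop) ?_ (Real.sqrt_pos.2 h2).ne'
  exact ContDiffAt.sqrt (by fun_prop) h2.ne'

/-- The formulas for the doubled angle divide by zero at the origin, where Lean's value is 0; the
bound by the radius makes this the correct limit. -/
theorem continuous_of_abs_le_sqrt {f : ℝ × ℝ → ℝ} (hf : ∀ p, |f p| ≤ √(p.1 ^ 2 + p.2 ^ 2))
    (h : ∀ p : ℝ × ℝ, ¬(p.1 = 0 ∧ p.2 = 0) → ContinuousAt f p) : Continuous f := by
  rw [continuous_iff_continuousAt]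
  intro p
  by_cases hp : p.1 = 0 ∧ p.2 = 0
  · have h0 : f p = 0 := by simpa [hp.1, hp.2] using hf p
    rw [ContinuousAt, h0]
    refine squeeze_zero_norm hf ?_
    have : Continuous fun p : ℝ × ℝ => √(p.1 ^ 2 + p.2 ^ 2) := by fun_prop
    simpa [hp.1, hp.2] using this.tendsto p
  · exact h p hp

theorem continuous_dblSin : Continuous fun p : ℝ × ℝ => dblSin p.1 p.2 :=
  continuous_of_abs_le_sqrt
    (fun p => Real.abs_le_sqrt (by nlinarith [dbl_sq_add_sq p.1 p.2, sq_nonneg (dblCos p.1 p.2)]))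
    fun _ hp => (contDiffAt_dblSin hp).continuousAt

theorem continuous_dblCos : Continuous fun p : ℝ × ℝ => dblCos p.1 p.2 :=
  continuous_of_abs_le_sqrt
    (fun p => Real.abs_le_sqrt (by nlinarith [dbl_sq_add_sq p.1 p.2, sq_nonneg (dblSin p.1 p.2)]))
    fun _ hp => (contDiffAt_dblCos hp).continuousAt

theorem contDiffAt_halfCos {u v : ℝ} (h : 0 < √(u ^ 2 + v ^ 2) + v) (h0 : ¬(u = 0 ∧ v = 0)) :
    ContDiffAt ℝ ∞ (fun p : ℝ × ℝ => halfCos p.1 p.2) (u, v) := by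
  have h2 := sq_add_sq_pos h0
  have h3 := Real.sqrt_pos.2 h2
  have hs : ContDiffAt ℝ ∞ (fun p : ℝ × ℝ => √(p.1 ^ 2 + p.2 ^ 2)) (u, v) :=
    ContDiffAt.sqrt (by fun_prop) h2.ne'
  unfold halfCos
  exact ContDiffAt.sqrt ((hs.mul (hs.add contDiffAt_snd)).div_const 2) (by positivity)

theorem contDiffAt_halfSin {u v : ℝ} (h : 0 < √(u ^ 2 + v ^ 2) - v) (h0 : ¬(u = 0 ∧ v = 0)) :
    ContDiffAt ℝ ∞ (fun p : ℝ × ℝ => halfSin p.1 p.2) (u, v) := by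
  have h2 := sq_add_sq_pos h0
  have h3 := Real.sqrt_pos.2 h2
  have hs : ContDiffAt ℝ ∞ (fun p : ℝ × ℝ => √(p.1 ^ 2 + p.2 ^ 2)) (u, v) :=
    ContDiffAt.sqrt (by fun_prop) h2.ne'
  unfold halfSin
  exact ContDiffAt.sqrt ((hs.mul (hs.sub contDiffAt_snd)).div_const 2) (by positivity)

/-- Each half-angle coordinate is a square root that degenerates on one half of the axis `u = 0`.
Off the origin at least one of the two radicands is positive, and the other coordinate is recovered
smoothly by dividing `r u = 2 * halfCos * halfSin` (with `r = √(u² + v²)`) by the good one; this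
identity needs `0 ≤ u`. -/
theorem contDiffWithinAt_half {u v : ℝ} (hu : 0 ≤ u) (h0 : ¬(u = 0 ∧ v = 0)) :
    ContDiffWithinAt ℝ ∞ (fun p : ℝ × ℝ => halfCos p.1 p.2) {p | 0 ≤ p.1} (u, v) ∧
    ContDiffWithinAt ℝ ∞ (fun p : ℝ × ℝ => halfSin p.1 p.2) {p | 0 ≤ p.1} (u, v) := by
  have h2 := sq_add_sq_pos h0
  have h3 := Real.sqrt_pos.2 h2
  have hs : ContDiffAt ℝ ∞ (fun p : ℝ × ℝ => √(p.1 ^ 2 + p.2 ^ 2)) (u, v) :=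
    ContDiffAt.sqrt (by fun_prop) h2.ne'
  rcases lt_or_ge 0 (√(u ^ 2 + v ^ 2) + v) with h | h
  · have hc := contDiffAt_halfCos h h0
    have hpos : 0 < halfCos u v := Real.sqrt_pos.2 (by positivity)
    refine ⟨hc.contDiffWithinAt, ?_⟩
    have hd : ContDiffAt ℝ ∞
        (fun p : ℝ × ℝ => √(p.1 ^ 2 + p.2 ^ 2) * p.1 / (2 * halfCos p.1 p.2)) (u, v) :=
      (hs.mul contDiffAt_fst).div (contDiffAt_const.mul hc) (by positivity)
    refine hd.contDiffWithinAt.congr_of_eventuallyEq ?_ ?_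
    · filter_upwards [nhdsWithin_le_nhds (hc.continuousAt.eventually (lt_mem_nhds hpos)),
        self_mem_nhdsWithin] with p hp1 hp2
      rw [← two_mul_halfCos_mul_halfSin hp2]
      field_simp
    · rw [← two_mul_halfCos_mul_halfSin hu]
      field_simp
  · have h' : 0 < √(u ^ 2 + v ^ 2) - v := by linarith
    have hc := contDiffAt_halfSin h' h0
    have hpos : 0 < halfSin u v := Real.sqrt_pos.2 (by positivity)
    refine ⟨?_, hc.contDiffWithinAt⟩
    have hd : ContDiffAt ℝ ∞
        (fun p : ℝ × ℝ => √(p.1 ^ 2 + p.2 ^ 2) * p.1 / (2 * halfSin p.1 p.2)) (u, v) :=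
      (hs.mul contDiffAt_fst).div (contDiffAt_const.mul hc) (by positivity)
    refine hd.contDiffWithinAt.congr_of_eventuallyEq ?_ ?_
    · filter_upwards [nhdsWithin_le_nhds (hc.continuousAt.eventually (lt_mem_nhds hpos)),
        self_mem_nhdsWithin] with p hp1 hp2
      rw [← two_mul_halfCos_mul_halfSin hp2]
      field_simp
    · rw [← two_mul_halfCos_mul_halfSin hu]
      field_simp

end PlaneAngle

/-! ### Straightening of a pair of coordinates in Euclidean space -/

section StraightenPair

variable {m : ℕ}

/-- The inverse of `straightenPair k`. -/
def foldPair {m : ℕ} (k : ℕ) (y : EuclideanSpace ℝ (Fin m)) : EuclideanSpace ℝ (Fin m) :=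
  if h : k + 1 < m then
    let u : ℝ := y ⟨k, (Nat.lt_succ_self k).trans h⟩
    let v : ℝ := y ⟨k + 1, h⟩
    WithLp.toLp 2 fun l =>
      if (l : ℕ) = k then halfCos u v
      else if (l : ℕ) = k + 1 then halfSin u v
      else y l
  else y

/-- Multiplication of the coordinates with index in `[l, k)` by `s`. -/
def scaleOn (l k : ℕ) (s : ℝ) (x : EuclideanSpace ℝ (Fin m)) : EuclideanSpace ℝ (Fin m) :=
  WithLp.toLp 2 fun i => if l ≤ (i : ℕ) ∧ (i : ℕ) < k then s * x i else x i

theorem scaleOn_apply (l k : ℕ) (s : ℝ) (x : EuclideanSpace ℝ (Fin m)) (i : Fin m) :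
    scaleOn l k s x i = if l ≤ (i : ℕ) ∧ (i : ℕ) < k then s * x i else x i := rfl

theorem scaleOn_apply_of_mem {l k : ℕ} (s : ℝ) (x : EuclideanSpace ℝ (Fin m)) {i : Fin m}
    (h1 : l ≤ (i : ℕ)) (h2 : (i : ℕ) < k) : scaleOn l k s x i = s * x i := by
  rw [scaleOn_apply, if_pos ⟨h1, h2⟩]

theorem scaleOn_zero_idem (l k : ℕ) (x : EuclideanSpace ℝ (Fin m)) :
    scaleOn l k 0 (scaleOn l k 0 x) = scaleOn l k 0 x := by
  ext i; simp only [scaleOn_apply]; split_ifs <;> simp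

theorem scaleOn_one (l k : ℕ) (x : EuclideanSpace ℝ (Fin m)) : scaleOn l k 1 x = x := by
  ext i; simp [scaleOn_apply]

theorem scaleOn_eq_self {l k : ℕ} (s : ℝ) {x : EuclideanSpace ℝ (Fin m)}
    (h : ∀ i : Fin m, l ≤ (i : ℕ) → (i : ℕ) < k → x i = 0) : scaleOn l k s x = x := by
  ext i
  rw [scaleOn_apply]
  split_ifs with hi
  · rw [h i hi.1 hi.2, mul_zero]
  · rfl

theorem scaleOn_mem_cornerSector {l k k' : ℕ} {s : ℝ} (hs : 0 ≤ s)
    {x : EuclideanSpace ℝ (Fin m)} (hx : x ∈ cornerSector m k') :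
    scaleOn l k s x ∈ cornerSector m k' := fun i hi => by
  rw [scaleOn_apply]
  split_ifs
  · exact mul_nonneg hs (hx i hi)
  · exact hx i hi

theorem contDiff_scaleOn (l k : ℕ) :
    ContDiff ℝ ∞ fun p : ℝ × EuclideanSpace ℝ (Fin m) => scaleOn l k p.1 p.2 := by
  rw [contDiff_euclidean]
  intro i
  simp only [scaleOn_apply]
  split_ifs <;> fun_prop

/-- Scaling moves coordinates towards those of a centre at which they vanish, so balls around such
centres are stable under it. -/
theorem dist_scaleOn_le {l k : ℕ} {s : ℝ} (hs : 0 ≤ s) (hs1 : s ≤ 1)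
    {x t : EuclideanSpace ℝ (Fin m)}
    (h : ∀ i : Fin m, l ≤ (i : ℕ) → (i : ℕ) < k → t i = 0) :
    dist (scaleOn l k s x) t ≤ dist x t := by
  rw [EuclideanSpace.dist_eq, EuclideanSpace.dist_eq]
  refine Real.sqrt_le_sqrt (Finset.sum_le_sum fun i _ => ?_)
  rw [scaleOn_apply]
  split_ifs with hi
  · rw [h i hi.1 hi.2, Real.dist_eq, Real.dist_eq, sub_zero, sub_zero, abs_mul, abs_of_nonneg hs]
    gcongr
    exact mul_le_of_le_one_left (abs_nonneg _) hs1
  · exact le_rfl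

theorem straightenPair_apply {k : ℕ} (h : k + 1 < m) (x : EuclideanSpace ℝ (Fin m)) (i : Fin m) :
    straightenPair k x i = if (i : ℕ) = k then
      dblSin (x ⟨k, (Nat.lt_succ_self k).trans h⟩) (x ⟨k + 1, h⟩)
      else if (i : ℕ) = k + 1 then
      dblCos (x ⟨k, (Nat.lt_succ_self k).trans h⟩) (x ⟨k + 1, h⟩) else x i := by
  rw [straightenPair, dif_pos h]; rfl

theorem foldPair_apply {k : ℕ} (h : k + 1 < m) (x : EuclideanSpace ℝ (Fin m)) (i : Fin m) :
    foldPair k x i = if (i : ℕ) = k then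
      halfCos (x ⟨k, (Nat.lt_succ_self k).trans h⟩) (x ⟨k + 1, h⟩)
      else if (i : ℕ) = k + 1 then
      halfSin (x ⟨k, (Nat.lt_succ_self k).trans h⟩) (x ⟨k + 1, h⟩) else x i := by
  rw [foldPair, dif_pos h]

theorem straightenPair_fst {k : ℕ} (h : k + 1 < m) (x : EuclideanSpace ℝ (Fin m)) :
    straightenPair k x ⟨k, (Nat.lt_succ_self k).trans h⟩ =
      dblSin (x ⟨k, (Nat.lt_succ_self k).trans h⟩) (x ⟨k + 1, h⟩) := by
  simp [straightenPair_apply h]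

theorem straightenPair_snd {k : ℕ} (h : k + 1 < m) (x : EuclideanSpace ℝ (Fin m)) :
    straightenPair k x ⟨k + 1, h⟩ =
      dblCos (x ⟨k, (Nat.lt_succ_self k).trans h⟩) (x ⟨k + 1, h⟩) := by
  simp [straightenPair_apply h]

theorem straightenPair_of_ne {k : ℕ} (h : k + 1 < m) (x : EuclideanSpace ℝ (Fin m)) {i : Fin m}
    (h1 : (i : ℕ) ≠ k) (h2 : (i : ℕ) ≠ k + 1) : straightenPair k x i = x i := by
  rw [straightenPair_apply h, if_neg h1, if_neg h2]

theorem foldPair_fst {k : ℕ} (h : k + 1 < m) (x : EuclideanSpace ℝ (Fin m)) :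
    foldPair k x ⟨k, (Nat.lt_succ_self k).trans h⟩ =
      halfCos (x ⟨k, (Nat.lt_succ_self k).trans h⟩) (x ⟨k + 1, h⟩) := by
  simp [foldPair_apply h]

theorem foldPair_snd {k : ℕ} (h : k + 1 < m) (x : EuclideanSpace ℝ (Fin m)) :
    foldPair k x ⟨k + 1, h⟩ =
      halfSin (x ⟨k, (Nat.lt_succ_self k).trans h⟩) (x ⟨k + 1, h⟩) := by
  simp [foldPair_apply h]

theorem foldPair_of_ne {k : ℕ} (h : k + 1 < m) (x : EuclideanSpace ℝ (Fin m)) {i : Fin m}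
    (h1 : (i : ℕ) ≠ k) (h2 : (i : ℕ) ≠ k + 1) : foldPair k x i = x i := by
  rw [foldPair_apply h, if_neg h1, if_neg h2]

theorem straightenPair_mem {k : ℕ} (h : k + 1 < m) {x : EuclideanSpace ℝ (Fin m)}
    (hx : x ∈ cornerSector m (k + 2)) : straightenPair k x ∈ cornerSector m (k + 1) := by
  intro i hi
  rw [straightenPair_apply h]
  split_ifs with h1 h2
  · exact dblSin_nonneg (hx _ (by simp)) (hx _ (by simp))
  · omega
  · exact hx i (by omega)

theorem foldPair_mem {k : ℕ} (h : k + 1 < m) {x : EuclideanSpace ℝ (Fin m)}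
    (hx : x ∈ cornerSector m (k + 1)) : foldPair k x ∈ cornerSector m (k + 2) := by
  intro i hi
  rw [foldPair_apply h]
  split_ifs with h1 h2
  · exact halfCos_nonneg _ _
  · exact halfSin_nonneg _ _
  · exact hx i (by omega)

theorem foldPair_straightenPair {k : ℕ} (h : k + 1 < m) {x : EuclideanSpace ℝ (Fin m)}
    (hx : x ∈ cornerSector m (k + 2)) : foldPair k (straightenPair k x) = x := by
  ext i
  rw [foldPair_apply h, straightenPair_fst h, straightenPair_snd h]
  split_ifs with h1 h2
  · rw [halfCos_dbl (hx _ (by simp)), show (⟨k, (Nat.lt_succ_self k).trans h⟩ : Fin m) = i from Fin.ext h1.symm]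
  · rw [halfSin_dbl _ (hx _ (by simp)), show (⟨k + 1, h⟩ : Fin m) = i from Fin.ext h2.symm]
  · exact straightenPair_of_ne h _ h1 h2

theorem straightenPair_foldPair {k : ℕ} (h : k + 1 < m) {x : EuclideanSpace ℝ (Fin m)}
    (hx : x ∈ cornerSector m (k + 1)) : straightenPair k (foldPair k x) = x := by
  ext i
  rw [straightenPair_apply h, foldPair_fst h, foldPair_snd h]
  split_ifs with h1 h2
  · rw [dblSin_half (hx _ (by simp)), show (⟨k, (Nat.lt_succ_self k).trans h⟩ : Fin m) = i from Fin.ext h1.symm]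
  · rw [dblCos_half, show (⟨k + 1, h⟩ : Fin m) = i from Fin.ext h2.symm]
  · exact foldPair_of_ne h _ h1 h2

theorem continuous_euclidean_of_forall {X : Type*} [TopologicalSpace X]
    {f : X → EuclideanSpace ℝ (Fin m)} (h : ∀ i, Continuous fun x => f x i) : Continuous f :=
  (PiLp.continuous_toLp 2 fun _ => ℝ).comp (continuous_pi h)

theorem continuous_straightenPair {k : ℕ} (h : k + 1 < m) :
    Continuous (straightenPair (m := m) k) := by
  refine continuous_euclidean_of_forall fun i => ?_
  · simp only [straightenPair_apply h]
    split_ifs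
    · exact continuous_dblSin.comp (f := fun x : EuclideanSpace ℝ (Fin m) =>
        (x ⟨k, (Nat.lt_succ_self k).trans h⟩, x ⟨k + 1, h⟩)) (by fun_prop)
    · exact continuous_dblCos.comp (f := fun x : EuclideanSpace ℝ (Fin m) =>
        (x ⟨k, (Nat.lt_succ_self k).trans h⟩, x ⟨k + 1, h⟩)) (by fun_prop)
    · fun_prop

theorem continuous_foldPair {k : ℕ} (h : k + 1 < m) :
    Continuous (foldPair (m := m) k) := by
  refine continuous_euclidean_of_forall fun i => ?_
  · simp only [foldPair_apply h]
    split_ifs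
    · exact continuous_halfCos.comp (f := fun x : EuclideanSpace ℝ (Fin m) =>
        (x ⟨k, (Nat.lt_succ_self k).trans h⟩, x ⟨k + 1, h⟩)) (by fun_prop)
    · exact continuous_halfSin.comp (f := fun x : EuclideanSpace ℝ (Fin m) =>
        (x ⟨k, (Nat.lt_succ_self k).trans h⟩, x ⟨k + 1, h⟩)) (by fun_prop)
    · fun_prop

theorem contDiffAt_straightenPair {k : ℕ} (h : k + 1 < m) {x : EuclideanSpace ℝ (Fin m)}
    (hx : ¬(x ⟨k, (Nat.lt_succ_self k).trans h⟩ = 0 ∧ x ⟨k + 1, h⟩ = 0)) :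
    ContDiffAt ℝ ∞ (straightenPair k) x := by
  rw [contDiffAt_euclidean]
  intro i
  simp only [straightenPair_apply h]
  have hp : ContDiffAt ℝ ∞ (fun x : EuclideanSpace ℝ (Fin m) =>
    (x ⟨k, (Nat.lt_succ_self k).trans h⟩, x ⟨k + 1, h⟩)) x := by fun_prop
  split_ifs with h1 h2
  · exact ContDiffAt.comp (g := fun p : ℝ × ℝ => dblSin p.1 p.2) x (contDiffAt_dblSin hx) hp
  · exact ContDiffAt.comp (g := fun p : ℝ × ℝ => dblCos p.1 p.2) x (contDiffAt_dblCos hx) hp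
  · fun_prop

theorem contDiffWithinAt_foldPair {k : ℕ} (h : k + 1 < m) {x : EuclideanSpace ℝ (Fin m)}
    (hx0 : x ∈ cornerSector m (k + 1))
    (hx : ¬(x ⟨k, (Nat.lt_succ_self k).trans h⟩ = 0 ∧ x ⟨k + 1, h⟩ = 0)) :
    ContDiffWithinAt ℝ ∞ (foldPair k) (cornerSector m (k + 1)) x := by
  rw [contDiffWithinAt_euclidean]
  intro i
  simp only [foldPair_apply h]
  have hp : ContDiffAt ℝ ∞ (fun x : EuclideanSpace ℝ (Fin m) =>
    (x ⟨k, (Nat.lt_succ_self k).trans h⟩, x ⟨k + 1, h⟩)) x := by fun_prop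
  have hm : MapsTo (fun x : EuclideanSpace ℝ (Fin m) =>
    (x ⟨k, (Nat.lt_succ_self k).trans h⟩, x ⟨k + 1, h⟩)) (cornerSector m (k + 1))
    {p : ℝ × ℝ | 0 ≤ p.1} := fun y hy => hy _ (by simp)
  have hh := contDiffWithinAt_half (hx0 ⟨k, (Nat.lt_succ_self k).trans h⟩ (by simp)) hx
  split_ifs with h1 h2
  · exact ContDiffWithinAt.comp (g := fun p : ℝ × ℝ => halfCos p.1 p.2) x hh.1
      hp.contDiffWithinAt hm
  · exact ContDiffWithinAt.comp (g := fun p : ℝ × ℝ => halfSin p.1 p.2) x hh.2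
      hp.contDiffWithinAt hm
  · exact ContDiffAt.contDiffWithinAt (by fun_prop)

end StraightenPair

/-! ### Corner charts and atlases on topological spaces -/

/-- A corner chart of a topological space: a homeomorphism of an open subset with a relatively open
subset of a sector. -/
structure CornerChart (Y : Type*) [TopologicalSpace Y] (m : ℕ) where
  k : ℕ
  dom : Set Y
  cod : Set (EuclideanSpace ℝ (Fin m))
  toFun : Y → EuclideanSpace ℝ (Fin m)
  inv : EuclideanSpace ℝ (Fin m) → Y
  isOpen_dom : IsOpen dom
  isOpen_cod : IsOpen cod
  map_mem : ∀ q ∈ dom, toFun q ∈ cod ∩ cornerSector m k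
  inv_mem : ∀ t ∈ cod ∩ cornerSector m k, inv t ∈ dom
  left_inv : ∀ q ∈ dom, inv (toFun q) = q
  right_inv : ∀ t ∈ cod ∩ cornerSector m k, toFun (inv t) = t
  continuousOn_toFun : ContinuousOn toFun dom
  continuousOn_inv : ContinuousOn inv (cod ∩ cornerSector m k)

namespace CornerChart

variable {Y Y' Y'' : Type*} [TopologicalSpace Y] [TopologicalSpace Y'] [TopologicalSpace Y'']
  {m : ℕ}

/-- The image of a corner chart. -/
def tgt (c : CornerChart Y m) : Set (EuclideanSpace ℝ (Fin m)) := c.cod ∩ cornerSector m c.k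

theorem continuousAt_toFun (c : CornerChart Y m) {q : Y} (hq : q ∈ c.dom) :
    ContinuousAt c.toFun q := c.continuousOn_toFun.continuousAt (c.isOpen_dom.mem_nhds hq)

theorem tendsto_inv (c : CornerChart Y m) {q : Y} (hq : q ∈ c.dom) :
    Filter.Tendsto c.inv (𝓝[c.tgt] (c.toFun q)) (𝓝 q) := by
  have := c.continuousOn_inv _ (c.map_mem q hq)
  rwa [ContinuousWithinAt, c.left_inv q hq] at this

theorem eventually_inv (c : CornerChart Y m) {q : Y} (hq : q ∈ c.dom) {p : Y → Prop}
    (h : ∀ᶠ y in 𝓝 q, p y) : ∀ᶠ t in 𝓝[c.tgt] (c.toFun q), p (c.inv t) :=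
  (c.tendsto_inv hq).eventually h

variable {V : Type*} [NormedAddCommGroup V] [NormedSpace ℝ V]

/-- The vector valued function `f` is smooth at `q`, when read in the chart `c`. -/
def SmoothFn (c : CornerChart Y m) (f : Y → V) (q : Y) : Prop :=
  ContDiffWithinAt ℝ ∞ (fun t => f (c.inv t)) c.tgt (c.toFun q)

/-- The map `g` is smooth at `q`, when read in the charts `c` and `d`. -/
def SmoothVia (c : CornerChart Y m) (d : CornerChart Y' m) (g : Y → Y') (q : Y) : Prop :=
  c.SmoothFn (fun y => d.toFun (g y)) q

theorem SmoothFn.congr {c : CornerChart Y m} {f f' : Y → V} {q : Y} (hq : q ∈ c.dom)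
    (h : c.SmoothFn f q) (hf : f' =ᶠ[𝓝 q] f) : c.SmoothFn f' q := by
  refine ContDiffWithinAt.congr_of_eventuallyEq h (c.eventually_inv hq hf) ?_
  rw [c.left_inv q hq]
  exact hf.self_of_nhds

theorem SmoothVia.congr {c : CornerChart Y m} {d : CornerChart Y' m} {g g' : Y → Y'} {q : Y}
    (hq : q ∈ c.dom) (h : c.SmoothVia d g q) (hg : g' =ᶠ[𝓝 q] g) : c.SmoothVia d g' q :=
  SmoothFn.congr hq h (hg.fun_comp d.toFun)

theorem SmoothVia.comp_fn {c : CornerChart Y m} {d : CornerChart Y' m} {f : Y' → V}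
    {g : Y → Y'} {q : Y} (hq : q ∈ c.dom) (hgq : g q ∈ d.dom)
    (hg : ContinuousAt g q) (h : c.SmoothVia d g q) (h' : d.SmoothFn f (g q)) :
    c.SmoothFn (fun y => f (g y)) q := by
  have hev : ∀ᶠ y in 𝓝 q, g y ∈ d.dom := hg.eventually (d.isOpen_dom.mem_nhds hgq)
  have h2 : c.SmoothFn (fun y => f (d.inv (d.toFun (g y)))) q := by
    refine ContDiffWithinAt.comp_of_preimage_mem_nhdsWithin_of_eq
      (g := fun s => f (d.inv s)) (t := d.tgt) _ h' h ?_ ?_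
    · filter_upwards [c.eventually_inv hq hev] with t ht using d.map_mem _ ht
    · rw [c.left_inv q hq]
  exact h2.congr hq (hev.mono fun y hy => by simp only [d.left_inv _ hy])

theorem SmoothVia.comp {c : CornerChart Y m} {d : CornerChart Y' m} {e : CornerChart Y'' m}
    {g : Y → Y'} {g' : Y' → Y''} {q : Y} (hq : q ∈ c.dom) (hgq : g q ∈ d.dom)
    (hg : ContinuousAt g q) (h : c.SmoothVia d g q) (h' : d.SmoothVia e g' (g q)) :
    c.SmoothVia e (fun y => g' (g y)) q :=
  SmoothVia.comp_fn (g := g) (f := fun y => e.toFun (g' y)) hq hgq hg h h'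

theorem smoothFn_of_contDiffAt {c : CornerChart Y m} {f : Y → V}
    {F : EuclideanSpace ℝ (Fin m) → V} {q : Y} (hq : q ∈ c.dom)
    (hF : ContDiffWithinAt ℝ ∞ F c.tgt (c.toFun q)) (h : ∀ᶠ y in 𝓝 q, f y = F (c.toFun y)) :
    c.SmoothFn f q := by
  refine hF.congr_of_eventuallyEq ?_ ?_
  · filter_upwards [c.eventually_inv hq h, self_mem_nhdsWithin] with t ht ht'
    rw [ht, c.right_inv t ht']
  · rw [c.left_inv q hq]; exact h.self_of_nhds

theorem smoothVia_id (c : CornerChart Y m) {q : Y} (hq : q ∈ c.dom) :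
    c.SmoothVia c (fun y => y) q :=
  smoothFn_of_contDiffAt hq contDiffWithinAt_id (Filter.Eventually.of_forall fun _ => rfl)

theorem smoothFn_euclidean {c : CornerChart Y m} {n : ℕ} {f : Y → EuclideanSpace ℝ (Fin n)}
    {q : Y} : c.SmoothFn f q ↔ ∀ i, c.SmoothFn (fun y => f y i) q :=
  contDiffWithinAt_euclidean

theorem smoothFn_coord (c : CornerChart Y m) {q : Y} (hq : q ∈ c.dom) (i : Fin m) :
    c.SmoothFn (fun y => c.toFun y i) q :=
  smoothFn_euclidean.1 (c.smoothVia_id hq) i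

theorem SmoothFn.contDiffAt_comp {V' : Type*} [NormedAddCommGroup V'] [NormedSpace ℝ V']
    {c : CornerChart Y m} {f : Y → V} {F : V → V'} {q : Y} (hq : q ∈ c.dom)
    (hF : ContDiffAt ℝ ∞ F (f q)) (h : c.SmoothFn f q) : c.SmoothFn (fun y => F (f y)) q := by
  refine ContDiffAt.comp_contDiffWithinAt (g := F) _ ?_ h
  rwa [c.left_inv q hq]

/-- A change of coordinates of a corner chart. -/
def reparam (c : CornerChart Y m) (k : ℕ) (T T' : Set (EuclideanSpace ℝ (Fin m)))
    (Ψ χ : EuclideanSpace ℝ (Fin m) → EuclideanSpace ℝ (Fin m)) (hT : IsOpen T) (hT' : IsOpen T')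
    (hΨ : ContinuousOn Ψ (T ∩ c.tgt)) (hχ : ContinuousOn χ (T' ∩ cornerSector m k))
    (h1 : ∀ t ∈ T ∩ c.tgt, Ψ t ∈ T' ∩ cornerSector m k ∧ χ (Ψ t) = t)
    (h2 : ∀ y ∈ T' ∩ cornerSector m k, χ y ∈ T ∩ c.tgt ∧ Ψ (χ y) = y) : CornerChart Y m where
  k := k
  dom := c.dom ∩ c.toFun ⁻¹' T
  cod := T'
  toFun y := Ψ (c.toFun y)
  inv y := c.inv (χ y)
  isOpen_dom := c.continuousOn_toFun.isOpen_inter_preimage c.isOpen_dom hT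
  isOpen_cod := hT'
  map_mem q hq := (h1 _ ⟨hq.2, c.map_mem q hq.1⟩).1
  inv_mem t ht := by
    have := (h2 t ht).1
    refine ⟨c.inv_mem _ this.2, ?_⟩
    rw [mem_preimage, c.right_inv _ this.2]
    exact this.1
  left_inv q hq := by rw [(h1 _ ⟨hq.2, c.map_mem q hq.1⟩).2, c.left_inv q hq.1]
  right_inv t ht := by rw [c.right_inv _ (h2 t ht).1.2, (h2 t ht).2]
  continuousOn_toFun := hΨ.comp (c.continuousOn_toFun.mono inter_subset_left)
    fun q hq => ⟨hq.2, c.map_mem q hq.1⟩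
  continuousOn_inv := c.continuousOn_inv.comp hχ fun t ht => (h2 t ht).1.2

/-- Restriction of a corner chart to an open subset of its image. -/
def restr (c : CornerChart Y m) (T : Set (EuclideanSpace ℝ (Fin m))) (hT : IsOpen T) :
    CornerChart Y m :=
  c.reparam c.k T (c.cod ∩ T) id id hT (c.isOpen_cod.inter hT) continuousOn_id continuousOn_id
    (fun _ ht => ⟨⟨⟨ht.2.1, ht.1⟩, ht.2.2⟩, rfl⟩) (fun _ ht => ⟨⟨ht.1.2, ht.1.1, ht.2⟩, rfl⟩)

theorem smoothVia_restr_left {c : CornerChart Y m} {T : Set (EuclideanSpace ℝ (Fin m))}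
    {hT : IsOpen T} {d : CornerChart Y' m} {g : Y → Y'} {q : Y} (h : c.SmoothVia d g q) :
    (c.restr T hT).SmoothVia d g q := by
  have h' : ContDiffWithinAt ℝ ∞ (fun t => d.toFun (g (c.inv t))) c.tgt (c.toFun q) := h
  exact h'.mono fun _ ht => ⟨ht.1.1, ht.2⟩

theorem exists_restr_subset (c : CornerChart Y m) {q : Y} (hq : q ∈ c.dom) {U : Set Y}
    (hU : U ∈ 𝓝 q) : ∃ ε > 0, (c.restr (Metric.ball (c.toFun q) ε) Metric.isOpen_ball).dom ⊆ U ∧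
      Metric.ball (c.toFun q) ε ⊆ c.cod := by
  obtain ⟨ε₁, hε₁, h1⟩ := Metric.isOpen_iff.1 c.isOpen_cod _ (c.map_mem q hq).1
  obtain ⟨ε₂, hε₂, h2⟩ := Metric.mem_nhdsWithin_iff.1 (c.eventually_inv hq hU)
  refine ⟨min ε₁ ε₂, lt_min hε₁ hε₂, ?_, (Metric.ball_subset_ball (min_le_left _ _)).trans h1⟩
  intro y hy
  have := h2 ⟨Metric.ball_subset_ball (min_le_right _ _) hy.2, c.map_mem y hy.1⟩
  rwa [mem_ofPred_eq, c.left_inv y hy.1] at this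

theorem mem_restr_dom {c : CornerChart Y m} {T : Set (EuclideanSpace ℝ (Fin m))}
    {hT : IsOpen T} {q : Y} : q ∈ (c.restr T hT).dom ↔ q ∈ c.dom ∧ c.toFun q ∈ T := Iff.rfl

end CornerChart

/-- An atlas of corner charts with smooth transition maps. -/
structure CornerAtlas (Y : Type*) [TopologicalSpace Y] (m : ℕ) where
  charts : Set (CornerChart Y m)
  cover : ∀ q, ∃ c ∈ charts, q ∈ c.dom
  compat : ∀ c ∈ charts, ∀ d ∈ charts, ∀ q, q ∈ c.dom → q ∈ d.dom → c.SmoothVia d (fun y => y) q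

namespace CornerAtlas

variable {Y Y' Y'' : Type*} [TopologicalSpace Y] [TopologicalSpace Y'] [TopologicalSpace Y'']
  {m : ℕ} (A : CornerAtlas Y m) (A' : CornerAtlas Y' m) (A'' : CornerAtlas Y'' m)

/-- A corner chart is smooth if it is compatible with the charts of the atlas. -/
def IsSmooth (c : CornerChart Y m) : Prop :=
  ∀ d ∈ A.charts, ∀ q, q ∈ c.dom → q ∈ d.dom →
    c.SmoothVia d (fun y => y) q ∧ d.SmoothVia c (fun y => y) q

/-- Smoothness of a map at a point. -/
def SmoothMapAt (g : Y → Y') (q : Y) : Prop :=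
  ContinuousAt g q ∧ ∀ c d, A.IsSmooth c → A'.IsSmooth d → q ∈ c.dom → g q ∈ d.dom →
    c.SmoothVia d g q

variable {A A' A''}

theorem isSmooth_of_mem {c : CornerChart Y m} (hc : c ∈ A.charts) : A.IsSmooth c :=
  fun d hd q hqc hqd => ⟨A.compat c hc d hd q hqc hqd, A.compat d hd c hc q hqd hqc⟩

theorem IsSmooth.smoothVia {c d : CornerChart Y m} (hc : A.IsSmooth c) (hd : A.IsSmooth d)
    {q : Y} (hqc : q ∈ c.dom) (hqd : q ∈ d.dom) : c.SmoothVia d (fun y => y) q := by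
  obtain ⟨e, he, hqe⟩ := A.cover q
  exact CornerChart.SmoothVia.comp (g := fun y => y) (g' := fun y => y) hqc hqe continuousAt_id
    (hc e he q hqc hqe).1 (hd e he q hqd hqe).2

theorem smoothMapAt_of_smoothVia {g : Y → Y'} {q : Y} (hg : ContinuousAt g q)
    {c : CornerChart Y m} {d : CornerChart Y' m} (hc : A.IsSmooth c) (hd : A'.IsSmooth d)
    (hqc : q ∈ c.dom) (hqd : g q ∈ d.dom) (h : c.SmoothVia d g q) : A.SmoothMapAt A' g q := by
  refine ⟨hg, fun c' d' hc' hd' hqc' hqd' => ?_⟩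
  have h1 : c'.SmoothVia d g q := CornerChart.SmoothVia.comp (g := fun y => y) (g' := g) hqc' hqc
    continuousAt_id (hc'.smoothVia hc hqc' hqc) h
  exact CornerChart.SmoothVia.comp (g := g) (g' := fun y => y) hqc' hqd hg h1
    (hd.smoothVia hd' hqd hqd')

theorem SmoothMapAt.comp {g : Y → Y'} {g' : Y' → Y''} {q : Y} (h' : A'.SmoothMapAt A'' g' (g q))
    (h : A.SmoothMapAt A' g q) : A.SmoothMapAt A'' (fun y => g' (g y)) q := by
  obtain ⟨d, hd, hqd⟩ := A'.cover (g q)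
  refine ⟨ContinuousAt.comp (g := g') h'.1 h.1, fun c e hc he hqc hqe => ?_⟩
  exact CornerChart.SmoothVia.comp hqc hqd h.1 (h.2 c d hc (isSmooth_of_mem hd) hqc hqd)
    (h'.2 d e (isSmooth_of_mem hd) he hqd hqe)

theorem SmoothMapAt.congr {g g' : Y → Y'} {q : Y} (h : A.SmoothMapAt A' g q)
    (hg : g' =ᶠ[𝓝 q] g) : A.SmoothMapAt A' g' q := by
  refine ⟨h.1.congr hg.symm, fun c d hc hd hqc hqd => ?_⟩
  rw [hg.self_of_nhds] at hqd
  exact (h.2 c d hc hd hqc hqd).congr hqc hg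

theorem smoothMapAt_id (q : Y) : A.SmoothMapAt A (fun y => y) q :=
  ⟨continuousAt_id, fun _ _ hc hd hqc hqd => hc.smoothVia hd hqc hqd⟩

theorem IsSmooth.restr {c : CornerChart Y m} (hc : A.IsSmooth c)
    {T : Set (EuclideanSpace ℝ (Fin m))} {hT : IsOpen T} : A.IsSmooth (c.restr T hT) := by
  intro d hd q hqc hqd
  exact ⟨CornerChart.smoothVia_restr_left (hc d hd q hqc.1 hqd).1, (hc d hd q hqc.1 hqd).2⟩

/-- A chart which is related to smooth charts by smooth transition maps is smooth. -/
theorem isSmooth_of_forall {c : CornerChart Y m} (h : ∀ q ∈ c.dom, ∃ d, A.IsSmooth d ∧ q ∈ d.dom ∧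
    c.SmoothVia d (fun y => y) q ∧ d.SmoothVia c (fun y => y) q) : A.IsSmooth c := by
  intro e he q hqc hqe
  obtain ⟨d, hd, hqd, h1, h2⟩ := h q hqc
  exact ⟨CornerChart.SmoothVia.comp (g := fun y => y) (g' := fun y => y) hqc hqd continuousAt_id h1
    (hd.smoothVia (isSmooth_of_mem he) hqd hqe),
    CornerChart.SmoothVia.comp (g := fun y => y) (g' := fun y => y) hqe hqd continuousAt_id
    ((isSmooth_of_mem he).smoothVia hd hqe hqd) h2⟩

theorem IsSmooth.reparam {c : CornerChart Y m} (hc : A.IsSmooth c) {k : ℕ}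
    {T T' : Set (EuclideanSpace ℝ (Fin m))} {Ψ χ : EuclideanSpace ℝ (Fin m) →
    EuclideanSpace ℝ (Fin m)} {hT hT' hΨ hχ h1 h2} (hsΨ : ContDiffOn ℝ ∞ Ψ (T ∩ c.tgt))
    (hsχ : ContDiffOn ℝ ∞ χ (T' ∩ cornerSector m k)) :
    A.IsSmooth (c.reparam k T T' Ψ χ hT hT' hΨ hχ h1 h2) := by
  refine isSmooth_of_forall fun q hq => ⟨c, hc, hq.1, ?_, ?_⟩
  · refine ContDiffWithinAt.congr (hsχ _ ((h1 _ ⟨hq.2, c.map_mem q hq.1⟩).1)) ?_ ?_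
    · intro t ht
      exact c.right_inv _ (h2 t ht).1.2
    · exact c.right_inv _ (h2 _ (h1 _ ⟨hq.2, c.map_mem q hq.1⟩).1).1.2
  · refine CornerChart.smoothFn_of_contDiffAt hq.1 ?_ (Filter.Eventually.of_forall fun _ => rfl)
    exact (hsΨ _ ⟨hq.2, c.map_mem q hq.1⟩).mono_of_mem_nhdsWithin
      (Filter.inter_mem (nhdsWithin_le_nhds (hT.mem_nhds hq.2)) self_mem_nhdsWithin)

end CornerAtlas

/-! ### Equivariant retractions onto corner strata -/

theorem isClosed_cornerSector (m k : ℕ) : IsClosed (cornerSector m k) := by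
  simp only [cornerSector, ofPred_forall]
  exact isClosed_iInter fun i => isClosed_iInter fun _ => isClosed_le continuous_const (by fun_prop)

section Retraction

variable {Y : Type*} [TopologicalSpace Y] {m : ℕ} {A : CornerAtlas Y m}

/-- Shrinking some coordinates of a chart to zero near a point. -/
theorem exists_shrinking [T2Space Y] {c : CornerChart Y m} (hc : A.IsSmooth c) {p : Y}
    (hp : p ∈ c.dom) {l k : ℕ}
    (h0 : ∀ i : Fin m, l ≤ (i : ℕ) → (i : ℕ) < k → c.toFun p i = 0) :
    ∃ s : Y → Y, (∀ q, A.SmoothMapAt A s q) ∧ (∀ q, q ∉ c.dom → s q = q) ∧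
      (∀ q ∈ c.dom, ∃ σ : ℝ, 0 ≤ σ ∧ σ ≤ 1 ∧ scaleOn l k σ (c.toFun q) ∈ c.tgt ∧
        s q = c.inv (scaleOn l k σ (c.toFun q))) ∧
      ∀ᶠ q in 𝓝 p, scaleOn l k 0 (c.toFun q) ∈ c.tgt ∧ s q = c.inv (scaleOn l k 0 (c.toFun q)) := by
  classical
  set t₀ := c.toFun p with ht₀
  obtain ⟨ε, hε, hball⟩ := Metric.isOpen_iff.1 c.isOpen_cod t₀ (c.map_mem p hp).1
  -- The shrinking factor is `1 - η`: it is 0 near `p`, and 1 outside a ball whose closure still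
  -- lies in the ball contained in `c.cod`, so the map can be extended by the identity.
  let η : ContDiffBump t₀ := ⟨ε / 4, ε / 2, by positivity, by linarith⟩
  have hη0 : ∀ t, t ∉ Metric.ball t₀ (ε / 2) → η t = 0 := fun t ht =>
    η.zero_of_le_dist (by simpa using ht)
  have hstay : ∀ t ∈ c.tgt, scaleOn l k (1 - η t) t ∈ c.tgt := by
    intro t ht
    have h1 : 0 ≤ 1 - η t := sub_nonneg.2 η.le_one
    refine ⟨?_, scaleOn_mem_cornerSector h1 ht.2⟩
    by_cases htb : t ∈ Metric.ball t₀ (ε / 2)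
    · refine hball ?_
      refine lt_of_le_of_lt (dist_scaleOn_le h1 (by linarith [η.nonneg (x := t)]) h0) ?_
      rw [Metric.mem_ball] at htb
      linarith
    · rw [hη0 t htb, sub_zero, scaleOn_one]; exact ht.1
  let s : Y → Y := fun q =>
    if q ∈ c.dom then c.inv (scaleOn l k (1 - η (c.toFun q)) (c.toFun q)) else q
  have hs : ∀ q ∈ c.dom, s q = c.inv (scaleOn l k (1 - η (c.toFun q)) (c.toFun q)) :=
    fun q hq => if_pos hq
  have hs' : ∀ q, q ∉ c.dom → s q = q := fun q hq => if_neg hq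
  have hsm : ContDiff ℝ ∞ fun t : EuclideanSpace ℝ (Fin m) => scaleOn l k (1 - η t) t :=
    (contDiff_scaleOn l k).comp ((contDiff_const.sub η.contDiff).prodMk contDiff_id)
  refine ⟨s, fun q => ?_, hs', fun q hq => ⟨1 - η (c.toFun q), sub_nonneg.2 η.le_one, ?_,
    hstay _ (c.map_mem q hq), hs q hq⟩, ?_⟩
  · by_cases hq : q ∈ c.dom
    · have hq' : s q ∈ c.dom := by rw [hs q hq]; exact c.inv_mem _ (hstay _ (c.map_mem q hq))
      have hcont : ContinuousAt s q := by
        have h1 : ContinuousOn s c.dom := by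
          refine ContinuousOn.congr (f := fun q =>
            c.inv (scaleOn l k (1 - η (c.toFun q)) (c.toFun q))) ?_ hs
          exact c.continuousOn_inv.comp (hsm.continuous.comp_continuousOn c.continuousOn_toFun)
            fun y hy => hstay _ (c.map_mem y hy)
        exact h1.continuousAt (c.isOpen_dom.mem_nhds hq)
      refine CornerAtlas.smoothMapAt_of_smoothVia hcont hc hc hq hq' ?_
      refine CornerChart.smoothFn_of_contDiffAt hq hsm.contDiffAt.contDiffWithinAt ?_
      filter_upwards [c.isOpen_dom.mem_nhds hq] with y hy
      rw [hs y hy, c.right_inv _ (hstay _ (c.map_mem y hy))]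
    · refine CornerAtlas.SmoothMapAt.congr (CornerAtlas.smoothMapAt_id q) ?_
      have hK : IsCompact (c.inv '' (Metric.closedBall t₀ (ε / 2) ∩ cornerSector m c.k)) := by
        refine ((isCompact_closedBall _ _).inter_right (isClosed_cornerSector m c.k)).image_of_continuousOn
          (c.continuousOn_inv.mono fun t ht => ⟨hball ?_, ht.2⟩)
        exact Metric.closedBall_subset_ball (by linarith) ht.1
      have hqK : q ∉ c.inv '' (Metric.closedBall t₀ (ε / 2) ∩ cornerSector m c.k) := by
        rintro ⟨t, ht, rfl⟩
        exact hq (c.inv_mem t ⟨hball (Metric.closedBall_subset_ball (by linarith) ht.1), ht.2⟩)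
      filter_upwards [hK.isClosed.isOpen_compl.mem_nhds hqK] with y hy
      by_cases hyd : y ∈ c.dom
      · rw [hs y hyd, hη0, sub_zero, scaleOn_one, c.left_inv y hyd]
        intro hyb
        exact hy ⟨c.toFun y, ⟨Metric.ball_subset_closedBall hyb, (c.map_mem y hyd).2⟩,
          c.left_inv y hyd⟩
      · exact hs' y hyd
  · linarith [η.nonneg (x := c.toFun q)]
  · have h1 : ∀ᶠ q in 𝓝 p, c.toFun q ∈ Metric.ball t₀ (ε / 4) :=
      (c.continuousAt_toFun hp).eventually (Metric.ball_mem_nhds _ (by positivity))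
    filter_upwards [h1, c.isOpen_dom.mem_nhds hp] with q hq hqd
    have h2 : η (c.toFun q) = 1 := η.one_of_mem_closedBall (Metric.ball_subset_closedBall hq)
    have h3 := hstay _ (c.map_mem q hqd)
    rw [h2, sub_self] at h3
    exact ⟨h3, by rw [hs q hqd, h2, sub_self]⟩

/-- The chart `c` describes `Z` by the vanishing of the coordinates with index in `[l, k)`, and
multiplying these coordinates by a number in `[0, 1]` preserves `N` and the values of `ξ` on it. -/
structure IsShrinkingChart {Ξ : Type*} (A : CornerAtlas Y m) (Z N : Set Y) (ξ : Y → Ξ) (l k : ℕ)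
    (c : CornerChart Y m) : Prop where
  isSmooth : A.IsSmooth c
  mem_iff : ∀ q ∈ c.dom, q ∈ Z ↔ ∀ i : Fin m, l ≤ (i : ℕ) → (i : ℕ) < k → c.toFun q i = 0
  scale : ∀ q ∈ c.dom, q ∈ N → ∀ σ : ℝ, 0 ≤ σ → σ ≤ 1 → scaleOn l k σ (c.toFun q) ∈ c.tgt →
    c.inv (scaleOn l k σ (c.toFun q)) ∈ N ∧ ξ (c.inv (scaleOn l k σ (c.toFun q))) = ξ q

theorem IsShrinkingChart.restr {Ξ : Type*} {Z N : Set Y} {ξ : Y → Ξ} {l k : ℕ}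
    {c : CornerChart Y m} (h : IsShrinkingChart A Z N ξ l k c)
    {T : Set (EuclideanSpace ℝ (Fin m))} {hT : IsOpen T} :
    IsShrinkingChart A Z N ξ l k (c.restr T hT) :=
  ⟨h.isSmooth.restr, fun q hq => h.mem_iff q hq.1,
    fun q hq hN σ h0 h1 ht => h.scale q hq.1 hN σ h0 h1 ⟨ht.1.1, ht.2⟩⟩

/-- A smooth equivariant self-map, which is the identity on `Z` and preserves `ξ` on `N`. -/
structure IsStratumMap {Ξ : Type*} (A : CornerAtlas Y m) (τ : Y → Y) (Z N : Set Y) (ξ : Y → Ξ)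
    (s : Y → Y) : Prop where
  smooth : ∀ q, A.SmoothMapAt A s q
  equivariant : ∀ q, s (τ q) = τ (s q)
  eq_self : ∀ q ∈ Z, s q = q
  preserves : ∀ q ∈ N, s q ∈ N ∧ ξ (s q) = ξ q

variable {τ : Y → Y}

theorem IsStratumMap.comp {Ξ : Type*} {Z N : Set Y} {ξ : Y → Ξ} {s s' : Y → Y}
    (h : IsStratumMap A τ Z N ξ s) (h' : IsStratumMap A τ Z N ξ s') :
    IsStratumMap A τ Z N ξ fun q => s' (s q) where
  smooth q := (h'.smooth (s q)).comp (h.smooth q)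
  equivariant q := by rw [h.equivariant, h'.equivariant]
  eq_self q hq := by rw [h.eq_self q hq, h'.eq_self q hq]
  preserves q hq := by
    obtain ⟨h1, h2⟩ := h.preserves q hq
    obtain ⟨h3, h4⟩ := h'.preserves _ h1
    exact ⟨h3, h4.trans h2⟩

/-- Since `τ p ≠ p`, a small chart domain `d` around `p` is disjoint from its image. A shrinking `s`
supported in `d` then commutes with its conjugate `τ s τ`, supported in `τ d`, so the product `s τ s
τ` is equivariant; on `d` it equals `s`. The hypothesis on `ξ` says that `τ` permutes its fibres in
`N`, so that the conjugate preserves them too. -/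
theorem exists_local_stratumMap [T2Space Y] (hτ : ∀ q, A.SmoothMapAt A τ q)
    (hττ : ∀ q, τ (τ q) = q) {Ξ : Type*} {Z N : Set Y} {ξ : Y → Ξ} (hZ : ∀ q ∈ Z, τ q ∈ Z)
    (hN : ∀ q ∈ N, τ q ∈ N) (hξ : ∀ q ∈ N, ∀ q' ∈ N, ξ q = ξ q' → ξ (τ q) = ξ (τ q'))
    {p : Y} (hp : p ∈ Z) (hpτ : τ p ≠ p) {l k : ℕ} {c : CornerChart Y m}
    (hc : IsShrinkingChart A Z N ξ l k c) (hpc : p ∈ c.dom) :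
    ∃ s, IsStratumMap A τ Z N ξ s ∧ ∀ᶠ q in 𝓝 p, s q ∈ Z := by
  obtain ⟨U, V, hU, hV, hpU, hpV, hUV⟩ := t2_separation hpτ
  obtain ⟨ε, hε, hdom, -⟩ := c.exists_restr_subset hpc (U := V ∩ τ ⁻¹' U)
    (Filter.inter_mem (hV.mem_nhds hpV) ((hτ p).1.preimage_mem_nhds (hU.mem_nhds hpU)))
  set d := c.restr (Metric.ball (c.toFun p) ε) Metric.isOpen_ball with hd
  have hcd : IsShrinkingChart A Z N ξ l k d := hc.restr
  have hpd : p ∈ d.dom := ⟨hpc, Metric.mem_ball_self hε⟩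
  have hdisj : ∀ q ∈ d.dom, τ q ∉ d.dom := fun q hq hq' =>
    hUV.le_bot ⟨(hdom hq).2, (hdom hq').1⟩
  obtain ⟨s, hs, hs1, hs2, hs3⟩ := exists_shrinking hcd.isSmooth hpd
    ((hcd.mem_iff p hpd).1 hp)
  have hsd : ∀ q ∈ d.dom, s q ∈ d.dom := fun q hq => by
    obtain ⟨σ, -, -, h3, h4⟩ := hs2 q hq
    rw [h4]; exact d.inv_mem _ h3
  have hsZ : ∀ q ∈ Z, s q = q := by
    intro q hq
    by_cases hqd : q ∈ d.dom
    · obtain ⟨σ, -, -, h3, h4⟩ := hs2 q hqd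
      rw [h4, scaleOn_eq_self _ ((hcd.mem_iff q hqd).1 hq), d.left_inv q hqd]
    · exact hs1 q hqd
  have hsN : ∀ q ∈ N, s q ∈ N ∧ ξ (s q) = ξ q := by
    intro q hq
    by_cases hqd : q ∈ d.dom
    · obtain ⟨σ, h1, h2, h3, h4⟩ := hs2 q hqd
      rw [h4]; exact hcd.scale q hqd hq σ h1 h2 h3
    · rw [hs1 q hqd]; exact ⟨hq, rfl⟩
  have key : ∀ q ∈ d.dom, s (τ (s (τ q))) = s q := fun q hq => by
    rw [hs1 _ (hdisj q hq), hττ]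
  have key' : ∀ q ∈ d.dom, s (τ (s (τ (τ q)))) = τ (s q) := fun q hq => by
    rw [hττ, hs1 _ (hdisj _ (hsd q hq))]
  refine ⟨fun q => s (τ (s (τ q))), ⟨fun q => ?_, fun q => ?_, fun q hq => ?_, fun q hq => ?_⟩, ?_⟩
  · exact (hs _).comp ((hτ _).comp ((hs _).comp (hτ q)))
  · by_cases hq : q ∈ d.dom
    · rw [key q hq, key' q hq]
    · by_cases hq' : τ q ∈ d.dom
      · have h1 := key' _ hq'
        rw [hττ] at h1
        rw [key _ hq', h1, hττ]
      · rw [hs1 _ hq', hττ, hs1 _ hq, hs1 _ hq']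
  · rw [hsZ _ (hZ q hq), hττ, hsZ q hq]
  · obtain ⟨h1, h2⟩ := hsN _ (hN q hq)
    obtain ⟨h3, h4⟩ := hsN _ (hN _ h1)
    refine ⟨h3, h4.trans ?_⟩
    rw [hξ _ h1 _ (hN q hq) h2, hττ]
  · filter_upwards [hs3, d.isOpen_dom.mem_nhds hpd] with q hq hqd
    rw [key q hqd, hq.2, hcd.mem_iff _ (d.inv_mem _ hq.1), d.right_inv _ hq.1]
    intro i h1 h2
    rw [scaleOn_apply_of_mem _ _ h1 h2, zero_mul]

/-- A closed stratum of a compact space is an equivariant neighbourhood retract. -/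
theorem exists_retraction [T2Space Y] [CompactSpace Y] (hτ : ∀ q, A.SmoothMapAt A τ q)
    (hττ : ∀ q, τ (τ q) = q) (hfree : ∀ q, τ q ≠ q) {Ξ : Type*} {Z N : Set Y} {ξ : Y → Ξ}
    (hZc : IsClosed Z) (hZ : ∀ q ∈ Z, τ q ∈ Z)
    (hN : ∀ q ∈ N, τ q ∈ N) (hξ : ∀ q ∈ N, ∀ q' ∈ N, ξ q = ξ q' → ξ (τ q) = ξ (τ q'))
    (h : ∀ p ∈ Z, ∃ l k c, IsShrinkingChart A Z N ξ l k c ∧ p ∈ c.dom) :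
    ∃ r, IsStratumMap A τ Z N ξ r ∧ ∀ p ∈ Z, ∀ᶠ q in 𝓝 p, r q ∈ Z := by
  have hid : IsStratumMap A τ Z N ξ fun q => q :=
    ⟨fun q => CornerAtlas.smoothMapAt_id q, fun _ => rfl, fun _ _ => rfl, fun _ hq => ⟨hq, rfl⟩⟩
  refine hZc.isCompact.induction_on
    (p := fun S => ∃ r, IsStratumMap A τ Z N ξ r ∧ ∀ p ∈ S ∩ Z, ∀ᶠ q in 𝓝 p, r q ∈ Z)
    ⟨_, hid, by simp⟩ ?_ ?_ ?_ |>.imp fun r hr => ⟨hr.1, fun p hp => hr.2 p ⟨hp, hp⟩⟩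
  · rintro S S' hSS ⟨r, hr, hr'⟩
    exact ⟨r, hr, fun p hp => hr' p ⟨hSS hp.1, hp.2⟩⟩
  · rintro S S' ⟨r, hr, hr1⟩ ⟨r', hr', hr1'⟩
    -- The composite works on both pieces: where `r` already lands in `Z`, the second map is the
    -- identity; where only `r'` retracts, `r` fixes `p` and keeps nearby points near `p`.
    refine ⟨_, hr.comp hr', fun p hp => ?_⟩
    rcases hp.1 with hpS | hpS
    · filter_upwards [hr1 p ⟨hpS, hp.2⟩] with q hq
      rw [hr'.eq_self _ hq]; exact hq
    · have h1 : ∀ᶠ q in 𝓝 (r p), r' q ∈ Z := by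
        rw [hr.eq_self p hp.2]; exact hr1' p ⟨hpS, hp.2⟩
      exact (hr.smooth p).1.eventually h1
  · intro p hp
    obtain ⟨l, k, c, hc, hpc⟩ := h p hp
    obtain ⟨s, hs, hs1⟩ := exists_local_stratumMap hτ hττ hZ hN hξ hp (hfree p) hc hpc
    obtain ⟨U, hU, hUo, hpU⟩ := eventually_nhds_iff.1 hs1
    refine ⟨U, mem_nhdsWithin_of_mem_nhds (hUo.mem_nhds hpU), s, hs, fun q hq => ?_⟩
    filter_upwards [hUo.mem_nhds hq.1] with y hy using hU y hy

end Retraction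

/-! ### Charts adapted to a retraction -/

section Adapt

variable {m : ℕ}

/-- The coordinate functionals which define a sector. -/
def sectorFunctional (m k : ℕ) (i : {i : Fin m // (i : ℕ) < k}) : EuclideanSpace ℝ (Fin m) →L[ℝ] ℝ :=
  EuclideanSpace.proj (i : Fin m)

theorem sectorFunctional_apply {k : ℕ} (i : {i : Fin m // (i : ℕ) < k})
    (x : EuclideanSpace ℝ (Fin m)) : sectorFunctional m k i x = x i := rfl

theorem wedge_sectorFunctional (m k : ℕ) : wedge (sectorFunctional m k) = cornerSector m k := by
  ext x
  simp [wedge, cornerSector, sectorFunctional]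

theorem sectorFunctional_single {k : ℕ} (i j : {i : Fin m // (i : ℕ) < k}) :
    sectorFunctional m k i (EuclideanSpace.single (j : Fin m) 1) = if i = j then 1 else 0 := by
  simp [sectorFunctional, Subtype.ext_iff]

/-- The linear projection which replaces the coordinates with index in `[l, k)` by zero. -/
def killOn (m l k : ℕ) : EuclideanSpace ℝ (Fin m) →L[ℝ] EuclideanSpace ℝ (Fin m) :=
  LinearMap.toContinuousLinearMap
    { toFun := scaleOn l k 0
      map_add' := fun x y => by ext i; simp only [scaleOn_apply, PiLp.add_apply]; split_ifs <;> simp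
      map_smul' := fun a x => by
        ext i; simp only [scaleOn_apply, PiLp.smul_apply]; split_ifs <;> simp }

theorem killOn_apply (l k : ℕ) (x : EuclideanSpace ℝ (Fin m)) : killOn m l k x = scaleOn l k 0 x :=
  rfl

theorem scaleOn_zero_eq_zero_iff {k : ℕ} {x : EuclideanSpace ℝ (Fin m)} :
    x - scaleOn 0 k 0 x = 0 ↔ ∀ i : Fin m, (i : ℕ) < k → x i = 0 := by
  constructor
  · intro h i hi
    have := congrArg (fun y : EuclideanSpace ℝ (Fin m) => y i) h
    simpa [scaleOn_apply_of_mem _ _ (Nat.zero_le _) hi] using this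
  · intro h
    rw [scaleOn_eq_self _ fun i _ hi => h i hi, sub_self]

/-- A chart adapted to the map `r`: in the chart, `r` replaces the coordinates with index in
`[l, k)` by zero. -/
def CornerChart.IsAdapted {Y : Type*} [TopologicalSpace Y] (r : Y → Y) (l k : ℕ)
    (c : CornerChart Y m) : Prop :=
  ∀ t ∈ c.tgt, scaleOn l k 0 t ∈ c.tgt ∧ r (c.inv t) = c.inv (scaleOn l k 0 t)

variable {Y : Type*} [TopologicalSpace Y] {A : CornerAtlas Y m}

theorem CornerChart.restr_isAdapted {c : CornerChart Y m} {r : Y → Y} {l k : ℕ}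
    (hc : c.IsAdapted r l k) {p : Y}
    (h0 : ∀ i : Fin m, l ≤ (i : ℕ) → (i : ℕ) < k → c.toFun p i = 0) (ε : ℝ) :
    (c.restr (Metric.ball (c.toFun p) ε) Metric.isOpen_ball).IsAdapted r l k := fun t ht => by
  obtain ⟨h1, h2⟩ := hc t ⟨ht.1.1, ht.2⟩
  exact ⟨⟨⟨h1.1, (dist_scaleOn_le le_rfl zero_le_one h0).trans_lt ht.1.2⟩, h1.2⟩, h2⟩

/-- Adapting a chart to a retraction onto the stratum on which all its boundary coordinates
vanish. -/
theorem exists_adapted {c : CornerChart Y m} (hc : A.IsSmooth c) {p : Y} (hp : p ∈ c.dom)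
    (h0 : ∀ i : Fin m, (i : ℕ) < c.k → c.toFun p i = 0) {r : Y → Y}
    (hr : ∀ q, A.SmoothMapAt A r q) (hrp : r p = p)
    (hr1 : ∀ᶠ q in 𝓝 p, ∀ i : Fin m, (i : ℕ) < c.k → c.toFun (r q) i = 0)
    (hr2 : ∀ᶠ q in 𝓝 p, (∀ i : Fin m, (i : ℕ) < c.k → c.toFun q i = 0) → r q = q) :
    ∃ c' : CornerChart Y m, A.IsSmooth c' ∧ p ∈ c'.dom ∧ c'.dom ⊆ c.dom ∧ c'.k = c.k ∧
      (∀ q ∈ c'.dom, ∀ i : Fin m, (i : ℕ) < c.k → c'.toFun q i = c.toFun q i) ∧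
      c'.IsAdapted r 0 c.k := by
  classical
  have hrt : Filter.Tendsto r (𝓝 p) (𝓝 p) := by
    have := (hr p).1; rwa [ContinuousAt, hrp] at this
  have hU : {q | q ∈ c.dom ∧ r q ∈ c.dom ∧ (∀ i : Fin m, (i : ℕ) < c.k → c.toFun (r q) i = 0) ∧
      ((∀ i : Fin m, (i : ℕ) < c.k → c.toFun q i = 0) → r q = q) ∧ r (r q) = r q} ∈ 𝓝 p := by
    have hd := c.isOpen_dom.mem_nhds hp
    filter_upwards [hd, hrt hd, hr1, hr2, hrt.eventually hr2] with q h1 h2 h3 h4 h5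
    exact ⟨h1, h2, h3, h4, h5 h3⟩
  obtain ⟨ε, hε, hdom, hball⟩ := c.exists_restr_subset hp hU
  set t₀ := c.toFun p with ht₀
  set T := Metric.ball t₀ ε
  set S := T ∩ cornerSector m c.k with hS
  have hSt : S ⊆ c.tgt := fun t ht => ⟨hball ht.1, ht.2⟩
  have hSU : ∀ t ∈ S, r (c.inv t) ∈ c.dom ∧
      (∀ i : Fin m, (i : ℕ) < c.k → c.toFun (r (c.inv t)) i = 0) ∧
      ((∀ i : Fin m, (i : ℕ) < c.k → t i = 0) → r (c.inv t) = c.inv t) ∧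
      r (r (c.inv t)) = r (c.inv t) := fun t ht => by
    have h1 : c.inv t ∈ (c.restr T Metric.isOpen_ball).dom := by
      rw [CornerChart.mem_restr_dom, c.right_inv _ (hSt ht)]
      exact ⟨c.inv_mem _ (hSt ht), ht.1⟩
    obtain ⟨-, h2, h3, h4, h5⟩ := hdom h1
    rw [c.right_inv _ (hSt ht)] at h4
    exact ⟨h2, h3, h4, h5⟩
  have ht₀S : t₀ ∈ S := ⟨Metric.mem_ball_self hε, (c.map_mem p hp).2⟩
  let R : EuclideanSpace ℝ (Fin m) → EuclideanSpace ℝ (Fin m) := fun t => c.toFun (r (c.inv t))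
  have hR : ContDiffOn ℝ ∞ R S := by
    intro t ht
    have h1 := (hr (c.inv t)).2 c c hc hc (c.inv_mem _ (hSt ht)) (hSU t ht).1
    have h2 : ContDiffWithinAt ℝ ∞ R c.tgt (c.toFun (c.inv t)) := h1
    rw [c.right_inv _ (hSt ht)] at h2
    exact h2.mono hSt
  have hRid : ∀ t ∈ S, (∀ i : Fin m, (i : ℕ) < c.k → t i = 0) → R t = t := fun t ht hti => by
    change c.toFun (r (c.inv t)) = t
    rw [(hSU t ht).2.2.1 hti, c.right_inv _ (hSt ht)]
  let Q := killOn m 0 c.k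
  let P : EuclideanSpace ℝ (Fin m) →L[ℝ] EuclideanSpace ℝ (Fin m) := ContinuousLinearMap.id ℝ _ - Q
  -- New coordinates: the boundary coordinates are kept, the others are replaced by those of the
  -- retracted point, so they become invariant under `r`.
  let Ψ : EuclideanSpace ℝ (Fin m) → EuclideanSpace ℝ (Fin m) := fun t => Q (R t) + P t
  have hΨs : ContDiffOn ℝ ∞ Ψ S :=
    (Q.contDiff.comp_contDiffOn hR).add P.contDiff.contDiffOn
  have hΨi : ∀ t, ∀ i : Fin m, (i : ℕ) < c.k → Ψ t i = t i := fun t i hi => by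
    simp [Ψ, P, Q, killOn_apply, scaleOn_apply_of_mem _ _ (Nat.zero_le _) hi]
  have hQΨ : ∀ t, Q (Ψ t) = Q (R t) := fun t => by
    simp [Ψ, P, Q, killOn_apply, scaleOn_zero_idem, map_add, map_sub]
  obtain ⟨B, hB⟩ := (hR _ ht₀S).differentiableWithinAt (by simp)
  -- `R` is the identity on the stratum. A line through `t₀` along the stratum stays in the sector
  -- in both directions, so the one-sided derivative `B` is determined on such vectors.
  have hBv : ∀ v, P v = 0 → B v = v := by
    intro v hv
    have hv' : ∀ i : Fin m, (i : ℕ) < c.k → v i = 0 := by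
      rw [← scaleOn_zero_eq_zero_iff]; exact hv
    have hline : HasDerivAt (fun s : ℝ => t₀ + s • v) v 0 := by
      simpa using ((hasDerivAt_id (0 : ℝ)).smul_const v).const_add t₀
    have hmem : ∀ᶠ s : ℝ in 𝓝 0, t₀ + s • v ∈ S := by
      have h1 : ∀ᶠ s : ℝ in 𝓝 0, t₀ + s • v ∈ T := by
        refine hline.continuousAt.eventually_mem (Metric.isOpen_ball.mem_nhds ?_)
        simp [hε]
      filter_upwards [h1] with s hs
      refine ⟨hs, fun i hi => ?_⟩
      simp [hv' i hi, h0 i hi]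
    have h2 : HasDerivWithinAt (fun s : ℝ => R (t₀ + s • v)) (B v)
        ((fun s : ℝ => t₀ + s • v) ⁻¹' S) 0 := by
      have h0' : HasFDerivWithinAt R B S (t₀ + (0 : ℝ) • v) := by simpa using hB
      exact h0'.comp_hasDerivWithinAt (0 : ℝ) hline.hasDerivWithinAt (mapsTo_preimage _ _)
    refine (h2.hasDerivAt hmem).unique (hline.congr_of_eventuallyEq ?_)
    filter_upwards [hmem] with s hs
    refine hRid _ hs fun i hi => ?_
    simp [hv' i hi, h0 i hi]
  let L : EuclideanSpace ℝ (Fin m) →L[ℝ] EuclideanSpace ℝ (Fin m) := Q.comp B + P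
  have hΨd : HasFDerivWithinAt Ψ L S t₀ :=
    (Q.hasFDerivAt.comp_hasFDerivWithinAt _ hB).add P.hasFDerivWithinAt
  -- If `Q B v + P v = 0`, applying `Q` gives `Q B v = 0` and hence `P v = 0`; then `B v = v`, so `Q
  -- v = 0` too.
  have hLinj : Function.Injective L.toLinearMap := by
    rw [← LinearMap.ker_eq_bot, LinearMap.ker_eq_bot']
    intro v hv
    have hv' : Q (B v) + P v = 0 := hv
    have hQQ : ∀ x, Q (Q x) = Q x := fun x => scaleOn_zero_idem _ _ _
    have h1 : Q (B v) = 0 := by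
      have := congrArg Q hv'
      simpa [P, map_add, map_sub, hQQ] using this
    have h2 : P v = 0 := by rwa [h1, zero_add] at hv'
    rw [hBv v h2] at h1
    have : v = Q v + P v := by simp [P]
    rw [this, h1, h2, add_zero]
  let E : EuclideanSpace ℝ (Fin m) ≃L[ℝ] EuclideanSpace ℝ (Fin m) :=
    (LinearEquiv.ofInjectiveEndo L.toLinearMap hLinj).toContinuousLinearEquiv
  have hE : (E : EuclideanSpace ℝ (Fin m) →L[ℝ] EuclideanSpace ℝ (Fin m)) = L := by
    ext1 v; rfl
  obtain ⟨T₀, T', χ, hT₀, hT', htT, hTT, hf, hg, hχ⟩ := exists_inverse_wedge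
    (ℓ := sectorFunctional m c.k) (m := sectorFunctional m c.k)
    (v := fun j => EuclideanSpace.single (j : Fin m) 1) (A := E) (Ψ := Ψ)
    sectorFunctional_single Metric.isOpen_ball ht₀S.1 (fun i => h0 i i.2)
    (by rw [wedge_sectorFunctional]; exact hΨs) (by rw [wedge_sectorFunctional, hE]; exact hΨd)
    (by
      intro t ht i
      rw [wedge_sectorFunctional] at ht
      simp only [sectorFunctional_apply, hΨi t i i.2]
      exact ⟨ht.2 i i.2, trivial⟩)
  rw [wedge_sectorFunctional] at hf hg hχ
  have hsub : T₀ ∩ c.tgt = T₀ ∩ cornerSector m c.k := by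
    ext t
    exact ⟨fun h => ⟨h.1, h.2.2⟩, fun h => ⟨h.1, hball (hTT h.1), h.2⟩⟩
  have hΨs' : ContDiffOn ℝ ∞ Ψ (T₀ ∩ c.tgt) := by
    rw [hsub]; exact hΨs.mono (inter_subset_inter_left _ hTT)
  let c1 := c.reparam c.k T₀ T' Ψ χ hT₀ hT' hΨs'.continuousOn hχ.continuousOn
    (by rw [hsub]; exact hf) (by rw [hsub]; exact hg)
  have hc1 : A.IsSmooth c1 := hc.reparam hΨs' hχ
  have hp1 : p ∈ c1.dom := ⟨hp, htT⟩
  have hc1p : c1.toFun p = t₀ := by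
    change Ψ t₀ = t₀
    have hQ : Q t₀ = t₀ := scaleOn_eq_self _ fun i _ hi => h0 i hi
    simp only [Ψ, P, hRid t₀ ht₀S h0]
    simp
  obtain ⟨δ, hδ, hdomδ, hballδ⟩ := c1.exists_restr_subset hp1
    (U := {q | r q ∈ c1.dom ∧ r (r q) = r q}) (by
      filter_upwards [hrt (c1.isOpen_dom.mem_nhds hp1), hU] with q h1 h2
      exact ⟨h1, h2.2.2.2.2⟩)
  rw [hc1p] at hdomδ hballδ
  set c2 := c1.restr (Metric.ball t₀ δ) Metric.isOpen_ball with hc2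
  refine ⟨c2, hc1.restr, ⟨hp1, ?_⟩, fun q hq => hq.1.1, rfl, fun q hq i hi => hΨi _ i hi, ?_⟩
  · rw [mem_preimage, hc1p]; exact Metric.mem_ball_self hδ
  intro t ht
  have htc : c2.inv t ∈ c2.dom := c2.inv_mem t ht
  obtain ⟨h1, h2⟩ := hdomδ htc
  -- The point `r q` lies on the stratum, so `P` kills its coordinates, and `r (r q) = r q`; hence
  -- its new coordinates are `Q` of the old coordinates of `r q`, which is `Q` of the new
  -- coordinates of `q`.
  have h3 : c1.toFun (r (c2.inv t)) = scaleOn 0 c.k 0 t := by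
    have e1 : c1.toFun (r (c2.inv t)) = Ψ (c.toFun (r (c2.inv t))) := rfl
    have e2 : R (c.toFun (r (c2.inv t))) = c.toFun (r (c2.inv t)) := by
      change c.toFun (r (c.inv (c.toFun (r (c2.inv t))))) = _
      rw [c.left_inv _ h1.1, h2]
    have hq1 := htc.1
    have hz : ∀ i : Fin m, (i : ℕ) < c.k → c.toFun (r (c2.inv t)) i = 0 := by
      have hs : c.toFun (c2.inv t) ∈ S := ⟨hTT hq1.2, (c.map_mem _ hq1.1).2⟩
      have := (hSU _ hs).2.1
      rwa [c.left_inv _ hq1.1] at this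
    have e3 : P (c.toFun (r (c2.inv t))) = 0 := scaleOn_zero_eq_zero_iff.2 hz
    have e4 : c2.toFun (c2.inv t) = Ψ (c.toFun (c2.inv t)) := rfl
    have e5 : R (c.toFun (c2.inv t)) = c.toFun (r (c2.inv t)) := by
      change c.toFun (r (c.inv (c.toFun (c2.inv t)))) = _
      rw [c.left_inv _ hq1.1]
    rw [e1]
    change Q (R _) + P _ = _
    rw [e2, e3, add_zero, ← e5, ← hQΨ, ← e4, c2.right_inv t ht]
    rfl
  refine ⟨⟨⟨?_, ?_⟩, scaleOn_mem_cornerSector le_rfl ht.2⟩, ?_⟩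
  · exact hballδ ((dist_scaleOn_le le_rfl zero_le_one fun i _ hi => h0 i hi).trans_lt ht.1.2)
  · exact (dist_scaleOn_le le_rfl zero_le_one fun i _ hi => h0 i hi).trans_lt ht.1.2
  · rw [← h3]
    exact (c1.left_inv _ h1).symm

end Adapt

/-! ### Straightening an atlas along a stratum -/

section Straighten

variable {m : ℕ} {Y : Type*} [TopologicalSpace Y]

namespace CornerChart

/-- Straightening the angle between the last two boundary coordinates of a corner chart. -/
def straight (c : CornerChart Y m) (k : ℕ) (hk : c.k = k + 2) (hm : k + 1 < m) :
    CornerChart Y m :=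
  c.reparam (k + 1) univ (foldPair k ⁻¹' c.cod) (straightenPair k) (foldPair k) isOpen_univ
    (c.isOpen_cod.preimage (continuous_foldPair hm)) (continuous_straightenPair hm).continuousOn
    (continuous_foldPair hm).continuousOn
    (fun t ht => by
      have h1 : t ∈ cornerSector m (k + 2) := hk ▸ ht.2.2
      have h2 := foldPair_straightenPair hm h1
      exact ⟨⟨by rw [mem_preimage, h2]; exact ht.2.1, straightenPair_mem hm h1⟩, h2⟩)
    (fun y hy => ⟨⟨mem_univ _, hy.1, by rw [hk]; exact foldPair_mem hm hy.2⟩,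
      straightenPair_foldPair hm hy.2⟩)

theorem straight_dom (c : CornerChart Y m) (k : ℕ) (hk : c.k = k + 2) (hm : k + 1 < m) :
    (c.straight k hk hm).dom = c.dom := inter_eq_left.2 fun _ _ => mem_univ _

theorem straight_tgt {c : CornerChart Y m} {k : ℕ} {hk : c.k = k + 2} {hm : k + 1 < m}
    {t : EuclideanSpace ℝ (Fin m)} (ht : t ∈ (c.straight k hk hm).tgt) : foldPair k t ∈ c.tgt :=
  ⟨ht.1, by rw [hk]; exact foldPair_mem hm ht.2⟩

end CornerChart

/-- Straightening changes only coordinates that are killed here, so the projection onto the edge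
looks the same before and after it. -/
theorem scaleOn_straightenPair {k l j : ℕ} (hm : k + 1 < m) (hl : l ≤ k) (hj : k + 2 ≤ j)
    (x : EuclideanSpace ℝ (Fin m)) : scaleOn l j 0 (straightenPair k x) = scaleOn l j 0 x := by
  ext i
  simp only [scaleOn_apply]
  split_ifs with h
  · simp
  · exact straightenPair_of_ne hm x (by omega) (by omega)

theorem scaleOn_foldPair {k l j : ℕ} (hm : k + 1 < m) (hl : l ≤ k) (hj : k + 2 ≤ j)
    (x : EuclideanSpace ℝ (Fin m)) : scaleOn l j 0 (foldPair k x) = scaleOn l j 0 x := by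
  ext i
  simp only [scaleOn_apply]
  split_ifs with h
  · simp
  · exact foldPair_of_ne hm x (by omega) (by omega)

/-- A chart that can be straightened along the stratum `f₁ = f₂ = 0`, with the help of the
retraction `r` onto this stratum. -/
structure IsStraightenable (A : CornerAtlas Y m) (r : Y → Y) (f₁ f₂ : Y → ℝ) (k : ℕ)
    (c : CornerChart Y m) : Prop where
  isSmooth : A.IsSmooth c
  k_eq : c.k = k + 2
  lt : k + 1 < m
  fst : ∀ q ∈ c.dom, c.toFun q ⟨k, (Nat.lt_succ_self k).trans lt⟩ = f₁ q
  snd : ∀ q ∈ c.dom, c.toFun q ⟨k + 1, lt⟩ = f₂ q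
  adapted : c.IsAdapted r k (k + 2)

namespace IsStraightenable

variable {A : CornerAtlas Y m} {r : Y → Y} {f₁ f₂ : Y → ℝ} {k k' : ℕ} {c d : CornerChart Y m}

/-- The straightened chart. -/
def chart (h : IsStraightenable A r f₁ f₂ k c) : CornerChart Y m := c.straight k h.k_eq h.lt

theorem chart_dom (h : IsStraightenable A r f₁ f₂ k c) : h.chart.dom = c.dom :=
  c.straight_dom k _ _

theorem chart_toFun (h : IsStraightenable A r f₁ f₂ k c) (q : Y) :
    h.chart.toFun q = straightenPair k (c.toFun q) := rfl

theorem chart_fst (h : IsStraightenable A r f₁ f₂ k c) {q : Y} (hq : q ∈ c.dom) :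
    h.chart.toFun q ⟨k, (Nat.lt_succ_self k).trans h.lt⟩ = dblSin (f₁ q) (f₂ q) := by
  rw [chart_toFun, straightenPair_fst h.lt, h.fst q hq, h.snd q hq]

theorem chart_snd (h : IsStraightenable A r f₁ f₂ k c) {q : Y} (hq : q ∈ c.dom) :
    h.chart.toFun q ⟨k + 1, h.lt⟩ = dblCos (f₁ q) (f₂ q) := by
  rw [chart_toFun, straightenPair_snd h.lt, h.fst q hq, h.snd q hq]

theorem retr_eq (h : IsStraightenable A r f₁ f₂ k c) {q : Y} (hq : q ∈ c.dom) :
    r q ∈ c.dom ∧ c.toFun (r q) = scaleOn k (k + 2) 0 (c.toFun q) ∧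
      r q = c.inv (scaleOn k (k + 2) 0 (c.toFun q)) := by
  obtain ⟨h1, h2⟩ := h.adapted _ (c.map_mem q hq)
  rw [c.left_inv q hq] at h2
  rw [h2]
  exact ⟨c.inv_mem _ h1, c.right_inv _ h1, rfl⟩

/-- This is why straightened charts are compatible. The two straightened coordinates are the same
functions `dblSin (f₁, f₂)` and `dblCos (f₁, f₂)` in every chart. Any other coordinate of `g y`
equals that of `r (g y) = g (r y)`, so it is an old smooth function composed with the linear
projection onto the edge, and never sees the non-smooth doubling map. The charts may have different
codimensions, hence the two indices `k` and `k'`. The factor `σ` admits an involution that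
interchanges `f₁` and `f₂`. -/
theorem smoothVia (h : IsStraightenable A r f₁ f₂ k c) (h' : IsStraightenable A r f₁ f₂ k' d)
    {g : Y → Y} (hg : ∀ q, A.SmoothMapAt A g q) (hgr : ∀ q, r (g q) = g (r q)) {σ : ℝ}
    (hs : ∀ q, dblSin (f₁ (g q)) (f₂ (g q)) = dblSin (f₁ q) (f₂ q))
    (hc : ∀ q, dblCos (f₁ (g q)) (f₂ (g q)) = σ * dblCos (f₁ q) (f₂ q))
    {q : Y} (hq : q ∈ c.dom) (hgq : g q ∈ d.dom) : h.chart.SmoothVia h'.chart g q := by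
  have hq' : q ∈ h.chart.dom := by rwa [h.chart_dom]
  have hev : ∀ᶠ y in 𝓝 q, y ∈ c.dom ∧ g y ∈ d.dom :=
    Filter.Eventually.and (c.isOpen_dom.mem_nhds hq) ((hg q).1.eventually (d.isOpen_dom.mem_nhds hgq))
  refine CornerChart.smoothFn_euclidean.2 fun i => ?_
  by_cases hi : (i : ℕ) = k'
  · obtain rfl : i = ⟨k', (Nat.lt_succ_self k').trans h'.lt⟩ := Fin.ext hi
    refine (h.chart.smoothFn_coord hq' ⟨k, (Nat.lt_succ_self k).trans h.lt⟩).congr hq' ?_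
    filter_upwards [hev] with y hy
    rw [h'.chart_fst hy.2, h.chart_fst hy.1, hs]
  by_cases hi' : (i : ℕ) = k' + 1
  · obtain rfl : i = ⟨k' + 1, h'.lt⟩ := Fin.ext hi'
    have h1 : h.chart.SmoothFn (fun y => σ * h.chart.toFun y ⟨k + 1, h.lt⟩) q :=
      (h.chart.smoothFn_coord hq' ⟨k + 1, h.lt⟩).contDiffAt_comp (F := fun x => σ * x) hq'
        (by fun_prop)
    refine h1.congr hq' ?_
    filter_upwards [hev] with y hy
    rw [h'.chart_snd hy.2, h.chart_snd hy.1, hc]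
  · obtain ⟨h1, h2, h3⟩ := h.retr_eq hq
    have h4 : g (r q) ∈ d.dom := by rw [← hgr]; exact (h'.retr_eq hgq).1
    have h5 : ContDiffWithinAt ℝ ∞ (fun t => d.toFun (g (c.inv t)) i) c.tgt (c.toFun (r q)) :=
      CornerChart.smoothFn_euclidean.1
        ((hg (r q)).2 c d h.isSmooth h'.isSmooth h1 h4) i
    rw [h2, ← scaleOn_straightenPair h.lt le_rfl le_rfl] at h5
    have h6 : ContDiffWithinAt ℝ ∞
        (fun t => d.toFun (g (c.inv (killOn m k (k + 2) t))) i) h.chart.tgt (h.chart.toFun q) := by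
      refine ContDiffWithinAt.comp (h.chart.toFun q)
        (g := fun t => d.toFun (g (c.inv t)) i) h5 (killOn m k (k + 2)).contDiff.contDiffWithinAt ?_
      intro t ht
      have := (h.adapted _ (CornerChart.straight_tgt ht)).1
      rwa [scaleOn_foldPair h.lt le_rfl le_rfl] at this
    refine CornerChart.smoothFn_of_contDiffAt hq' h6 ?_
    filter_upwards [hev] with y hy
    rw [h'.chart_toFun, straightenPair_of_ne h'.lt _ hi hi', killOn_apply, h.chart_toFun,
      scaleOn_straightenPair h.lt le_rfl le_rfl, ← (h.retr_eq hy.1).2.2, ← hgr,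
      (h'.retr_eq hy.2).2.1]
    rw [scaleOn_apply, if_neg (by omega)]

/-- Off the edge the doubling of the angle is a diffeomorphism of the quarter plane with the half
plane. -/
theorem smoothVia_chart (h : IsStraightenable A r f₁ f₂ k c) {q : Y} (hq : q ∈ c.dom)
    (hqZ : ¬(f₁ q = 0 ∧ f₂ q = 0)) :
    h.chart.SmoothVia c (fun y => y) q ∧ c.SmoothVia h.chart (fun y => y) q := by
  have hq' : q ∈ h.chart.dom := by rwa [h.chart_dom]
  have hqZ' := hqZ
  rw [← h.fst q hq, ← h.snd q hq] at hqZ'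
  rw [← dbl_eq_zero_iff, ← h.chart_fst hq, ← h.chart_snd hq] at hqZ
  constructor
  · refine CornerChart.smoothFn_of_contDiffAt hq' (F := foldPair k)
      ((contDiffWithinAt_foldPair h.lt (h.chart.map_mem q hq').2 hqZ).mono fun t ht => ht.2) ?_
    filter_upwards [c.isOpen_dom.mem_nhds hq] with y hy
    rw [h.chart_toFun, foldPair_straightenPair h.lt]
    have := (c.map_mem y hy).2
    rwa [h.k_eq] at this
  · exact CornerChart.smoothFn_of_contDiffAt hq
      (contDiffAt_straightenPair h.lt hqZ').contDiffWithinAt (Filter.Eventually.of_forall fun _ => rfl)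

end IsStraightenable

/-- The new atlas consists of the old smooth charts that miss the edge `f₁ = f₂ = 0` and of the
straightened ones. So nothing changes off the edge, and a smooth map that commutes with `r` and
respects the doubled coordinates remains smooth. -/
theorem exists_straightened_atlas (A : CornerAtlas Y m) {r : Y → Y} {f₁ f₂ : Y → ℝ}
    (hf₁ : Continuous f₁) (hf₂ : Continuous f₂)
    (h : ∀ p, f₁ p = 0 → f₂ p = 0 → ∃ k c, IsStraightenable A r f₁ f₂ k c ∧ p ∈ c.dom) :
    ∃ A' : CornerAtlas Y m,
      (∀ c : CornerChart Y m, (∀ q ∈ c.dom, ¬(f₁ q = 0 ∧ f₂ q = 0)) →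
        (A.IsSmooth c ↔ A'.IsSmooth c)) ∧
      (∀ k c (hc : IsStraightenable A r f₁ f₂ k c), A'.IsSmooth hc.chart) ∧
      ∀ (g : Y → Y) (σ : ℝ), σ ≠ 0 → (∀ q, A.SmoothMapAt A g q) → (∀ q, r (g q) = g (r q)) →
        (∀ q, dblSin (f₁ (g q)) (f₂ (g q)) = dblSin (f₁ q) (f₂ q)) →
        (∀ q, dblCos (f₁ (g q)) (f₂ (g q)) = σ * dblCos (f₁ q) (f₂ q)) →
        ∀ q, A'.SmoothMapAt A' g q := by
  have hoff : ∀ q, ¬(f₁ q = 0 ∧ f₂ q = 0) → ∃ c : CornerChart Y m, A.IsSmooth c ∧ q ∈ c.dom ∧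
      ∀ q ∈ c.dom, ¬(f₁ q = 0 ∧ f₂ q = 0) := by
    intro q hq
    obtain ⟨c, hc, hqc⟩ := A.cover q
    obtain ⟨ε, hε, hd, -⟩ := c.exists_restr_subset hqc (U := {q | ¬(f₁ q = 0 ∧ f₂ q = 0)}) (by
      have : IsClosed {q | f₁ q = 0 ∧ f₂ q = 0} :=
        (isClosed_eq hf₁ continuous_const).inter (isClosed_eq hf₂ continuous_const)
      exact this.isOpen_compl.mem_nhds hq)
    exact ⟨_, (CornerAtlas.isSmooth_of_mem hc).restr, ⟨hqc, Metric.mem_ball_self hε⟩, hd⟩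
  let A' : CornerAtlas Y m :=
    { charts := {c | (A.IsSmooth c ∧ ∀ q ∈ c.dom, ¬(f₁ q = 0 ∧ f₂ q = 0)) ∨
        ∃ k d, ∃ hd : IsStraightenable A r f₁ f₂ k d, c = hd.chart}
      cover := fun q => by
        by_cases hq : f₁ q = 0 ∧ f₂ q = 0
        · obtain ⟨k, c, hc, hqc⟩ := h q hq.1 hq.2
          exact ⟨hc.chart, Or.inr ⟨k, c, hc, rfl⟩, by rwa [hc.chart_dom]⟩
        · obtain ⟨c, hc, hqc, hcZ⟩ := hoff q hq
          exact ⟨c, Or.inl ⟨hc, hcZ⟩, hqc⟩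
      compat := by
        rintro c (⟨hc, hcZ⟩ | ⟨k, c, hc, rfl⟩) d (⟨hd, hdZ⟩ | ⟨k', d, hd, rfl⟩) q hqc hqd
        · exact hc.smoothVia hd hqc hqd
        · rw [hd.chart_dom] at hqd
          exact CornerChart.SmoothVia.comp (g := fun y => y) (g' := fun y => y) hqc hqd
            continuousAt_id (hc.smoothVia hd.isSmooth hqc hqd)
            (hd.smoothVia_chart hqd (hcZ q hqc)).2
        · have hqc' := hqc
          rw [hc.chart_dom] at hqc
          exact CornerChart.SmoothVia.comp (g := fun y => y) (g' := fun y => y) hqc' hqc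
            continuousAt_id (hc.smoothVia_chart hqc (hdZ q hqd)).1
            (hc.isSmooth.smoothVia hd hqc hqd)
        · rw [hc.chart_dom] at hqc
          rw [hd.chart_dom] at hqd
          exact hc.smoothVia hd (g := fun y => y) (σ := 1) CornerAtlas.smoothMapAt_id
            (fun _ => rfl) (fun _ => rfl) (fun _ => (one_mul _).symm) hqc hqd }
  have hA : ∀ c : CornerChart Y m, A.IsSmooth c → (∀ q ∈ c.dom, ¬(f₁ q = 0 ∧ f₂ q = 0)) →
      A'.IsSmooth c := fun c hc hcZ => CornerAtlas.isSmooth_of_mem (Or.inl ⟨hc, hcZ⟩)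
  have hA2 : ∀ k c (hc : IsStraightenable A r f₁ f₂ k c), A'.IsSmooth hc.chart :=
    fun k c hc => CornerAtlas.isSmooth_of_mem (Or.inr ⟨k, c, hc, rfl⟩)
  refine ⟨A', fun c hcZ => ⟨fun hc => hA c hc hcZ, fun hc => ?_⟩, hA2, ?_⟩
  · refine CornerAtlas.isSmooth_of_forall fun q hq => ?_
    obtain ⟨d, hd, hqd, hdZ⟩ := hoff q (hcZ q hq)
    have hd' := hA d hd hdZ
    exact ⟨d, hd, hqd, hc.smoothVia hd' hq hqd, hd'.smoothVia hc hqd hq⟩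
  · intro g σ hσ hg hgr hs hc q
    -- Here `σ ≠ 0` is needed: `g` must preserve both the edge and its complement, so that charts of
    -- the same kind can be used at `q` and at `g q`.
    have hZ : (f₁ (g q) = 0 ∧ f₂ (g q) = 0) ↔ (f₁ q = 0 ∧ f₂ q = 0) := by
      rw [← dbl_eq_zero_iff (f₁ (g q)), ← dbl_eq_zero_iff (f₁ q), hs, hc, mul_eq_zero, or_iff_right hσ]
    by_cases hq : f₁ q = 0 ∧ f₂ q = 0
    · obtain ⟨k, c, hcs, hqc⟩ := h q hq.1 hq.2
      obtain ⟨k', d, hds, hqd⟩ := h (g q) (hZ.2 hq).1 (hZ.2 hq).2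
      exact CornerAtlas.smoothMapAt_of_smoothVia (hg q).1 (hA2 _ _ hcs) (hA2 _ _ hds)
        (by rwa [hcs.chart_dom]) (by rwa [hds.chart_dom])
        (hcs.smoothVia hds hg hgr hs hc hqc hqd)
    · obtain ⟨c, hcs, hqc, hcZ⟩ := hoff q hq
      obtain ⟨d, hds, hqd, hdZ⟩ := hoff (g q) (hZ.not.2 hq)
      exact CornerAtlas.smoothMapAt_of_smoothVia (hg q).1 (hA c hcs hcZ) (hA d hds hdZ) hqc hqd
        ((hg q).2 c d hcs hds hqc hqd)

end Straighten

/-! ### Straightening an atlas with corners of codimension three -/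

section StraightenAll

variable {m : ℕ} {Y : Type*} [TopologicalSpace Y]

/-- The boundary coordinates of the corner chart `c` are the functions `f`. -/
structure CornerChart.HasBoundaryCoords (c : CornerChart Y m) {k : ℕ} (f : Fin k → Y → ℝ) :
    Prop where
  k_eq : c.k = k
  le : k ≤ m
  eq : ∀ q ∈ c.dom, ∀ i : Fin k, c.toFun q (Fin.castLE le i) = f i q

namespace CornerChart.HasBoundaryCoords

variable {c : CornerChart Y m} {k : ℕ} {f : Fin k → Y → ℝ}

theorem eq' (h : c.HasBoundaryCoords f) {q : Y} (hq : q ∈ c.dom) {i : Fin m} (hi : (i : ℕ) < k) :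
    c.toFun q i = f ⟨i, hi⟩ q := h.eq q hq ⟨i, hi⟩

theorem zero_iff (h : c.HasBoundaryCoords f) {q : Y} (hq : q ∈ c.dom) :
    (∀ i : Fin m, (i : ℕ) < k → c.toFun q i = 0) ↔ ∀ i, f i q = 0 := by
  constructor
  · intro h1 i
    rw [← h.eq q hq i]
    exact h1 _ i.2
  · intro h1 i hi
    rw [h.eq' hq hi, h1]

theorem restr (h : c.HasBoundaryCoords f) {T : Set (EuclideanSpace ℝ (Fin m))} {hT : IsOpen T} :
    (c.restr T hT).HasBoundaryCoords f := ⟨h.k_eq, h.le, fun q hq => h.eq q hq.1⟩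

end CornerChart.HasBoundaryCoords

variable {A : CornerAtlas Y m} {τ : Y → Y}

theorem isShrinkingChart_of_hasBoundaryCoords {Ξ : Type*} {c : CornerChart Y m} {k : ℕ}
    {f : Fin k → Y → ℝ} {N : Set Y} {ξ : Y → Ξ} (hc : A.IsSmooth c) (h : c.HasBoundaryCoords f)
    (hN : Disjoint c.dom N) : IsShrinkingChart A {q | ∀ i, f i q = 0} N ξ 0 k c where
  isSmooth := hc
  mem_iff q hq := by
    rw [mem_ofPred_eq, ← h.zero_iff hq]
    simp
  scale q hq hqN := (hN.le_bot ⟨hq, hqN⟩).elim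

theorem exists_adapted_of_isStratumMap {Ξ : Type*} {c : CornerChart Y m} {k : ℕ}
    {f : Fin k → Y → ℝ} {N : Set Y} {ξ : Y → Ξ} (hc : A.IsSmooth c) (h : c.HasBoundaryCoords f)
    {r : Y → Y} (hr : IsStratumMap A τ {q | ∀ i, f i q = 0} N ξ r) {p : Y} (hp : p ∈ c.dom)
    (hpZ : ∀ i, f i p = 0) (hev : ∀ᶠ q in 𝓝 p, ∀ i, f i (r q) = 0) :
    ∃ c' : CornerChart Y m, A.IsSmooth c' ∧ p ∈ c'.dom ∧ c'.dom ⊆ c.dom ∧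
      c'.HasBoundaryCoords f ∧ c'.IsAdapted r 0 k := by
  have hk := h.k_eq
  have hrp : r p = p := hr.eq_self p hpZ
  have hrt : Filter.Tendsto r (𝓝 p) (𝓝 p) := by
    have := (hr.smooth p).1; rwa [ContinuousAt, hrp] at this
  obtain ⟨c', h1, h2, h3, h4, h5, h6⟩ := exists_adapted hc hp (by rwa [hk, h.zero_iff hp]) hr.smooth
    hrp (by
      filter_upwards [hev, hrt (c.isOpen_dom.mem_nhds hp)] with q hq hq'
      rwa [hk, h.zero_iff hq']) (by
      filter_upwards [c.isOpen_dom.mem_nhds hp] with q hq hq'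
      rw [hk, h.zero_iff hq] at hq'
      exact hr.eq_self q hq')
  rw [hk] at h6
  refine ⟨c', h1, h2, h3, ⟨h4.trans hk, h.le, fun q hq i => ?_⟩, h6⟩
  rw [h5 q hq _ (by rw [hk]; exact i.2)]
  exact h.eq q (h3 hq) i

/-- Near the deepest stratum, which is given by the vanishing of the first three coordinates, the
stratum `Z` is given by the vanishing of two of them, and the third one is the function `e`. -/
structure IsTripleChart (A : CornerAtlas Y m) (r₃ : Y → Y) (w e : Y → ℝ) (Z : Set Y) (l : ℕ)
    (c : CornerChart Y m) : Prop where
  isSmooth : A.IsSmooth c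
  lt : 2 < m
  le_one : l ≤ 1
  mem_iff : ∀ q ∈ c.dom, q ∈ Z ↔ ∀ i : Fin m, l ≤ (i : ℕ) → (i : ℕ) < l + 2 → c.toFun q i = 0
  coord : ∀ q ∈ c.dom, ∀ i : Fin m, (i : ℕ) < 3 → ¬(l ≤ (i : ℕ) ∧ (i : ℕ) < l + 2) →
    c.toFun q i = e q
  sum_sq : ∀ q ∈ c.dom, w q = c.toFun q ⟨0, by omega⟩ ^ 2 + c.toFun q ⟨1, by omega⟩ ^ 2 +
    c.toFun q ⟨2, lt⟩ ^ 2
  adapted : c.IsAdapted r₃ 0 3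

namespace IsTripleChart

variable {r₃ : Y → Y} {w e : Y → ℝ} {Z : Set Y} {l : ℕ} {c : CornerChart Y m}

theorem retr_eq (h : IsTripleChart A r₃ w e Z l c) {q : Y} (hq : q ∈ c.dom) :
    r₃ q ∈ c.dom ∧ c.toFun (r₃ q) = scaleOn 0 3 0 (c.toFun q) ∧
      r₃ q = c.inv (scaleOn 0 3 0 (c.toFun q)) := by
  obtain ⟨h1, h2⟩ := h.adapted _ (c.map_mem q hq)
  rw [c.left_inv q hq] at h2
  rw [h2]
  exact ⟨c.inv_mem _ h1, c.right_inv _ h1, rfl⟩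

/-- Shrinking the two coordinates transverse to `Z` does not increase `w`, leaves the third
coordinate `e` alone, and is invisible to `r₃`, which kills all three. -/
theorem isShrinkingChart (h : IsTripleChart A r₃ w e Z l c) (ε : ℝ) :
    IsShrinkingChart A Z {q | w q < ε} (fun q => (e q, r₃ q)) l (l + 2) c where
  isSmooth := h.isSmooth
  mem_iff := h.mem_iff
  scale q hq hqN σ h0 h1 ht := by
    have hl := h.le_one
    set t := scaleOn l (l + 2) σ (c.toFun q) with ht_def
    have hd := c.inv_mem t ht
    have ht' := c.right_inv t ht
    refine ⟨lt_of_le_of_lt ?_ (show w q < ε from hqN), Prod.ext ?_ ?_⟩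
    · rw [h.sum_sq _ hd, h.sum_sq q hq, ht']
      have key : ∀ i : Fin m, t i ^ 2 ≤ c.toFun q i ^ 2 := fun i => by
        rw [ht_def, scaleOn_apply]
        split_ifs
        · rw [mul_pow]
          exact mul_le_of_le_one_left (sq_nonneg _) (pow_le_one₀ h0 h1)
        · exact le_rfl
      have := key ⟨0, by have := h.lt; omega⟩
      have := key ⟨1, by have := h.lt; omega⟩
      have := key ⟨2, h.lt⟩
      linarith
    · obtain ⟨j, hj3, hj⟩ : ∃ j : Fin m, (j : ℕ) < 3 ∧ ¬(l ≤ (j : ℕ) ∧ (j : ℕ) < l + 2) := by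
        rcases Nat.le_one_iff_eq_zero_or_eq_one.1 hl with rfl | rfl
        · exact ⟨⟨2, h.lt⟩, by simp⟩
        · exact ⟨⟨0, by have := h.lt; omega⟩, by simp⟩
      change e (c.inv t) = e q
      rw [← h.coord _ hd j hj3 hj, ← h.coord q hq j hj3 hj, ht', ht_def, scaleOn_apply, if_neg hj]
    · change r₃ (c.inv t) = r₃ q
      rw [(h.retr_eq hd).2.2, (h.retr_eq hq).2.2, ht', ht_def]
      congr 1
      ext i
      simp only [scaleOn_apply]
      split_ifs <;> first | omega | simp

/-- All coordinates of `r q` are forced: two vanish because `r q ∈ Z`, the third is `e`, which `r`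
preserves, and those beyond the first three are read off from `r₃`, which `r` preserves as well. So
the chart is adapted to `r` after mere restriction and keeps its coordinates, in particular its
relation to `r₃`. -/
theorem exists_restr_adapted (h : IsTripleChart A r₃ w e Z l c) {ε : ℝ} {r : Y → Y}
    (hr : IsStratumMap A τ Z {q | w q < ε} (fun q => (e q, r₃ q)) r) {p : Y} (hp : p ∈ c.dom)
    (hpw : w p = 0) (hε : 0 < ε) (hw : Continuous w) (hev : ∀ᶠ q in 𝓝 p, r q ∈ Z) :
    ∃ δ > 0, (c.restr (Metric.ball (c.toFun p) δ) Metric.isOpen_ball).IsAdapted r l (l + 2) := by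
  have hl := h.le_one
  have h0 : ∀ i : Fin m, (i : ℕ) < 3 → c.toFun p i = 0 := by
    have h1 := h.sum_sq p hp
    rw [hpw] at h1
    rintro ⟨i, hi⟩ hi3
    simp only at hi3
    interval_cases i <;> nlinarith [sq_nonneg (c.toFun p ⟨0, by have := h.lt; omega⟩),
      sq_nonneg (c.toFun p ⟨1, by have := h.lt; omega⟩), sq_nonneg (c.toFun p ⟨2, h.lt⟩)]
  have h0' : ∀ i : Fin m, l ≤ (i : ℕ) → (i : ℕ) < l + 2 → c.toFun p i = 0 := fun i _ hi =>
    h0 i (by omega)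
  have hpZ : p ∈ Z := (h.mem_iff p hp).2 h0'
  have hrt : Filter.Tendsto r (𝓝 p) (𝓝 p) := by
    have := (hr.smooth p).1; rwa [ContinuousAt, hr.eq_self p hpZ] at this
  obtain ⟨δ, hδ, hdom, hball⟩ := c.exists_restr_subset hp
    (U := {q | r q ∈ c.dom ∧ r q ∈ Z ∧ w q < ε}) (by
      filter_upwards [hrt (c.isOpen_dom.mem_nhds hp), hev,
        hw.continuousAt.eventually (Iio_mem_nhds (hpw.trans_lt hε))] with q h1 h2 h3
      exact ⟨h1, h2, h3⟩)
  refine ⟨δ, hδ, fun t ht => ?_⟩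
  set d := c.restr (Metric.ball (c.toFun p) δ) Metric.isOpen_ball
  have hd := d.inv_mem t ht
  obtain ⟨h1, h2, h3⟩ := hdom hd
  have hb : scaleOn l (l + 2) 0 t ∈ Metric.ball (c.toFun p) δ :=
    (dist_scaleOn_le le_rfl zero_le_one h0').trans_lt ht.1.2
  refine ⟨⟨⟨hball hb, hb⟩, scaleOn_mem_cornerSector le_rfl ht.2⟩, ?_⟩
  have hcd : d.inv t ∈ c.dom := hd.1
  have ht' : c.toFun (d.inv t) = t := d.right_inv t ht
  have h4 := (hr.preserves (d.inv t) h3).2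
  have h5 : e (r (d.inv t)) = e (d.inv t) := congrArg Prod.fst h4
  have h6 : r₃ (r (d.inv t)) = r₃ (d.inv t) := congrArg Prod.snd h4
  have h7 := congrArg c.toFun h6
  rw [(h.retr_eq h1).2.1, (h.retr_eq hcd).2.1, ht'] at h7
  have h8 : c.toFun (r (d.inv t)) = scaleOn l (l + 2) 0 t := by
    ext i
    rw [scaleOn_apply]
    split_ifs with hi
    · rw [zero_mul, (h.mem_iff _ h1).1 h2 i hi.1 hi.2]
    · by_cases hi3 : (i : ℕ) < 3
      · rw [h.coord _ h1 i hi3 hi, h5, ← h.coord _ hcd i hi3 hi, ht']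
      · have := congrArg (fun x : EuclideanSpace ℝ (Fin m) => x i) h7
        simpa only [scaleOn_apply, if_neg (show ¬(0 ≤ (i : ℕ) ∧ (i : ℕ) < 3) by omega)] using this
  change r (d.inv t) = c.inv (scaleOn l (l + 2) 0 t)
  rw [← h8, c.left_inv _ h1]

end IsTripleChart

/-- On the compact complement of `O` the function `w` has a positive minimum. -/
theorem exists_pos_sublevel_subset [CompactSpace Y] {w : Y → ℝ} (hw : Continuous w)
    (hw0 : ∀ q, 0 ≤ w q) {O : Set Y} (hO : IsOpen O) (h : ∀ q, w q = 0 → q ∈ O) :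
    ∃ ε > 0, ∀ q, w q < ε → q ∈ O := by
  rcases Oᶜ.eq_empty_or_nonempty with hE | hne
  · exact ⟨1, one_pos, fun q _ => by_contra fun hq => (hE ▸ hq : q ∈ (∅ : Set Y))⟩
  · obtain ⟨p, hp, hmin⟩ := hO.isClosed_compl.isCompact.exists_isMinOn hne hw.continuousOn
    refine ⟨w p, lt_of_le_of_ne (hw0 p) fun h' => hp (h p h'.symm), fun q hq => ?_⟩
    by_contra hqO
    exact absurd (hmin hqO) (not_le.2 hq)

/-- A retraction onto a stratum, which has a normal form both near the deepest stratum and away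
from it. -/
theorem exists_compatible_retraction [T2Space Y] [CompactSpace Y]
    (hτ : ∀ q, A.SmoothMapAt A τ q) (hττ : ∀ q, τ (τ q) = q) (hfree : ∀ q, τ q ≠ q)
    {r₃ : Y → Y} (hr₃ : ∀ q, r₃ (τ q) = τ (r₃ q)) {w e : Y → ℝ} (hw : Continuous w)
    (hw0 : ∀ q, 0 ≤ w q) (hwτ : ∀ q, w (τ q) = w q)
    (heτ : ∀ q q', e q = e q' → e (τ q) = e (τ q')) {f : Fin 2 → Y → ℝ}
    (hf : ∀ i, Continuous (f i)) (hfτ : ∀ q, (∀ i, f i q = 0) → ∀ i, f i (τ q) = 0) {l : ℕ}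
    (h1 : ∀ p, w p = 0 → ∃ c, IsTripleChart A r₃ w e {q | ∀ i, f i q = 0} l c ∧ p ∈ c.dom)
    (h2 : ∀ p, (∀ i, f i p = 0) → w p ≠ 0 → ∃ c : CornerChart Y m, A.IsSmooth c ∧
      c.HasBoundaryCoords f ∧ p ∈ c.dom) :
    ∃ r : Y → Y, (∀ q, r (τ q) = τ (r q)) ∧
      (∀ c, IsTripleChart A r₃ w e {q | ∀ i, f i q = 0} l c → ∀ p ∈ c.dom, w p = 0 →
        ∃ δ > 0, (c.restr (Metric.ball (c.toFun p) δ) Metric.isOpen_ball).IsAdapted r l (l + 2)) ∧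
      (∀ c : CornerChart Y m, A.IsSmooth c → c.HasBoundaryCoords f → ∀ p ∈ c.dom,
        (∀ i, f i p = 0) → ∃ c' : CornerChart Y m, A.IsSmooth c' ∧ p ∈ c'.dom ∧ c'.dom ⊆ c.dom ∧
          c'.HasBoundaryCoords f ∧ c'.IsAdapted r 0 2) := by
  have hZc : IsClosed {q | ∀ i, f i q = 0} := by
    simp only [ofPred_forall]
    exact isClosed_iInter fun i => isClosed_eq (hf i) continuous_const
  obtain ⟨ε, hε, hεO⟩ := exists_pos_sublevel_subset hw hw0
    (O := ⋃ c ∈ {c | IsTripleChart A r₃ w e {q | ∀ i, f i q = 0} l c}, c.dom)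
    (isOpen_biUnion fun c _ => c.isOpen_dom) (fun q hq => by
      obtain ⟨c, hc, hqc⟩ := h1 q hq
      exact mem_biUnion hc hqc)
  -- The compatibility with `e` and `r₃` is demanded only on `w < ε / 2`. Points with `w < ε` have
  -- triple charts, which respect it; for the others the chart is shrunk into `ε / 2 < w`, where
  -- there is nothing to respect.
  obtain ⟨r, hr, hev⟩ := exists_retraction (N := {q | w q < ε / 2}) (ξ := fun q => (e q, r₃ q))
    hτ hττ hfree hZc hfτ (fun q hq => by rw [mem_ofPred_eq, hwτ]; exact hq)
    (fun q _ q' _ hqq => by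
      obtain ⟨h3, h4⟩ := Prod.ext_iff.1 hqq
      exact Prod.ext (heτ q q' h3) (by simp only [hr₃]; exact congrArg τ h4))
    (fun p hp => by
      by_cases hpw : w p < ε
      · obtain ⟨c, hc, hpc⟩ := mem_iUnion₂.1 (hεO p hpw)
        exact ⟨l, l + 2, c, IsTripleChart.isShrinkingChart hc _, hpc⟩
      · obtain ⟨c, hc, hcf, hpc⟩ := h2 p hp (by linarith)
        obtain ⟨δ, hδ, hd, -⟩ := c.exists_restr_subset hpc (U := {q | ε / 2 < w q})
          (hw.continuousAt.eventually (Ioi_mem_nhds (by linarith)))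
        refine ⟨0, 2, c.restr (Metric.ball (c.toFun p) δ) Metric.isOpen_ball,
          isShrinkingChart_of_hasBoundaryCoords hc.restr hcf.restr
          (disjoint_left.2 fun q hq hqN => ?_), hpc, Metric.mem_ball_self hδ⟩
        exact lt_asymm (show ε / 2 < w q from hd hq) hqN)
  refine ⟨r, hr.equivariant, fun c hc p hp hpw => ?_, fun c hc hcf p hp hpZ => ?_⟩
  · refine hc.exists_restr_adapted hr hp hpw (by linarith) hw (hev p ?_)
    have := hc.sum_sq p hp
    rw [hpw] at this
    rw [hc.mem_iff p hp]
    rintro ⟨i, hi⟩ - hi3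
    have hl := hc.le_one
    simp only at hi3
    have : i < 3 := by omega
    interval_cases i <;> nlinarith [sq_nonneg (c.toFun p ⟨0, by have := hc.lt; omega⟩),
      sq_nonneg (c.toFun p ⟨1, by have := hc.lt; omega⟩), sq_nonneg (c.toFun p ⟨2, hc.lt⟩)]
  · exact exists_adapted_of_isStratumMap hc hcf hr hp hpZ (hev p hpZ)

end StraightenAll

/-! ### Straightening all corners of a space with a free involution -/

section StraightenAll

variable {m : ℕ} {Y : Type*} [TopologicalSpace Y]

/-- The boundary charts of a space with an involution whose corners are given by the vanishing of
the functions `a`, `b` (which the involution interchanges) and `h`. -/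
structure HasCornerCharts (A : CornerAtlas Y m) (h a b : Y → ℝ) : Prop where
  smooth : ∀ p, ¬(a p = 0 ∧ b p = 0) → ¬(h p = 0 ∧ dblSin (a p) (b p) = 0) →
    ∃ c : CornerChart Y m, A.IsSmooth c ∧ c.k = 1 ∧ p ∈ c.dom
  corner_ab : ∀ p, a p = 0 → b p = 0 → h p ≠ 0 →
    ∃ c : CornerChart Y m, A.IsSmooth c ∧ c.HasBoundaryCoords ![a, b] ∧ p ∈ c.dom
  corner_h : ∀ p, h p = 0 → dblSin (a p) (b p) = 0 → ¬(a p = 0 ∧ b p = 0) →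
    ∃ c : CornerChart Y m, A.IsSmooth c ∧
      c.HasBoundaryCoords ![h, fun q => dblSin (a q) (b q)] ∧ p ∈ c.dom
  corner_hab : ∀ p, h p = 0 → a p = 0 → b p = 0 →
    ∃ c : CornerChart Y m, A.IsSmooth c ∧ c.HasBoundaryCoords ![h, a, b] ∧ p ∈ c.dom

theorem exists_smooth_restr {A : CornerAtlas Y m} {c : CornerChart Y m} (hc : A.IsSmooth c) {p : Y}
    (hp : p ∈ c.dom) {U : Set Y} (hU : U ∈ 𝓝 p) : ∃ ε > 0,
      A.IsSmooth (c.restr (Metric.ball (c.toFun p) ε) Metric.isOpen_ball) ∧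
      p ∈ (c.restr (Metric.ball (c.toFun p) ε) Metric.isOpen_ball).dom ∧
      (c.restr (Metric.ball (c.toFun p) ε) Metric.isOpen_ball).dom ⊆ U := by
  obtain ⟨ε, hε, hd, -⟩ := c.exists_restr_subset hp hU
  exact ⟨ε, hε, hc.restr, ⟨hp, Metric.mem_ball_self hε⟩, hd⟩

/-- All angles of a compact space with corners and with a free involution can be straightened in
such a way that the involution remains smooth. -/
theorem exists_straightened_atlas_of_hasCornerCharts [T2Space Y] [CompactSpace Y]
    {A : CornerAtlas Y m} {τ : Y → Y}
    (hτ : ∀ q, A.SmoothMapAt A τ q) (hττ : ∀ q, τ (τ q) = q) (hfree : ∀ q, τ q ≠ q)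
    {h a b : Y → ℝ} (hh : Continuous h) (ha : Continuous a) (hb : Continuous b)
    (hhτ : ∀ q, h (τ q) = h q) (haτ : ∀ q, a (τ q) = b q) (hbτ : ∀ q, b (τ q) = a q)
    (hA : HasCornerCharts A h a b) :
    ∃ A' : CornerAtlas Y m, (∀ q, A'.SmoothMapAt A' τ q) ∧
      ∀ p, ∃ c d : CornerChart Y m, A.IsSmooth c ∧ A'.IsSmooth d ∧ p ∈ c.dom ∧ d.dom = c.dom ∧
        d.k = 1 ∧ ∀ q ∈ c.dom, d.toFun q = straighten c.k (c.toFun q) := by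
  set u : Y → ℝ := fun q => dblSin (a q) (b q) with hu
  set v : Y → ℝ := fun q => dblCos (a q) (b q) with hv
  have huc : Continuous u := continuous_dblSin.comp (ha.prodMk hb)
  have hvc : Continuous v := continuous_dblCos.comp (ha.prodMk hb)
  -- Interchanging `a` and `b` replaces `2θ` by `π - 2θ`: the sine is fixed, the cosine changes
  -- sign.
  have huτ : ∀ q, u (τ q) = u q := fun q => by simp only [hu, haτ, hbτ]; exact dblSin_comm _ _
  have hvτ : ∀ q, v (τ q) = -v q := fun q => by simp only [hv, haτ, hbτ]; exact dblCos_comm _ _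
  set w : Y → ℝ := fun q => h q ^ 2 + a q ^ 2 + b q ^ 2 with hw
  have hwc : Continuous w := by fun_prop
  have hw0 : ∀ q, 0 ≤ w q := fun q => by positivity
  have hwτ : ∀ q, w (τ q) = w q := fun q => by simp only [hw, hhτ, haτ, hbτ]; ring
  have hwz : ∀ q, w q = 0 ↔ h q = 0 ∧ a q = 0 ∧ b q = 0 := fun q => by
    refine ⟨fun h1 => ?_, fun h1 => by simp [hw, h1]⟩
    simp only [hw] at h1
    refine ⟨?_, ?_, ?_⟩ <;> nlinarith [sq_nonneg (h q), sq_nonneg (a q), sq_nonneg (b q)]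
  have hABc : IsClosed {q | a q = 0 ∧ b q = 0} :=
    (isClosed_eq ha continuous_const).inter (isClosed_eq hb continuous_const)
  have hQc : IsClosed {q | h q = 0 ∧ u q = 0} :=
    (isClosed_eq hh continuous_const).inter (isClosed_eq huc continuous_const)
  -- the stratum of codimension three
  obtain ⟨r₃, hr₃, hr₃e⟩ := exists_retraction (A := A) (τ := τ) hτ hττ hfree
    (Z := {q | ∀ i, (![h, a, b] : Fin 3 → Y → ℝ) i q = 0}) (N := ∅) (ξ := fun _ => ())
    (by
      simp only [ofPred_forall]
      refine isClosed_iInter fun i => isClosed_eq ?_ continuous_const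
      fin_cases i <;> assumption)
    (fun q hq => by
      simp only [mem_ofPred_eq, Fin.forall_fin_succ] at hq ⊢
      simp_all)
    (fun q hq => hq.elim) (fun _ _ _ _ _ => rfl)
    (fun p hp => by
      obtain ⟨c, hc, hcf, hpc⟩ := hA.corner_hab p (hp 0) (hp 1) (hp 2)
      exact ⟨0, 3, c, isShrinkingChart_of_hasBoundaryCoords hc hcf (disjoint_empty _), hpc⟩)
  have hK : ∀ p, w p = 0 → ∃ c : CornerChart Y m, A.IsSmooth c ∧ c.HasBoundaryCoords ![h, a, b] ∧
      c.IsAdapted r₃ 0 3 ∧ p ∈ c.dom := by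
    intro p hp
    obtain ⟨h1, h2, h3⟩ := (hwz p).1 hp
    have hz : ∀ i, (![h, a, b] : Fin 3 → Y → ℝ) i p = 0 := by
      simp [Fin.forall_fin_succ, h1, h2, h3]
    obtain ⟨c, hc, hcf, hpc⟩ := hA.corner_hab p h1 h2 h3
    obtain ⟨c', h4, h5, -, h6, h7⟩ :=
      exists_adapted_of_isStratumMap hc hcf hr₃ hpc hz (hr₃e p hz)
    exact ⟨c', h4, h6, h7, h5⟩
  -- the stratum `a = b = 0`
  have hTab : ∀ c : CornerChart Y m, A.IsSmooth c → c.HasBoundaryCoords ![h, a, b] →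
      c.IsAdapted r₃ 0 3 →
      IsTripleChart A r₃ w h {q | ∀ i, (![a, b] : Fin 2 → Y → ℝ) i q = 0} 1 c := by
    intro c hc hcf hcr
    have hm : 3 ≤ m := hcf.le
    have e0 : ∀ q ∈ c.dom, c.toFun q ⟨0, by omega⟩ = h q := fun q hq => hcf.eq q hq 0
    have e1 : ∀ q ∈ c.dom, c.toFun q ⟨1, by omega⟩ = a q := fun q hq => hcf.eq q hq 1
    have e2 : ∀ q ∈ c.dom, c.toFun q ⟨2, by omega⟩ = b q := fun q hq => hcf.eq q hq 2
    refine ⟨hc, hm, le_rfl, fun q hq => ?_, fun q hq i hi hi' => ?_, fun q hq => ?_, hcr⟩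
    · simp only [mem_ofPred_eq, Fin.forall_fin_two, Matrix.cons_val_zero, Matrix.cons_val_one]
      constructor
      · rintro ⟨h1, h2⟩ ⟨i, hi⟩ hi1 hi3
        obtain rfl | rfl : i = 1 ∨ i = 2 := by simp only at hi1 hi3; omega
        · rw [e1 q hq, h1]
        · rw [e2 q hq, h2]
      · intro h1
        exact ⟨by rw [← e1 q hq]; exact h1 _ le_rfl (by simp),
          by rw [← e2 q hq]; exact h1 _ (by simp) (by simp)⟩
    · rw [show i = ⟨0, by omega⟩ from Fin.ext (by simp only; omega)]
      exact e0 q hq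
    · rw [e0 q hq, e1 q hq, e2 q hq]
  obtain ⟨r, hrτ, hr1, hr2⟩ := exists_compatible_retraction (A := A) (τ := τ) hτ hττ hfree
    hr₃.equivariant hwc hw0 hwτ (e := h) (fun q q' hq => by rw [hhτ, hhτ, hq]) (f := ![a, b])
    (fun i => by fin_cases i <;> assumption)
    (fun q hq => by
      simp only [Fin.forall_fin_two, Matrix.cons_val_zero, Matrix.cons_val_one] at hq ⊢
      rw [haτ, hbτ]; exact hq.symm) (l := 1)
    (fun p hp => by
      obtain ⟨c, hc, hcf, hcr, hpc⟩ := hK p hp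
      exact ⟨c, hTab c hc hcf hcr, hpc⟩)
    (fun p hp hpw => by
      have h1 : a p = 0 := hp 0
      have h2 : b p = 0 := hp 1
      exact hA.corner_ab p h1 h2 fun h3 => hpw ((hwz p).2 ⟨h3, h1, h2⟩))
  -- At the deepest stratum the boundary coordinates are `h, a, b` in this order, so the pair to be
  -- straightened first sits at places 1 and 2. The chart has to stay adapted to `r₃`, which the
  -- second straightening needs.
  have hK' : ∀ p, w p = 0 → ∃ c, ∃ _ : IsStraightenable A r a b 1 c,
      c.HasBoundaryCoords ![h, a, b] ∧ c.IsAdapted r₃ 0 3 ∧ p ∈ c.dom := by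
    intro p hp
    obtain ⟨c, hc, hcf, hcr, hpc⟩ := hK p hp
    obtain ⟨δ, hδ, had⟩ := hr1 c (hTab c hc hcf hcr) p hpc hp
    refine ⟨_, ⟨hc.restr, hcf.restr.k_eq, hcf.le, fun q hq => hcf.eq q hq.1 1,
      fun q hq => hcf.eq q hq.1 2, had⟩, hcf.restr, ?_, hpc, Metric.mem_ball_self hδ⟩
    refine CornerChart.restr_isAdapted hcr ?_ δ
    obtain ⟨h1, h2, h3⟩ := (hwz p).1 hp
    intro i _ hi
    refine (hcf.zero_iff hpc).2 ?_ i hi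
    simp [Fin.forall_fin_succ, h1, h2, h3]
  have hab : ∀ p, a p = 0 → b p = 0 → h p ≠ 0 → ∃ c, ∃ _ : IsStraightenable A r a b 0 c,
      p ∈ c.dom ∧ ∀ q ∈ c.dom, h q ≠ 0 := by
    intro p h1 h2 h3
    obtain ⟨c, hc, hcf, hpc⟩ := hA.corner_ab p h1 h2 h3
    obtain ⟨δ, hδ, hcs, hpd, hd⟩ := exists_smooth_restr hc hpc (U := {q | h q ≠ 0})
      (hh.continuousAt.eventually_ne h3)
    obtain ⟨c', h4, h5, h6, h7, h8⟩ := hr2 _ hcs hcf.restr p hpd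
      (by simp [Fin.forall_fin_two, h1, h2])
    exact ⟨c', ⟨h4, h7.k_eq, h7.le, fun q hq => h7.eq q hq 0, fun q hq => h7.eq q hq 1, h8⟩, h5,
      fun q hq => hd (h6 hq)⟩
  obtain ⟨A₁, hA₁, hA₁s, hA₁g⟩ := exists_straightened_atlas A (r := r) ha hb (fun p h1 h2 => by
    by_cases h3 : h p = 0
    · obtain ⟨c, hc, -, -, hpc⟩ := hK' p ((hwz p).2 ⟨h3, h1, h2⟩)
      exact ⟨1, c, hc, hpc⟩
    · obtain ⟨c, hc, hpc, -⟩ := hab p h1 h2 h3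
      exact ⟨0, c, hc, hpc⟩)
  -- The factor `-1` is the sign change of `v` under `τ`.
  have hτ₁ : ∀ q, A₁.SmoothMapAt A₁ τ q := hA₁g τ (-1) (by norm_num) hτ hrτ huτ
    fun q => by rw [neg_one_mul]; exact hvτ q
  -- the stratum `h = u = 0`
  have huv : ∀ q, w q = h q ^ 2 + u q ^ 2 + v q ^ 2 := fun q => by
    simp only [hw, hu, hv, add_assoc, dbl_sq_add_sq]
  -- After the first straightening the first three coordinates are `h, u, v`. Now `h, u` at places 0
  -- and 1 cut out the edge and `v`, no longer a boundary coordinate, plays the role of `e`; the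
  -- function `w` is the same sum of squares as before.
  have hThu : ∀ c, ∀ hc : IsStraightenable A r a b 1 c, c.HasBoundaryCoords ![h, a, b] →
      c.IsAdapted r₃ 0 3 →
      IsTripleChart A₁ r₃ w v {q | ∀ i, (![h, u] : Fin 2 → Y → ℝ) i q = 0} 0 hc.chart := by
    intro c hc hcf hcr
    have hm : 3 ≤ m := hcf.le
    have hd := hc.chart_dom
    have e0 : ∀ q ∈ hc.chart.dom, hc.chart.toFun q ⟨0, by omega⟩ = h q := fun q hq => by
      rw [hc.chart_toFun, straightenPair_of_ne hc.lt _ (by simp) (by simp)]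
      exact hcf.eq q (hd ▸ hq) 0
    have e1 : ∀ q ∈ hc.chart.dom, hc.chart.toFun q ⟨1, by omega⟩ = u q := fun q hq =>
      hc.chart_fst (hd ▸ hq)
    have e2 : ∀ q ∈ hc.chart.dom, hc.chart.toFun q ⟨2, by omega⟩ = v q := fun q hq =>
      hc.chart_snd (hd ▸ hq)
    refine ⟨hA₁s 1 c hc, hm, zero_le_one, fun q hq => ?_, fun q hq i hi hi' => ?_,
      fun q hq => ?_, fun t ht => ?_⟩
    · simp only [mem_ofPred_eq, Fin.forall_fin_two, Matrix.cons_val_zero, Matrix.cons_val_one]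
      constructor
      · rintro ⟨h1, h2⟩ ⟨i, hi⟩ hi1 hi3
        obtain rfl | rfl : i = 0 ∨ i = 1 := by simp only at hi1 hi3; omega
        · rw [e0 q hq, h1]
        · rw [e1 q hq, h2]
      · intro h1
        exact ⟨by rw [← e0 q hq]; exact h1 _ (by simp) (by simp),
          by rw [← e1 q hq]; exact h1 _ (by simp) (by simp)⟩
    · rw [show i = ⟨2, by omega⟩ from Fin.ext (by simp only; omega)]
      exact e2 q hq
    · rw [e0 q hq, e1 q hq, e2 q hq, huv]
    · obtain ⟨h1, h2⟩ := hcr _ (CornerChart.straight_tgt ht)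
      rw [scaleOn_foldPair hc.lt zero_le_one le_rfl] at h1 h2
      -- Folding fixes points whose first three coordinates vanish, so being adapted to `r₃`
      -- survives the first straightening.
      have h3 : foldPair 1 (scaleOn 0 3 0 t) = scaleOn 0 3 0 t := by
        ext i
        rw [foldPair_apply hc.lt]
        have h4 : ∀ j : Fin m, (j : ℕ) < 3 → scaleOn 0 3 0 t j = 0 := fun j hj => by
          rw [scaleOn_apply_of_mem _ _ (Nat.zero_le _) hj, zero_mul]
        rw [h4 ⟨1, _⟩ (by simp), h4 ⟨1 + 1, _⟩ (by simp)]
        split_ifs with h5 h6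
        · rw [h4 i (by omega)]; simp [halfCos]
        · rw [h4 i (by omega)]; simp [halfSin]
        · rfl
      refine ⟨⟨?_, scaleOn_mem_cornerSector le_rfl ht.2⟩, ?_⟩
      · change foldPair 1 _ ∈ c.cod
        rw [h3]; exact h1.1
      · change r₃ (c.inv (foldPair 1 t)) = c.inv (foldPair 1 _)
        rw [h2, h3]
  -- Away from `a = b = 0` the first straightening has not changed the charts, so the original
  -- corner charts of the edge `h = u = 0` can be used.
  have hgen : ∀ p, h p = 0 → u p = 0 → ¬(a p = 0 ∧ b p = 0) → ∃ c : CornerChart Y m,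
      A₁.IsSmooth c ∧ c.HasBoundaryCoords ![h, u] ∧ p ∈ c.dom ∧
        ∀ q ∈ c.dom, ¬(a q = 0 ∧ b q = 0) := by
    intro p h1 h2 h3
    obtain ⟨c, hc, hcf, hpc⟩ := hA.corner_h p h1 h2 h3
    obtain ⟨δ, hδ, hcs, hpd, hd⟩ := exists_smooth_restr hc hpc (hABc.isOpen_compl.mem_nhds h3)
    exact ⟨_, (hA₁ _ hd).1 hcs, hcf.restr, hpd, hd⟩
  obtain ⟨r', hr'τ, hr'1, hr'2⟩ := exists_compatible_retraction (A := A₁) (τ := τ) hτ₁ hττ hfree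
    hr₃.equivariant hwc hw0 hwτ (e := v) (fun q q' hq => by rw [hvτ, hvτ, hq]) (f := ![h, u])
    (fun i => by fin_cases i <;> assumption)
    (fun q hq => by
      simp only [Fin.forall_fin_two, Matrix.cons_val_zero, Matrix.cons_val_one] at hq ⊢
      rw [hhτ, huτ]; exact hq) (l := 0)
    (fun p hp => by
      obtain ⟨c, hc, hcf, hcr, hpc⟩ := hK' p hp
      exact ⟨hc.chart, hThu c hc hcf hcr, by rwa [hc.chart_dom]⟩)
    (fun p hp hpw => by
      have h1 : h p = 0 := hp 0
      have h2 : u p = 0 := hp 1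
      obtain ⟨c, hc, hcf, hpc, -⟩ := hgen p h1 h2 fun h3 => hpw ((hwz p).2 ⟨h1, h3⟩)
      exact ⟨c, hc, hcf, hpc⟩)
  have hK'' : ∀ p, w p = 0 → ∃ c, ∃ hc : IsStraightenable A r a b 1 c, ∃ δ > 0, p ∈ c.dom ∧
      IsStraightenable A₁ r' h u 0
        (hc.chart.restr (Metric.ball (hc.chart.toFun p) δ) Metric.isOpen_ball) := by
    intro p hp
    obtain ⟨c, hc, hcf, hcr, hpc⟩ := hK' p hp
    have hT := hThu c hc hcf hcr
    have hm : 3 ≤ m := hT.lt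
    obtain ⟨δ, hδ, had⟩ := hr'1 _ hT p (by rwa [hc.chart_dom]) hp
    refine ⟨c, hc, δ, hδ, hpc, hT.isSmooth.restr, rfl, by omega, fun q hq => ?_, fun q hq => ?_, had⟩
    · have hq' : q ∈ c.dom := hc.chart_dom ▸ hq.1
      change hc.chart.toFun q ⟨0, _⟩ = h q
      rw [hc.chart_toFun, straightenPair_of_ne hc.lt _ (by simp) (by simp)]
      exact hcf.eq q hq' 0
    · exact hc.chart_fst (hc.chart_dom ▸ hq.1)
  have hgen' : ∀ p, h p = 0 → u p = 0 → ¬(a p = 0 ∧ b p = 0) → ∃ c,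
      ∃ _ : IsStraightenable A₁ r' h u 0 c, p ∈ c.dom ∧ ∀ q ∈ c.dom, ¬(a q = 0 ∧ b q = 0) := by
    intro p h1 h2 h3
    obtain ⟨c, hc, hcf, hpc, hd⟩ := hgen p h1 h2 h3
    obtain ⟨c', h4, h5, h6, h7, h8⟩ := hr'2 _ hc hcf p hpc (by simp [Fin.forall_fin_two, h1, h2])
    exact ⟨c', ⟨h4, h7.k_eq, h7.le, fun q hq => h7.eq q hq 0, fun q hq => h7.eq q hq 1, h8⟩, h5,
      fun q hq => hd q (h6 hq)⟩
  obtain ⟨A₂, hA₂, hA₂s, hA₂g⟩ := exists_straightened_atlas A₁ (r := r') hh huc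
    (fun p h1 h2 => by
      by_cases h3 : a p = 0 ∧ b p = 0
      · obtain ⟨c, hc, δ, hδ, hpc, hs⟩ := hK'' p ((hwz p).2 ⟨h1, h3⟩)
        exact ⟨0, _, hs, hc.chart_dom.symm ▸ hpc, Metric.mem_ball_self hδ⟩
      · obtain ⟨c, hc, hpc, -⟩ := hgen' p h1 h2 h3
        exact ⟨0, c, hc, hpc⟩)
  refine ⟨A₂, hA₂g τ 1 one_ne_zero hτ₁ hr'τ (fun q => by rw [hhτ, huτ])
    (fun q => by rw [hhτ, huτ, one_mul]), fun p => ?_⟩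
  by_cases h1 : a p = 0 ∧ b p = 0
  · by_cases h2 : h p = 0
    · obtain ⟨c, hc, δ, hδ, hpc, hs⟩ := hK'' p ((hwz p).2 ⟨h2, h1⟩)
      -- The second straightening was done on a ball in straightened coordinates, so the original
      -- chart has to be cut down to the preimage of that ball.
      refine ⟨c.restr (straightenPair 1 ⁻¹' Metric.ball (hc.chart.toFun p) δ)
        (Metric.isOpen_ball.preimage (continuous_straightenPair hc.lt)), hs.chart,
        hc.isSmooth.restr, hA₂s 0 _ hs, ⟨hpc, Metric.mem_ball_self hδ⟩, ?_, rfl, fun q hq => ?_⟩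
      · rw [hs.chart_dom]
        ext q
        change q ∈ hc.chart.dom ∧ _ ↔ q ∈ c.dom ∧ _
        rw [hc.chart_dom]; rfl
      · change _ = straighten c.k (c.toFun q)
        rw [hc.k_eq]
        rfl
    · obtain ⟨c, hc, hpc, hch⟩ := hab p h1.1 h1.2 h2
      -- This chart avoids `h = 0`, hence the second edge, so one straightening is enough.
      refine ⟨c, hc.chart, hc.isSmooth, (hA₂ _ fun q hq hq' => ?_).1 (hA₁s 0 c hc), hpc,
        hc.chart_dom, rfl, fun q hq => ?_⟩
      · exact hch q (hc.chart_dom ▸ hq) hq'.1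
      · rw [hc.k_eq]; rfl
  · by_cases h2 : h p = 0 ∧ u p = 0
    · obtain ⟨c, hc, hpc, hcab⟩ := hgen' p h2.1 h2.2 h1
      refine ⟨c, hc.chart, (hA₁ c hcab).2 hc.isSmooth, hA₂s 0 c hc, hpc, hc.chart_dom, rfl,
        fun q hq => ?_⟩
      rw [hc.k_eq]; rfl
    · obtain ⟨c, hc, hck, hpc⟩ := hA.smooth p h1 h2
      obtain ⟨δ, hδ, hcs, hpd, hd⟩ := exists_smooth_restr hc hpc
        (Filter.inter_mem (hABc.isOpen_compl.mem_nhds h1) (hQc.isOpen_compl.mem_nhds h2))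
      refine ⟨_, _, hcs, (hA₂ _ fun q hq => (hd hq).2).1 ((hA₁ _ fun q hq => (hd hq).1).1 hcs),
        hpd, rfl, hck, fun q _ => ?_⟩
      change c.toFun q = straighten c.k (c.toFun q)
      rw [hck]; rfl

end StraightenAll

/-! ### Manifolds with boundary from atlases of corner charts -/

/-- For `m = 0` both sides are everything, since there is no coordinate to constrain. -/
theorem range_halfModel (m : ℕ) : range (halfModel m) = cornerSector m 1 := by
  cases m with
  | zero =>
    refine (range_id (α := EuclideanSpace ℝ (Fin 0))).trans (eq_univ_of_forall fun x i => i.elim0).symm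
  | succ m =>
    refine (range_modelWithCornersEuclideanHalfSpace (m + 1)).trans ?_
    ext x
    constructor
    · intro h i hi
      obtain rfl : i = 0 := Fin.ext (by simpa using hi)
      exact h
    · intro h
      exact h 0 (by simp)

section Manifolds

variable {m : ℕ} {Y : Type*} [TopologicalSpace Y]

theorem halfModel_right_inv {x : EuclideanSpace ℝ (Fin m)} (hx : x ∈ cornerSector m 1) :
    halfModel m ((halfModel m).symm x) = x :=
  (halfModel m).right_inv (by rwa [range_halfModel])

theorem halfModel_mem (z : HalfSpace m) : halfModel m z ∈ cornerSector m 1 := by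
  rw [← range_halfModel]; exact mem_range_self z

/-- The chart with values in the half-space which belongs to a corner chart. -/
def CornerChart.toHomeo (c : CornerChart Y m) (hk : c.k = 1) :
    OpenPartialHomeomorph Y (HalfSpace m) where
  toFun y := (halfModel m).symm (c.toFun y)
  invFun z := c.inv (halfModel m z)
  source := c.dom
  target := halfModel m ⁻¹' c.cod
  map_source' q hq := by
    have h := c.map_mem q hq
    rw [hk] at h
    rw [mem_preimage, halfModel_right_inv h.2]
    exact h.1
  map_target' z hz := c.inv_mem _ ⟨hz, hk ▸ halfModel_mem z⟩
  left_inv' q hq := by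
    have h := c.map_mem q hq
    rw [hk] at h
    rw [halfModel_right_inv h.2, c.left_inv q hq]
  right_inv' z hz := by
    rw [c.right_inv _ ⟨hz, hk ▸ halfModel_mem z⟩, (halfModel m).left_inv]
  open_source := c.isOpen_dom
  open_target := c.isOpen_cod.preimage (halfModel m).continuous
  continuousOn_toFun := (halfModel m).continuous_symm.comp_continuousOn c.continuousOn_toFun
  continuousOn_invFun := c.continuousOn_inv.comp (halfModel m).continuous.continuousOn
    fun z hz => ⟨hz, hk ▸ halfModel_mem z⟩

theorem CornerChart.halfModel_toHomeo {c : CornerChart Y m} (hk : c.k = 1) {q : Y}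
    (hq : q ∈ c.dom) : halfModel m (c.toHomeo hk q) = c.toFun q :=
  halfModel_right_inv (hk ▸ (c.map_mem q hq).2)

namespace CornerAtlas

variable (A : CornerAtlas Y m)

/-- The charted space whose charts are the smooth corner charts without corners. -/
@[reducible] def chartedSpace (hA : ∀ p, ∃ c, A.IsSmooth c ∧ c.k = 1 ∧ p ∈ c.dom) :
    ChartedSpace (HalfSpace m) Y where
  atlas := {φ | ∃ c, ∃ hk : c.k = 1, A.IsSmooth c ∧ φ = c.toHomeo hk}
  chartAt p := (hA p).choose.toHomeo (hA p).choose_spec.2.1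
  mem_chart_source p := (hA p).choose_spec.2.2
  chart_mem_atlas p := ⟨(hA p).choose, (hA p).choose_spec.2.1, (hA p).choose_spec.1, rfl⟩

variable {A}

theorem isManifold (hA : ∀ p, ∃ c, A.IsSmooth c ∧ c.k = 1 ∧ p ∈ c.dom) :
    @IsManifold ℝ _ _ _ _ _ _ (halfModel m) ∞ Y _ (A.chartedSpace hA) := by
  let _ := A.chartedSpace hA
  refine isManifold_of_contDiffOn (halfModel m) ∞ Y ?_
  intro e e' he he'
  obtain ⟨c, hk, hc, rfl⟩ : ∃ c : CornerChart Y m, ∃ hk : c.k = 1, A.IsSmooth c ∧ e = c.toHomeo hk := he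
  obtain ⟨d, hk', hd, rfl⟩ : ∃ c : CornerChart Y m, ∃ hk : c.k = 1, A.IsSmooth c ∧ e' = c.toHomeo hk := he'
  rintro t ⟨ht, htr⟩
  rw [range_halfModel] at htr
  have key : ∀ t, t ∈ cornerSector m 1 →
      (halfModel m).symm t ∈ ((c.toHomeo hk).symm ≫ₕ d.toHomeo hk').source →
      t ∈ c.tgt ∧ c.inv t ∈ d.dom := by
    intro t ht h
    have h1 : halfModel m ((halfModel m).symm t) ∈ c.cod := h.1
    have h2 : c.inv (halfModel m ((halfModel m).symm t)) ∈ d.dom := h.2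
    rw [halfModel_right_inv ht] at h1 h2
    exact ⟨⟨h1, hk ▸ ht⟩, h2⟩
  obtain ⟨h1, h2⟩ := key t htr ht
  have h3 := hc.smoothVia hd (c.inv_mem t h1) h2
  have h4 : ContDiffWithinAt ℝ ∞ (fun t => d.toFun (c.inv t)) c.tgt (c.toFun (c.inv t)) := h3
  rw [c.right_inv t h1] at h4
  have h5 : ∀ s, s ∈ cornerSector m 1 →
      (halfModel m).symm s ∈ ((c.toHomeo hk).symm ≫ₕ d.toHomeo hk').source →
      (halfModel m ∘ ((c.toHomeo hk).symm ≫ₕ d.toHomeo hk') ∘ (halfModel m).symm) s =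
        d.toFun (c.inv s) := by
    intro s hs hs'
    obtain ⟨h6, h7⟩ := key s hs hs'
    change halfModel m (d.toHomeo hk' (c.inv (halfModel m ((halfModel m).symm s)))) = _
    rw [halfModel_right_inv hs, CornerChart.halfModel_toHomeo hk' h7]
  refine (h4.mono fun s hs => ?_).congr (fun s hs => ?_) (h5 t htr ht)
  · rw [range_halfModel] at hs; exact (key s hs.2 hs.1).1
  · rw [range_halfModel] at hs; exact h5 s hs.2 hs.1

theorem toHomeo_mem_maximalAtlas (hA : ∀ p, ∃ c, A.IsSmooth c ∧ c.k = 1 ∧ p ∈ c.dom)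
    {c : CornerChart Y m} (hc : A.IsSmooth c) (hk : c.k = 1) :
    c.toHomeo hk ∈ @IsManifold.maximalAtlas ℝ _ _ _ _ _ _ (halfModel m) ∞ Y _ (A.chartedSpace hA) := by
  let _ := A.chartedSpace hA
  have := isManifold hA
  have h : ∃ d : CornerChart Y m, ∃ hk' : d.k = 1, A.IsSmooth d ∧ c.toHomeo hk = d.toHomeo hk' := ⟨c, hk, hc, rfl⟩
  exact IsManifold.subset_maximalAtlas h

end CornerAtlas

/-! ### Quotients by free involutions -/

variable {s : Setoid Y} {τ : Y → Y}

/-- The saturation of an open set `U` is `U ∪ τ⁻¹ U`, which is open. -/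
theorem isOpenQuotientMap_mk (hτ : Continuous τ) (hs : ∀ p q, s p q ↔ p = q ∨ p = τ q) :
    IsOpenQuotientMap (Quotient.mk s) := by
  refine ⟨Quotient.mk_surjective, continuous_quotient_mk', fun U hU => ?_⟩
  refine isQuotientMap_quotient_mk'.isOpen_preimage.1 ?_
  have : (Quotient.mk s) ⁻¹' (Quotient.mk s '' U) = U ∪ τ ⁻¹' U := by
    ext q
    simp only [mem_preimage, mem_image, mem_union]
    constructor
    · rintro ⟨p, hp, hpq⟩
      rcases (hs p q).1 (Quotient.exact hpq) with rfl | rfl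
      · exact Or.inl hp
      · exact Or.inr hp
    · rintro (h | h)
      · exact ⟨q, h, rfl⟩
      · exact ⟨τ q, h, Quotient.sound ((hs _ _).2 (Or.inr rfl))⟩
  change IsOpen (Quotient.mk s ⁻¹' _)
  rw [this]
  exact hU.union (hU.preimage hτ)

/-- For an open quotient map this amounts to closedness of the relation, here the union of the
diagonal and the graph of `τ`. -/
theorem t2Space_quotient_of_involution [T2Space Y] (hτ : Continuous τ)
    (hs : ∀ p q, s p q ↔ p = q ∨ p = τ q) : T2Space (Quotient s) := by
  rw [t2Space_iff_of_isOpenQuotientMap (isOpenQuotientMap_mk hτ hs)]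
  have : {q : Y × Y | Quotient.mk s q.1 = Quotient.mk s q.2} =
      {q | q.1 = q.2} ∪ {q | q.1 = τ q.2} := by
    ext ⟨p, q⟩
    exact Quotient.eq.trans (hs p q)
  rw [this]
  exact (isClosed_eq continuous_fst continuous_snd).union
    (isClosed_eq continuous_fst (hτ.comp continuous_snd))

open Classical in
/-- A chart of the quotient, from a chart whose domain is disjoint from its image under the
involution. -/
def CornerChart.push (c : CornerChart Y m) (π : Y → Quotient s) (hπ : IsOpenQuotientMap π)
    (hinj : InjOn π c.dom) : CornerChart (Quotient s) m :=
  have hl : ∀ q ∈ c.dom, ∀ h : ∃ p ∈ c.dom, π p = π q, h.choose = q := fun _ hq h =>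
    hinj h.choose_spec.1 hq h.choose_spec.2
  -- The section matters only over the image of the domain; its value elsewhere is arbitrary.
  let sec : Quotient s → Y := fun x => if h : ∃ p ∈ c.dom, π p = x then h.choose else
    (hπ.surjective x).choose
  have hsec : ∀ q ∈ c.dom, sec (π q) = q := fun q hq => by
    have h : ∃ p ∈ c.dom, π p = π q := ⟨q, hq, rfl⟩
    simp only [sec, dif_pos h]
    exact hl q hq h
  { k := c.k
    dom := π '' c.dom
    cod := c.cod
    toFun := fun x => c.toFun (sec x)
    inv := fun t => π (c.inv t)
    isOpen_dom := hπ.isOpenMap _ c.isOpen_dom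
    isOpen_cod := c.isOpen_cod
    map_mem := by
      rintro _ ⟨q, hq, rfl⟩
      rw [hsec q hq]; exact c.map_mem q hq
    inv_mem := fun t ht => mem_image_of_mem _ (c.inv_mem t ht)
    left_inv := by
      rintro _ ⟨q, hq, rfl⟩
      rw [hsec q hq, c.left_inv q hq]
    right_inv := fun t ht => by rw [hsec _ (c.inv_mem t ht), c.right_inv t ht]
    continuousOn_toFun := by
      rintro _ ⟨q, hq, rfl⟩
      refine ContinuousAt.continuousWithinAt ?_
      rw [ContinuousAt, ← hπ.isOpenMap.map_nhds_eq hπ.continuous.continuousAt, Filter.tendsto_map'_iff,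
        hsec q hq]
      refine Filter.Tendsto.congr' ?_ (c.continuousAt_toFun hq)
      filter_upwards [c.isOpen_dom.mem_nhds hq] with y hy
      simp only [Function.comp, hsec y hy]
    continuousOn_inv := hπ.continuous.comp_continuousOn c.continuousOn_inv }

open Classical in
theorem CornerChart.push_toFun {c : CornerChart Y m} {π : Y → Quotient s}
    {hπ : IsOpenQuotientMap π} {hinj : InjOn π c.dom} {q : Y} (hq : q ∈ c.dom) :
    (c.push π hπ hinj).toFun (π q) = c.toFun q := by
  have h : ∃ p ∈ c.dom, π p = π q := ⟨q, hq, rfl⟩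
  change c.toFun (if h : ∃ p ∈ c.dom, π p = π q then h.choose else (hπ.surjective (π q)).choose) = _
  rw [dif_pos h, hinj h.choose_spec.1 hq h.choose_spec.2]

/-- Freeness gives charts on which the projection is injective. Two lifts of one point agree or
differ by `τ`, so a transition map of pushed charts is locally one of the original transition maps
or `τ` read in the original charts. -/
theorem exists_quotient_atlas [T2Space Y] {A : CornerAtlas Y m}
    (hA : ∀ p, ∃ c, A.IsSmooth c ∧ c.k = 1 ∧ p ∈ c.dom) (hτ : ∀ q, A.SmoothMapAt A τ q)
    (hfree : ∀ q, τ q ≠ q) (hs : ∀ p q, s p q ↔ p = q ∨ p = τ q)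
    (hπ : IsOpenQuotientMap (Quotient.mk s)) :
    ∃ A' : CornerAtlas (Quotient s) m, ∀ p, ∃ c, ∃ hinj : InjOn (Quotient.mk s) c.dom,
      A.IsSmooth c ∧ c.k = 1 ∧ p ∈ c.dom ∧ A'.IsSmooth (c.push _ hπ hinj) := by
  have hsmall : ∀ p, ∃ c, ∃ _ : InjOn (Quotient.mk s) c.dom,
      A.IsSmooth c ∧ c.k = 1 ∧ p ∈ c.dom := by
    intro p
    obtain ⟨c, hc, hk, hpc⟩ := hA p
    obtain ⟨U, V, hU, hV, hpU, hpV, hUV⟩ := t2_separation (hfree p)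
    obtain ⟨ε, hε, hcs, hpd, hd⟩ := exists_smooth_restr hc hpc (U := V ∩ τ ⁻¹' U)
      (Filter.inter_mem (hV.mem_nhds hpV) ((hτ p).1.preimage_mem_nhds (hU.mem_nhds hpU)))
    refine ⟨_, fun q hq q' hq' h => ?_, hcs, hk, hpd⟩
    rcases (hs q q').1 (Quotient.exact h) with h | h
    · exact h
    · exact (hUV.le_bot ⟨(hd hq').2, h ▸ (hd hq).1⟩).elim
  let A' : CornerAtlas (Quotient s) m :=
    { charts := {d | ∃ c, ∃ hinj : InjOn (Quotient.mk s) c.dom, A.IsSmooth c ∧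
        d = c.push _ hπ hinj}
      cover := fun x => by
        obtain ⟨p, rfl⟩ := hπ.surjective x
        obtain ⟨c, hinj, hc, -, hpc⟩ := hsmall p
        exact ⟨_, ⟨c, hinj, hc, rfl⟩, mem_image_of_mem _ hpc⟩
      compat := by
        rintro _ ⟨c, hinj, hc, rfl⟩ _ ⟨d, hinj', hd, rfl⟩ x ⟨q, hqc, rfl⟩ ⟨q', hqd, hqq⟩
        change ContDiffWithinAt ℝ ∞
          (fun t => (d.push _ hπ hinj').toFun (Quotient.mk s (c.inv t))) c.tgt _
        rw [CornerChart.push_toFun hqc]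
        rcases (hs q' q).1 (Quotient.exact hqq) with rfl | rfl
        · refine CornerChart.SmoothFn.congr
            (f' := fun y => (d.push _ hπ hinj').toFun (Quotient.mk s y)) hqc
            (hc.smoothVia hd hqc hqd) ?_
          filter_upwards [d.isOpen_dom.mem_nhds hqd] with y hy
          exact CornerChart.push_toFun hy
        · refine CornerChart.SmoothFn.congr
            (f' := fun y => (d.push _ hπ hinj').toFun (Quotient.mk s y)) hqc
            ((hτ q).2 c d hc hd hqc hqd) ?_
          filter_upwards [(hτ q).1.preimage_mem_nhds (d.isOpen_dom.mem_nhds hqd)] with y hy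
          rw [← CornerChart.push_toFun (hπ := hπ) (hinj := hinj') hy,
            show Quotient.mk s (τ y) = Quotient.mk s y from
              Quotient.sound ((hs _ _).2 (Or.inr rfl))] }
  refine ⟨A', fun p => ?_⟩
  obtain ⟨c, hinj, hc, hk, hpc⟩ := hsmall p
  exact ⟨c, hinj, hc, hk, hpc, CornerAtlas.isSmooth_of_mem ⟨c, hinj, hc, rfl⟩⟩

/-- Read in a small chart and in its push-forward, the projection is the identity, which makes it a
local diffeomorphism. -/
theorem exists_quotient_manifold [T2Space Y] {A : CornerAtlas Y m}
    (hA : ∀ p, ∃ c, A.IsSmooth c ∧ c.k = 1 ∧ p ∈ c.dom) (hτ : ∀ q, A.SmoothMapAt A τ q)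
    (hfree : ∀ q, τ q ≠ q) (hs : ∀ p q, s p q ↔ p = q ∨ p = τ q) :
    T2Space (Quotient s) ∧ ∃ _ : ChartedSpace (HalfSpace m) (Quotient s),
      IsManifold (halfModel m) ∞ (Quotient s) ∧
      @IsLocalDiffeomorph ℝ _ _ _ _ _ _ _ _ _ _ _ (halfModel m) (halfModel m) Y _
        (A.chartedSpace hA) (Quotient s) _ _ ∞ (Quotient.mk s) := by
  have hτc : Continuous τ := continuous_iff_continuousAt.2 fun q => (hτ q).1
  have hπ := isOpenQuotientMap_mk hτc hs
  refine ⟨t2Space_quotient_of_involution hτc hs, ?_⟩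
  obtain ⟨A', hA'⟩ := exists_quotient_atlas hA hτ hfree hs hπ
  have hcov : ∀ x, ∃ c, A'.IsSmooth c ∧ c.k = 1 ∧ x ∈ c.dom := fun x => by
    obtain ⟨p, rfl⟩ := hπ.surjective x
    obtain ⟨c, hinj, hc, hk, hpc, hc'⟩ := hA' p
    exact ⟨_, hc', hk, mem_image_of_mem _ hpc⟩
  let _ := A.chartedSpace hA
  let _ := A'.chartedSpace hcov
  have := CornerAtlas.isManifold hA
  have := CornerAtlas.isManifold hcov
  refine ⟨A'.chartedSpace hcov, CornerAtlas.isManifold hcov, fun p => ?_⟩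
  obtain ⟨c, hinj, hc, hk, hpc, hc'⟩ := hA' p
  set d := c.push _ hπ hinj with hd
  have hdk : d.k = 1 := hk
  have h1 := CornerAtlas.toHomeo_mem_maximalAtlas hA hc hk
  have h2 := CornerAtlas.toHomeo_mem_maximalAtlas hcov hc' hdk
  have hEq : ∀ q ∈ c.dom, Quotient.mk s q = (c.toHomeo hk ≫ₕ (d.toHomeo hdk).symm) q := by
    intro q hq
    change _ = Quotient.mk s (c.inv (halfModel m ((halfModel m).symm (c.toFun q))))
    rw [halfModel_right_inv (hk ▸ (c.map_mem q hq).2), c.left_inv q hq]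
  have hsrc : ∀ q ∈ c.dom, q ∈ (c.toHomeo hk ≫ₕ (d.toHomeo hdk).symm).source := fun q hq =>
    ⟨hq, (c.toHomeo hk).map_source hq⟩
  refine ⟨{ toPartialEquiv := (c.toHomeo hk ≫ₕ (d.toHomeo hdk).symm).toPartialEquiv
            open_source := (c.toHomeo hk ≫ₕ (d.toHomeo hdk).symm).open_source
            open_target := (c.toHomeo hk ≫ₕ (d.toHomeo hdk).symm).open_target
            contMDiffOn_toFun := ?_
            contMDiffOn_invFun := ?_ }, hsrc p hpc, fun q hq => hEq q hq.1⟩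
  · exact (contMDiffOn_symm_of_mem_maximalAtlas h2).comp
      ((contMDiffOn_of_mem_maximalAtlas h1).mono inter_subset_left) fun q hq => hq.2
  · exact (contMDiffOn_symm_of_mem_maximalAtlas h1).comp
      ((contMDiffOn_of_mem_maximalAtlas h2).mono inter_subset_left) fun q hq => hq.2

end Manifolds

/-! ### Linear coordinates extending given functionals -/

theorem exists_linearIndependent_extension_fin {W : Type*} [AddCommGroup W] [Module ℝ W]
    [FiniteDimensional ℝ W] {k : ℕ} {L : Fin k → W} (hL : LinearIndependent ℝ L) (d : ℕ)
    (h : k + d ≤ Module.finrank ℝ W) : ∃ L' : Fin (k + d) → W, LinearIndependent ℝ L' ∧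
      ∀ i (hi : i < k), L' ⟨i, by omega⟩ = L ⟨i, hi⟩ := by
  induction d with
  | zero => exact ⟨L, hL, fun i hi => rfl⟩
  | succ d ih =>
    obtain ⟨L', h1, h2⟩ := ih (by omega)
    obtain ⟨x, hx⟩ := exists_linearIndependent_snoc_of_lt_finrank h1
      (show k + d < Module.finrank ℝ W by omega)
    refine ⟨Fin.snoc L' x, hx, fun i hi => ?_⟩
    rw [← h2 i hi]
    exact Fin.snoc_castSucc (α := fun _ => W) x L' ⟨i, by omega⟩

/-- The given functionals are completed to a basis of the dual space; its members are the
coordinates. -/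
theorem exists_coordinates {V : Type*} [NormedAddCommGroup V] [NormedSpace ℝ V]
    [FiniteDimensional ℝ V] {k m : ℕ} (hm : Module.finrank ℝ V = m) {L : Fin k → V →L[ℝ] ℝ}
    (hL : LinearIndependent ℝ L) : ∃ Θ : V ≃L[ℝ] EuclideanSpace ℝ (Fin m), k ≤ m ∧
      ∀ v (i : Fin m) (hi : (i : ℕ) < k), Θ v i = L ⟨i, hi⟩ v := by
  let L₀ : Fin k → Module.Dual ℝ V := fun i => (L i : V →ₗ[ℝ] ℝ)
  have hL₀ : LinearIndependent ℝ L₀ :=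
    hL.map' (ContinuousLinearMap.coeLM ℝ) (LinearMap.ker_eq_bot.2 ContinuousLinearMap.coe_injective)
  have hd : Module.finrank ℝ (Module.Dual ℝ V) = m := by rw [Subspace.dual_finrank_eq, hm]
  have hk : k ≤ m := by
    have := hL₀.fintype_card_le_finrank
    rwa [Fintype.card_fin, hd] at this
  obtain ⟨d, rfl⟩ := Nat.exists_eq_add_of_le hk
  obtain ⟨L', h1, h2⟩ := exists_linearIndependent_extension_fin hL₀ d hd.ge
  let f : V →ₗ[ℝ] EuclideanSpace ℝ (Fin (k + d)) :=
    (WithLp.linearEquiv 2 ℝ (Fin (k + d) → ℝ)).symm.toLinearMap ∘ₗ LinearMap.pi L'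
  have hf : ∀ v i, f v i = L' i v := fun v i => rfl
  have hinj : Function.Injective f := by
    rw [← LinearMap.ker_eq_bot, LinearMap.ker_eq_bot']
    intro v hv
    have hspan : Submodule.span ℝ (range L') = ⊤ :=
      h1.span_eq_top_of_card_eq_finrank' (by rw [Fintype.card_fin, hd])
    have hv' : ∀ φ : Module.Dual ℝ V, φ v = 0 := by
      intro φ
      have : φ ∈ Submodule.span ℝ (range L') := hspan ▸ Submodule.mem_top
      induction this using Submodule.span_induction with
      | mem x hx =>
        obtain ⟨i, rfl⟩ := hx
        rw [← hf, hv]; rfl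
      | zero => rfl
      | add x y _ _ hx hy => rw [LinearMap.add_apply, hx, hy, add_zero]
      | smul a x _ hx => rw [LinearMap.smul_apply, hx, smul_zero]
    exact (Module.forall_dual_apply_eq_zero_iff ℝ v).1 hv'
  refine ⟨(LinearEquiv.ofInjectiveOfFinrankEq f hinj (by simp [hm])).toContinuousLinearEquiv, hk,
    fun v i hi => ?_⟩
  change f v i = _
  rw [hf]
  exact congrArg (fun φ : Module.Dual ℝ V => φ v) (h2 i hi)

/-! ### The boundary in charts -/

/-- The first coordinate of a point (zero, if there are no coordinates). -/
def firstCoord : (n : ℕ) → EuclideanSpace ℝ (Fin n) →L[ℝ] ℝ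
  | 0 => 0
  | _ + 1 => EuclideanSpace.proj 0

/-- The first basis vector. -/
def firstVec : (n : ℕ) → EuclideanSpace ℝ (Fin n)
  | 0 => 0
  | _ + 1 => EuclideanSpace.single 0 1

theorem firstCoord_firstVec {n : ℕ} (hn : n ≠ 0) : firstCoord n (firstVec n) = 1 := by
  cases n with
  | zero => exact absurd rfl hn
  | succ n => simp [firstCoord, firstVec]

theorem range_halfModel_eq (n : ℕ) : range (halfModel n) = {t | 0 ≤ firstCoord n t} := by
  rw [range_halfModel]
  cases n with
  | zero =>
    ext x
    simp [cornerSector, firstCoord]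
  | succ n =>
    ext x
    constructor
    · intro h
      exact h 0 (by simp)
    · intro h i hi
      obtain rfl : i = 0 := Fin.ext (by simpa using hi)
      exact h

theorem mem_interior_range_halfModel {n : ℕ} {t : EuclideanSpace ℝ (Fin n)}
    (ht : t ∈ range (halfModel n)) :
    t ∈ interior (range (halfModel n)) ↔ ¬(n ≠ 0 ∧ firstCoord n t = 0) := by
  cases n with
  | zero =>
    have : range (halfModel 0) = univ := by
      rw [range_halfModel_eq]; simp [firstCoord]
    simp [this]
  | succ n =>
    have : interior (range (halfModel (n + 1))) = {t | 0 < t 0} :=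
      interior_range_modelWithCornersEuclideanHalfSpace (n + 1)
    rw [this]
    rw [range_halfModel_eq] at ht
    have ht' : 0 ≤ t 0 := ht
    change 0 < t 0 ↔ ¬(n + 1 ≠ 0 ∧ t 0 = 0)
    constructor
    · rintro h ⟨-, h'⟩; linarith
    · intro h
      exact lt_of_le_of_ne ht' fun h' => h ⟨by simp, h'.symm⟩

/-- Whether a point is interior may be tested in any chart of the atlas, not only in the preferred
chart at this point. The condition `n ≠ 0` is there because `firstCoord 0` vanishes identically,
although a 0-manifold has no boundary. -/
theorem mem_bdry_iff {n : ℕ} {M : CompactManifold n} {z x : M}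
    (hx : x ∈ (extChartAt (halfModel n) z).source) :
    x ∈ M.bdry ↔ n ≠ 0 ∧ firstCoord n (extChartAt (halfModel n) z x) = 0 := by
  have hx' : x ∈ (chartAt (HalfSpace n) z).source := by rwa [extChartAt_source] at hx
  have h1 : x ∈ M.bdry ↔ ¬ (halfModel n).IsInteriorPoint x :=
    (halfModel n).isBoundaryPoint_iff_not_isInteriorPoint x
  have h2 := (halfModel n).isInteriorPoint_iff_of_mem_atlas (n := ∞) (by simp)
    (chart_mem_atlas (HalfSpace n) z) hx'
  have hr : extChartAt (halfModel n) z x ∈ range (halfModel n) :=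
    extChartAt_target_subset_range z ((extChartAt (halfModel n) z).map_source hx)
  have h3 : extChartAt (halfModel n) z x ∈ interior (extChartAt (halfModel n) z).target ↔
      extChartAt (halfModel n) z x ∈ interior (range (halfModel n)) := by
    constructor
    · intro h
      exact interior_mono (extChartAt_target_subset_range z) h
    · intro h
      rw [mem_interior_iff_mem_nhds] at h ⊢
      rw [← nhdsWithin_eq_nhds.2 h]
      exact extChartAt_target_mem_nhdsWithin' hx
  rw [h1, h2]
  change ¬ extChartAt (halfModel n) z x ∈ interior (extChartAt (halfModel n) z).target ↔ _
  rw [h3, mem_interior_range_halfModel hr, not_not]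

/-! ### Corner charts of subsets of a product -/

section ProductCharts

variable {n : ℕ} {M : CompactManifold n} {C : Set (M × M)}

/-- The model with corners of `M × M`. -/
abbrev pairModel (n : ℕ) := (halfModel n).prod (halfModel n)

/-- A corner chart of a subset of `M × M` which is smooth with respect to the product structure. -/
structure IsProductSmooth (C : Set (M × M)) (c : CornerChart C (2 * n)) : Prop where
  exists_extension : ∃ φ : M × M → EuclideanSpace ℝ (Fin (2 * n)),
    ContMDiffOn (pairModel n) 𝓘(ℝ, EuclideanSpace ℝ (Fin (2 * n))) ∞ φ (Subtype.val '' c.dom) ∧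
      ∀ q ∈ c.dom, c.toFun q = φ q
  contMDiffOn_inv : ContMDiffOn 𝓘(ℝ, EuclideanSpace ℝ (Fin (2 * n))) (pairModel n) ∞
    (fun t => (c.inv t : M × M)) c.tgt

theorem IsProductSmooth.smoothVia {c d : CornerChart C (2 * n)} (hc : IsProductSmooth C c)
    (hd : IsProductSmooth C d) {g : M × M → M × M} (hg : ContMDiff (pairModel n) (pairModel n) ∞ g)
    {g' : C → C} (hgg : ∀ q, (g' q : M × M) = g q) {q : C} (hq : q ∈ c.dom) (hgq : g' q ∈ d.dom) :
    c.SmoothVia d g' q := by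
  obtain ⟨φ, hφ, hdφ⟩ := hd.exists_extension
  have hcont : Continuous g' := by
    rw [continuous_induced_rng]
    have : (Subtype.val ∘ g') = fun q : C => g q := funext hgg
    rw [this]
    exact hg.continuous.comp continuous_subtype_val
  have hev := c.eventually_inv hq (hcont.continuousAt.preimage_mem_nhds (d.isOpen_dom.mem_nhds hgq))
  have h1 : ContMDiffWithinAt 𝓘(ℝ, EuclideanSpace ℝ (Fin (2 * n))) (pairModel n) ∞
      (fun t => g (c.inv t)) c.tgt (c.toFun q) :=
    hg.contMDiffAt.comp_contMDiffWithinAt (c.toFun q) (hc.contMDiffOn_inv _ (c.map_mem q hq))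
  have h2 : ContMDiffWithinAt 𝓘(ℝ, EuclideanSpace ℝ (Fin (2 * n)))
      𝓘(ℝ, EuclideanSpace ℝ (Fin (2 * n))) ∞ (fun t => φ (g (c.inv t))) c.tgt (c.toFun q) := by
    refine ContMDiffWithinAt.mono_of_mem_nhdsWithin (s := c.tgt ∩ {t | g' (c.inv t) ∈ d.dom}) ?_
      (Filter.inter_mem self_mem_nhdsWithin hev)
    refine ContMDiffWithinAt.comp (c.toFun q) (g := φ) (t := Subtype.val '' d.dom) ?_
      (h1.mono inter_subset_left) fun t ht => ⟨g' (c.inv t), ht.2, hgg _⟩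
    rw [c.left_inv q hq, ← hgg]
    exact hφ _ (mem_image_of_mem _ hgq)
  have h3 := h2.contDiffWithinAt
  refine h3.congr_of_eventuallyEq ?_ ?_
  · filter_upwards [hev] with t ht
    rw [hdφ _ ht, hgg]
  · rw [c.left_inv q hq]
    exact (hdφ _ hgq).trans (by rw [hgg])

/-- The atlas of all corner charts of `C` which are smooth with respect to the product structure. -/
def productAtlas (C : Set (M × M)) (h : ∀ q : C, ∃ c, IsProductSmooth C c ∧ q ∈ c.dom) :
    CornerAtlas C (2 * n) where
  charts := {c | IsProductSmooth C c}
  cover := h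
  compat _ hc _ hd _ hqc hqd := IsProductSmooth.smoothVia hc hd contMDiff_id (fun _ => rfl) hqc hqd

theorem productAtlas_isSmooth {h : ∀ q : C, ∃ c, IsProductSmooth C c ∧ q ∈ c.dom}
    {c : CornerChart C (2 * n)} (hc : IsProductSmooth C c) : (productAtlas C h).IsSmooth c :=
  CornerAtlas.isSmooth_of_mem hc

-- Supplies all corner charts. In a product chart at `p` the manifold `M × M` is locally a wedge
-- given by the boundary coordinates active at `p`. The functions `g i`, completed by linear
-- coordinates, have an invertible derivative and take each face of this wedge to the vanishing of
-- one of the `g i`; so `exists_inverse_wedge` applies, and the local description of `C` cuts the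
-- target wedge down to the sector.
open Classical in
theorem exists_isProductSmooth (p : C) {k : ℕ} (g : Fin k → M × M → ℝ)
    (hg : ∀ i, ∀ᶠ q in 𝓝 (p : M × M), ContMDiffAt (pairModel n) 𝓘(ℝ) ∞ (g i) q)
    {L : Fin k → EuclideanSpace ℝ (Fin n) × EuclideanSpace ℝ (Fin n) →L[ℝ] ℝ}
    (hL : LinearIndependent ℝ L)
    (hgL : ∀ i, HasMFDerivAt (pairModel n) 𝓘(ℝ) (g i) (p : M × M) (L i))
    (h1 : (p : M × M).1 ∈ M.bdry →
      ∃ i, ∀ᶠ q in 𝓝 (p : M × M), 0 ≤ g i q ∧ (g i q = 0 ↔ q.1 ∈ M.bdry))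
    (h2 : (p : M × M).2 ∈ M.bdry →
      ∃ i, ∀ᶠ q in 𝓝 (p : M × M), 0 ≤ g i q ∧ (g i q = 0 ↔ q.2 ∈ M.bdry))
    (hC : ∀ᶠ q in 𝓝 (p : M × M), q ∈ C ↔ ∀ i, 0 ≤ g i q) :
    ∃ c : CornerChart C (2 * n), IsProductSmooth C c ∧ p ∈ c.dom ∧
      c.HasBoundaryCoords fun i q => g i q := by
  set x := (p : M × M).1 with hx
  set y := (p : M × M).2 with hy
  set Φ := extChartAt (pairModel n) (p : M × M) with hΦ
  set t₀ := Φ p with ht₀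
  obtain ⟨Θ, hkm, hΘ⟩ := exists_coordinates (m := 2 * n) (by simp [two_mul]) hL
  -- the active boundary coordinates
  let ι := {b : Bool // (b = false ∧ x ∈ M.bdry) ∨ (b = true ∧ y ∈ M.bdry)}
  have hκ : ∀ b : ι, ∃ i, ∀ᶠ q in 𝓝 (p : M × M), 0 ≤ g i q ∧
      (g i q = 0 ↔ (if b.1 then q.2 else q.1) ∈ M.bdry) := by
    rintro ⟨b, (⟨rfl, h⟩ | ⟨rfl, h⟩)⟩
    · obtain ⟨i, hi⟩ := h1 h
      exact ⟨i, by simpa using hi⟩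
    · obtain ⟨i, hi⟩ := h2 h
      exact ⟨i, by simpa using hi⟩
  choose κ hκ using hκ
  let E := EuclideanSpace ℝ (Fin n)
  let ℓ : ι → E × E →L[ℝ] ℝ := fun b => (firstCoord n).comp
    (if b.1 then ContinuousLinearMap.snd ℝ E E else ContinuousLinearMap.fst ℝ E E)
  let v : ι → E × E := fun b => if b.1 then (0, firstVec n) else (firstVec n, 0)
  have hxs : x ∈ (extChartAt (halfModel n) x).source := mem_extChartAt_source x
  have hys : y ∈ (extChartAt (halfModel n) y).source := mem_extChartAt_source y
  have ht₀' : t₀ = (extChartAt (halfModel n) x x, extChartAt (halfModel n) y y) := by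
    rw [ht₀, hΦ, extChartAt_prod]; rfl
  have hΦ' : ∀ q ∈ Φ.source, q.1 ∈ (extChartAt (halfModel n) x).source ∧
      q.2 ∈ (extChartAt (halfModel n) y).source ∧
      (Φ q).1 = extChartAt (halfModel n) x q.1 ∧ (Φ q).2 = extChartAt (halfModel n) y q.2 := by
    intro q hq
    rw [hΦ, extChartAt_prod] at hq ⊢
    exact ⟨hq.1, hq.2, rfl, rfl⟩
  have hv : ∀ i j, ℓ i (v j) = if i = j then 1 else 0 := by
    have hn : ∀ i : ι, n ≠ 0 := by
      rintro ⟨b, (⟨-, h⟩ | ⟨-, h⟩)⟩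
      · exact ((mem_bdry_iff hxs).1 h).1
      · exact ((mem_bdry_iff hys).1 h).1
    rintro ⟨i, hi⟩ ⟨j, hj⟩
    have hn' := firstCoord_firstVec (hn ⟨i, hi⟩)
    rcases i <;> rcases j <;> simp [ℓ, v, hn']
    all_goals exact fun h => by simpa using congrArg Subtype.val h
  have hℓ₀ : ∀ i, ℓ i t₀ = 0 := by
    rintro ⟨b, (⟨rfl, h⟩ | ⟨rfl, h⟩)⟩
    · simpa [ℓ, ht₀'] using ((mem_bdry_iff hxs).1 h).2
    · simpa [ℓ, ht₀'] using ((mem_bdry_iff hys).1 h).2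
  -- a small neighbourhood
  have hU : {q : M × M | q ∈ Φ.source ∧ (∀ i, ContMDiffAt (pairModel n) 𝓘(ℝ) ∞ (g i) q) ∧
      (∀ b : ι, 0 ≤ g (κ b) q ∧ (g (κ b) q = 0 ↔ (if b.1 then q.2 else q.1) ∈ M.bdry)) ∧
      (q ∈ C ↔ ∀ i, 0 ≤ g i q)} ∈ 𝓝 (p : M × M) := by
    filter_upwards [extChartAt_source_mem_nhds (I := pairModel n) (p : M × M),
      Filter.eventually_all.2 hg, Filter.eventually_all.2 hκ, hC] with q a1 a2 a3 a4
    exact ⟨a1, a2, a3, a4⟩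
  obtain ⟨T, hT, htT, hTsub⟩ : ∃ T : Set (E × E), IsOpen T ∧ t₀ ∈ T ∧
      ∀ t ∈ T ∩ wedge ℓ, t ∈ Φ.target ∧ (∀ i, ContMDiffAt (pairModel n) 𝓘(ℝ) ∞ (g i) (Φ.symm t)) ∧
        (∀ b : ι, 0 ≤ g (κ b) (Φ.symm t) ∧ (g (κ b) (Φ.symm t) = 0 ↔ ℓ b t = 0)) ∧
        (Φ.symm t ∈ C ↔ ∀ i, 0 ≤ g i (Φ.symm t)) := by
    have hr : range (pairModel n) = {t | 0 ≤ firstCoord n t.1 ∧ 0 ≤ firstCoord n t.2} := by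
      rw [show range (pairModel n) = range (halfModel n) ×ˢ range (halfModel n) from
        (halfModel n).range_prod, range_halfModel_eq]
      rfl
    -- A boundary coordinate that is not active at `p` is positive nearby, so near `t₀` the wedge of
    -- the active ones lies in the range of the model.
    have hnear : ∀ᶠ t in 𝓝 t₀, t ∈ wedge ℓ → t ∈ range (pairModel n) := by
      have e1 : ∀ᶠ t : E × E in 𝓝 t₀, t ∈ wedge ℓ → 0 ≤ firstCoord n t.1 := by
        by_cases h : x ∈ M.bdry
        · filter_upwards with t ht
          simpa [ℓ] using ht ⟨false, Or.inl ⟨rfl, h⟩⟩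
        · rcases eq_or_ne n 0 with rfl | hn
          · exact Filter.Eventually.of_forall fun t _ => le_rfl
          have h3 : 0 < firstCoord n t₀.1 := by
            rw [mem_bdry_iff hxs] at h
            rw [ht₀']
            have := extChartAt_target_subset_range (I := halfModel n) x
              ((extChartAt (halfModel n) x).map_source hxs)
            rw [range_halfModel_eq] at this
            exact lt_of_le_of_ne this fun h' => h ⟨hn, h'.symm⟩
          have h4 : Continuous fun t : E × E => firstCoord n t.1 := by fun_prop
          filter_upwards [h4.continuousAt.eventually (lt_mem_nhds h3)] with t ht _
          exact le_of_lt ht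
      have e2 : ∀ᶠ t : E × E in 𝓝 t₀, t ∈ wedge ℓ → 0 ≤ firstCoord n t.2 := by
        by_cases h : y ∈ M.bdry
        · filter_upwards with t ht
          simpa [ℓ] using ht ⟨true, Or.inr ⟨rfl, h⟩⟩
        · rcases eq_or_ne n 0 with rfl | hn
          · exact Filter.Eventually.of_forall fun t _ => le_rfl
          have h3 : 0 < firstCoord n t₀.2 := by
            rw [mem_bdry_iff hys] at h
            rw [ht₀']
            have := extChartAt_target_subset_range (I := halfModel n) y
              ((extChartAt (halfModel n) y).map_source hys)
            rw [range_halfModel_eq] at this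
            exact lt_of_le_of_ne this fun h' => h ⟨hn, h'.symm⟩
          have h4 : Continuous fun t : E × E => firstCoord n t.2 := by fun_prop
          filter_upwards [h4.continuousAt.eventually (lt_mem_nhds h3)] with t ht _
          exact le_of_lt ht
      filter_upwards [e1, e2] with t a1 a2 a3
      rw [hr]; exact ⟨a1 a3, a2 a3⟩
    have hsymm : Filter.Tendsto Φ.symm (𝓝[range (pairModel n)] t₀) (𝓝 (p : M × M)) := by
      have := (continuousAt_extChartAt_symm (I := pairModel n) (p : M × M)).tendsto
      rw [extChartAt_to_inv] at this
      exact this.mono_left nhdsWithin_le_nhds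
    have hev := (hsymm.eventually hU).and (extChartAt_target_mem_nhdsWithin (I := pairModel n)
      (p : M × M))
    rw [Filter.eventually_iff_exists_mem] at hev
    obtain ⟨S, hS, hS'⟩ := hev
    obtain ⟨T₁, hT₁, htT₁, hT₁S⟩ := mem_nhdsWithin.1 hS
    obtain ⟨T₂, hT₂, hT₂o, htT₂⟩ := eventually_nhds_iff.1 hnear
    refine ⟨T₁ ∩ T₂, hT₁.inter hT₂o, ⟨htT₁, htT₂⟩, fun t ht => ?_⟩
    obtain ⟨⟨b1, b2, b3, b4⟩, b5⟩ := hS' t (hT₁S ⟨ht.1.1, hT₂ t ht.1.2 ht.2⟩)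
    refine ⟨b5, b2, fun b => ?_, b4⟩
    refine ⟨(b3 b).1, (b3 b).2.trans ?_⟩
    obtain ⟨c1, c2, c3, c4⟩ := hΦ' _ b1
    rw [Φ.right_inv b5] at c3 c4
    obtain ⟨b, (⟨rfl, h⟩ | ⟨rfl, h⟩)⟩ := b
    · have hn := ((mem_bdry_iff hxs).1 h).1
      simp [ℓ, c3, mem_bdry_iff c1, hn]
    · have hn := ((mem_bdry_iff hys).1 h).1
      simp [ℓ, c4, mem_bdry_iff c2, hn]
  set S := T ∩ wedge ℓ with hS
  have hSr : S ⊆ range (pairModel n) := fun t ht =>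
    extChartAt_target_subset_range (I := pairModel n) (p : M × M) (hTsub t ht).1
  -- The last coordinates are linear and the first ones have derivatives `L i`, so the derivative at
  -- `t₀` is exactly `Θ`.
  let Ψ : E × E → EuclideanSpace ℝ (Fin (2 * n)) := fun t => WithLp.toLp 2 fun i =>
    if h : (i : ℕ) < k then g ⟨i, h⟩ (Φ.symm t) else Θ t i
  have hΨlt : ∀ t (i : Fin k), Ψ t (Fin.castLE hkm i) = g i (Φ.symm t) := fun t i => by
    simp [Ψ]
  have hsm : ContDiffOn ℝ ∞ Ψ S := by
    intro t ht
    rw [contDiffWithinAt_euclidean]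
    intro i
    by_cases hi : (i : ℕ) < k
    · simp only [Ψ, dif_pos hi]
      have a1 := (hTsub t ht).2.1 ⟨i, hi⟩
      have a2 := (contMDiffOn_extChartAt_symm (I := pairModel n) (n := ∞) (p : M × M)) t
        (hTsub t ht).1
      exact (a1.comp_contMDiffWithinAt t
        (a2.mono fun t ht => (hTsub t ht).1 : ContMDiffWithinAt _ _ _ _ S t)).contDiffWithinAt
    · simp only [Ψ, dif_neg hi]
      exact ((EuclideanSpace.proj (𝕜 := ℝ) i).comp
        (Θ : E × E →L[ℝ] EuclideanSpace ℝ (Fin (2 * n)))).contDiff.contDiffWithinAt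
  have hd : HasFDerivWithinAt Ψ (Θ : E × E →L[ℝ] EuclideanSpace ℝ (Fin (2 * n))) S t₀ := by
    rw [hasFDerivWithinAt_euclidean]
    intro i
    by_cases hi : (i : ℕ) < k
    · simp only [Ψ, dif_pos hi]
      have a1 := (hgL ⟨i, hi⟩).2
      have a2 : HasFDerivWithinAt (fun t => g ⟨i, hi⟩ (Φ.symm t)) (L ⟨i, hi⟩)
        (range (pairModel n)) t₀ := a1
      have a3 : (EuclideanSpace.proj (𝕜 := ℝ) i).comp
          (Θ : E × E →L[ℝ] EuclideanSpace ℝ (Fin (2 * n))) = L ⟨i, hi⟩ :=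
        ContinuousLinearMap.ext fun v => hΘ v i hi
      have a4 := a2.mono hSr
      rw [← a3] at a4
      exact a4
    · simp only [Ψ, dif_neg hi]
      exact ((EuclideanSpace.proj (𝕜 := ℝ) i).comp
        (Θ : E × E →L[ℝ] EuclideanSpace ℝ (Fin (2 * n)))).hasFDerivWithinAt
  obtain ⟨T₀, T', χ, hT₀, hT', htT₀, hTT, hf, hg', hχ⟩ := exists_inverse_wedge
    (ℓ := ℓ) (v := v) (m := fun b : ι => EuclideanSpace.proj (𝕜 := ℝ) (Fin.castLE hkm (κ b)))
    (A := Θ) (Ψ := Ψ) hv hT htT hℓ₀ hsm hd (by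
      intro t ht b
      have := (hTsub t ht).2.2.1 b
      simpa [hΨlt] using this)
  have hTsub' : ∀ t ∈ T₀ ∩ wedge ℓ, t ∈ S := fun t ht => ⟨hTT ht.1, ht.2⟩
  -- The sector demands all `k` functions to be non-negative, the wedge only those that describe the
  -- boundary of `M × M`; hence the inverse is defined on the sector.
  have hsec : ∀ z ∈ T' ∩ cornerSector (2 * n) k, z ∈ T' ∩
      wedge (fun b : ι => EuclideanSpace.proj (𝕜 := ℝ) (Fin.castLE hkm (κ b))) :=
    fun z hz => ⟨hz.1, fun b => hz.2 _ (κ b).2⟩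
  have hΦw : ∀ q : M × M, q ∈ Φ.source → Φ q ∈ wedge ℓ := by
    intro q hq b
    have hr : Φ q ∈ range (pairModel n) :=
      extChartAt_target_subset_range (I := pairModel n) (p : M × M) (Φ.map_source hq)
    rw [show range (pairModel n) = range (halfModel n) ×ˢ range (halfModel n) from
      (halfModel n).range_prod, range_halfModel_eq] at hr
    obtain ⟨b, (⟨rfl, h⟩ | ⟨rfl, h⟩)⟩ := b
    · simpa [ℓ] using hr.1
    · simpa [ℓ] using hr.2
  have hinvC : ∀ z ∈ T' ∩ cornerSector (2 * n) k, Φ.symm (χ z) ∈ C := by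
    intro z hz
    obtain ⟨a1, a2⟩ := hg' z (hsec z hz)
    rw [(hTsub _ (hTsub' _ a1)).2.2.2]
    intro i
    rw [← hΨlt, a2]
    exact hz.2 _ i.2
  -- The value `p` is a mere default; on the sector the first branch applies.
  let inv : EuclideanSpace ℝ (Fin (2 * n)) → C := fun z =>
    if h : Φ.symm (χ z) ∈ C then ⟨_, h⟩ else p
  have hinv : ∀ z ∈ T' ∩ cornerSector (2 * n) k, (inv z : M × M) = Φ.symm (χ z) := fun z hz => by
    simp only [inv, dif_pos (hinvC z hz)]
  have hΦT : IsOpen (Φ.source ∩ Φ ⁻¹' T₀) :=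
    (continuousOn_extChartAt (I := pairModel n) (p : M × M)).isOpen_inter_preimage
      (isOpen_extChartAt_source (I := pairModel n) (p : M × M)) hT₀
  have hmem : ∀ q : C, (q : M × M) ∈ Φ.source ∩ Φ ⁻¹' T₀ →
      Φ q ∈ T₀ ∩ wedge ℓ ∧ Ψ (Φ q) ∈ T' ∩ cornerSector (2 * n) k ∧ χ (Ψ (Φ q)) = Φ q := by
    intro q hq
    have a0 : Φ q ∈ T₀ ∩ wedge ℓ := ⟨hq.2, hΦw _ hq.1⟩
    obtain ⟨a1, a2⟩ := hf _ a0
    refine ⟨a0, ⟨a1.1, fun i hi => ?_⟩, a2⟩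
    have a3 := hΨlt (Φ q) ⟨i, hi⟩
    rw [show Fin.castLE hkm ⟨i, hi⟩ = i from rfl] at a3
    rw [a3]
    refine (hTsub _ (hTsub' _ a0)).2.2.2.1 ?_ _
    rw [Φ.left_inv hq.1]
    exact q.2
  have hχs : ContMDiffOn 𝓘(ℝ, EuclideanSpace ℝ (Fin (2 * n))) (pairModel n) ∞
      (fun z => (inv z : M × M)) (T' ∩ cornerSector (2 * n) k) := by
    have a1 : ContMDiffOn 𝓘(ℝ, EuclideanSpace ℝ (Fin (2 * n))) (pairModel n) ∞
        (Φ.symm ∘ χ) (T' ∩ cornerSector (2 * n) k) := by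
      refine (contMDiffOn_extChartAt_symm (I := pairModel n) (n := ∞) (p : M × M)).comp
        (hχ.mono hsec).contMDiffOn fun z hz => ?_
      exact (hTsub _ (hTsub' _ (hg' z (hsec z hz)).1)).1
    exact a1.congr hinv
  have hφs : ContMDiffOn (pairModel n) 𝓘(ℝ, EuclideanSpace ℝ (Fin (2 * n))) ∞
      (Ψ ∘ Φ) (Φ.source ∩ Φ ⁻¹' T₀) := by
    refine hsm.contMDiffOn.comp (t := S)
      ((contMDiffOn_extChartAt (I := pairModel n) (n := ∞) (x := (p : M × M))).mono fun q hq => ?_)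
      fun q hq => hTsub' _ ⟨hq.2, hΦw _ hq.1⟩
    have := hq.1
    rwa [hΦ, extChartAt_source] at this
  let c : CornerChart C (2 * n) :=
    { k := k
      dom := Subtype.val ⁻¹' (Φ.source ∩ Φ ⁻¹' T₀)
      cod := T'
      toFun := fun q => Ψ (Φ q)
      inv := inv
      isOpen_dom := hΦT.preimage continuous_subtype_val
      isOpen_cod := hT'
      map_mem := fun q hq => (hmem q hq).2.1
      inv_mem := fun z hz => by
        have a1 := (hg' z (hsec z hz)).1
        have a2 := (hTsub _ (hTsub' _ a1)).1
        rw [mem_preimage, hinv z hz]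
        refine ⟨Φ.map_target a2, ?_⟩
        rw [mem_preimage, Φ.right_inv a2]
        exact a1.1
      left_inv := fun q hq => by
        obtain ⟨a1, a2, a3⟩ := hmem q hq
        refine Subtype.ext ?_
        rw [hinv _ a2, a3, Φ.left_inv hq.1]
      right_inv := fun z hz => by
        obtain ⟨a1, a2⟩ := hg' z (hsec z hz)
        rw [hinv z hz, Φ.right_inv (hTsub _ (hTsub' _ a1)).1, a2]
      continuousOn_toFun := hφs.continuousOn.comp continuous_subtype_val.continuousOn fun _ hq => hq
      continuousOn_inv := continuousOn_iff_continuous_domRestrict.2 (by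
        rw [continuous_induced_rng]
        exact continuousOn_iff_continuous_domRestrict.1 hχs.continuousOn) }
  refine ⟨c, ⟨⟨Ψ ∘ Φ, hφs.mono ?_, fun _ _ => rfl⟩, hχs⟩, ?_, rfl, hkm, fun q hq i => ?_⟩
  · rintro _ ⟨q, hq, rfl⟩; exact hq
  · exact ⟨mem_extChartAt_source (I := pairModel n) (p : M × M), htT₀⟩
  · have hq' : (q : M × M) ∈ Φ.source ∩ Φ ⁻¹' T₀ := hq
    change Ψ (Φ q) _ = _
    rw [hΨlt, Φ.left_inv hq'.1]

end ProductCharts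

/-! ### Tangent vectors given by coordinates -/

section Tangent

variable {n : ℕ} {M : CompactManifold n} {F : Type*} [NormedAddCommGroup F] [NormedSpace ℝ F]

/-- The tangent vector at the point with the coordinates `s` which has the coordinates `v`. -/
def coordTangent (z : M) (s : EuclideanSpace ℝ (Fin n)) :
    EuclideanSpace ℝ (Fin n) →L[ℝ] EuclideanSpace ℝ (Fin n) :=
  mfderivWithin 𝓘(ℝ, EuclideanSpace ℝ (Fin n)) (halfModel n) (extChartAt (halfModel n) z).symm
    (range (halfModel n)) s

/-- The differential of a map to a vector space, as a linear map between fixed vector spaces. -/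
abbrev vectorDeriv (G : M → F) (x : M) : EuclideanSpace ℝ (Fin n) →L[ℝ] F :=
  mfderiv (halfModel n) 𝓘(ℝ, F) G x

theorem hasFDerivWithinAt_comp_extChartAt_symm {G : M → F} {z : M}
    {s : EuclideanSpace ℝ (Fin n)} (hs : s ∈ (extChartAt (halfModel n) z).target)
    (hG : MDifferentiableAt (halfModel n) 𝓘(ℝ, F) G ((extChartAt (halfModel n) z).symm s)) :
    HasFDerivWithinAt (G ∘ (extChartAt (halfModel n) z).symm)
      ((vectorDeriv G ((extChartAt (halfModel n) z).symm s)).comp (coordTangent z s))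
      (range (halfModel n)) s :=
  (HasMFDerivAt.comp_hasMFDerivWithinAt s hG.hasMFDerivAt
    (mdifferentiableWithinAt_extChartAt_symm hs).hasMFDerivWithinAt).hasFDerivWithinAt

theorem hasFDerivWithinAt_extChartAt_symm_self {G : M → F} {z : M}
    (hG : MDifferentiableAt (halfModel n) 𝓘(ℝ, F) G z) :
    HasFDerivWithinAt (G ∘ (extChartAt (halfModel n) z).symm) (vectorDeriv G z)
      (range (halfModel n)) (extChartAt (halfModel n) z z) :=
  hG.hasMFDerivAt.2

theorem convex_range_halfModel (n : ℕ) : Convex ℝ (range (halfModel n)) := by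
  rw [range_halfModel_eq]
  exact convex_halfSpace_ge (firstCoord n).isLinear 0

/-- At a minimum on the boundary of the half-space the derivative is non-negative on inward vectors,
hence zero on tangential ones, hence a non-negative multiple of the first coordinate. -/
theorem exists_eq_mul_firstCoord {R : EuclideanSpace ℝ (Fin n) → ℝ} (hn : n ≠ 0)
    {t : EuclideanSpace ℝ (Fin n)} (ht : firstCoord n t = 0)
    {L : EuclideanSpace ℝ (Fin n) →L[ℝ] ℝ} (hL : HasFDerivWithinAt R L (range (halfModel n)) t)
    (hR : ∀ s ∈ range (halfModel n), R t ≤ R s) :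
    ∃ c, 0 ≤ c ∧ ∀ v, L v = c * firstCoord n v := by
  have hmin : IsLocalMinOn R (range (halfModel n)) t :=
    Filter.eventually_of_mem self_mem_nhdsWithin hR
  have hpos : ∀ v, 0 ≤ firstCoord n v → 0 ≤ L v := by
    intro v hv
    refine hmin.hasFDerivWithinAt_nonneg hL (mem_posTangentConeAt_of_segment_subset ?_)
    refine (convex_range_halfModel n).segment_subset ?_ ?_ <;> rw [range_halfModel_eq]
    · exact ht.ge
    · rw [mem_ofPred_eq, map_add, ht, zero_add]; exact hv
  have hzero : ∀ v, firstCoord n v = 0 → L v = 0 := by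
    intro v hv
    have h1 := hpos v hv.ge
    have h2 := hpos (-v) (by rw [map_neg, hv, neg_zero])
    rw [map_neg] at h2
    linarith
  have h1 := firstCoord_firstVec hn
  refine ⟨L (firstVec n), hpos _ (by rw [h1]; exact zero_le_one), fun v => ?_⟩
  have := hzero (v - firstCoord n v • firstVec n) (by simp [h1])
  rw [map_sub, map_smul, sub_eq_zero] at this
  rw [this, smul_eq_mul, mul_comm]

/-! ### Boundary defining functions -/

/-- `ρ` is a smooth function which is positive in the interior and vanishes on the boundary, and
its differential does not vanish there. -/
structure IsBoundaryDefining (M : CompactManifold n) (ρ : M → ℝ) : Prop where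
  contMDiff : ContMDiff (halfModel n) 𝓘(ℝ) ∞ ρ
  nonneg : ∀ x, 0 ≤ ρ x
  eq_zero_iff : ∀ x, ρ x = 0 ↔ x ∈ M.bdry
  deriv_ne_zero : ∀ x ∈ M.bdry, vectorDeriv ρ x ≠ 0

/-- Needed at points other than the centre of the chart: it shows that vectors without first
coordinate are tangent to the boundary. -/
theorem exists_vectorDeriv_coordTangent {ρ : M → ℝ}
    (hρ : ContMDiff (halfModel n) 𝓘(ℝ) ∞ ρ) (h0 : ∀ x, 0 ≤ ρ x) (hb : ∀ x ∈ M.bdry, ρ x = 0)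
    {z : M} {s : EuclideanSpace ℝ (Fin n)} (hs : s ∈ (extChartAt (halfModel n) z).target)
    (hsb : (extChartAt (halfModel n) z).symm s ∈ M.bdry) :
    ∃ c, 0 ≤ c ∧ ∀ v, vectorDeriv ρ ((extChartAt (halfModel n) z).symm s) (coordTangent z s v) =
      c * firstCoord n v := by
  have h1 := (mem_bdry_iff ((extChartAt (halfModel n) z).map_target hs)).1 hsb
  rw [(extChartAt (halfModel n) z).right_inv hs] at h1
  refine exists_eq_mul_firstCoord h1.1 h1.2 (hasFDerivWithinAt_comp_extChartAt_symm hs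
    (hρ.mdifferentiable (by simp) _)) fun t _ => ?_
  simp only [Function.comp_apply, hb _ hsb, h0]

theorem exists_vectorDeriv_eq {ρ : M → ℝ}
    (hρ : ContMDiff (halfModel n) 𝓘(ℝ) ∞ ρ) (h0 : ∀ x, 0 ≤ ρ x) (hb : ∀ x ∈ M.bdry, ρ x = 0)
    {z : M} (hz : z ∈ M.bdry) : ∃ c, 0 ≤ c ∧ ∀ v, vectorDeriv ρ z v = c * firstCoord n v := by
  have h1 := (mem_bdry_iff (mem_extChartAt_source z)).1 hz
  refine exists_eq_mul_firstCoord h1.1 h1.2 (hasFDerivWithinAt_extChartAt_symm_self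
    (hρ.mdifferentiable (by simp) _)) fun t _ => ?_
  simp only [Function.comp_apply, extChartAt_to_inv, hb _ hz, h0]

/-- Locally the first coordinate times a bump function does it, and compactness allows adding up
finitely many of these. For `n = 0` there is no boundary and a positive constant works. -/
theorem exists_isBoundaryDefining (M : CompactManifold n) : ∃ ρ, IsBoundaryDefining M ρ := by
  rcases eq_or_ne n 0 with rfl | hn
  · have hb : ∀ x : M, x ∉ M.bdry := fun x hx => ((mem_bdry_iff (mem_extChartAt_source x)).1 hx).1 rfl
    exact ⟨fun _ => 1, contMDiff_const, fun _ => zero_le_one, fun x => by simp [hb],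
      fun x hx => absurd hx (hb x)⟩
  suffices H : ∃ ρ : M → ℝ, ContMDiff (halfModel n) 𝓘(ℝ) ∞ ρ ∧ (∀ x, 0 ≤ ρ x) ∧
      (∀ x ∈ M.bdry, ρ x = 0) ∧ (∀ x ∈ univ, x ∉ M.bdry → ρ x ≠ 0) ∧
      ∀ x ∈ univ, x ∈ M.bdry → vectorDeriv ρ x ≠ 0 by
    obtain ⟨ρ, h1, h2, h3, h4, h5⟩ := H
    exact ⟨ρ, h1, h2, fun x => ⟨fun h => by_contra fun h' => h4 x trivial h' h, h3 x⟩,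
      fun x => h5 x trivial⟩
  refine IsCompact.induction_on (isCompact_univ (X := M)) (p := fun K => ∃ ρ : M → ℝ,
    ContMDiff (halfModel n) 𝓘(ℝ) ∞ ρ ∧ (∀ x, 0 ≤ ρ x) ∧ (∀ x ∈ M.bdry, ρ x = 0) ∧
    (∀ x ∈ K, x ∉ M.bdry → ρ x ≠ 0) ∧ ∀ x ∈ K, x ∈ M.bdry → vectorDeriv ρ x ≠ 0) ?_ ?_ ?_ ?_
  · exact ⟨fun _ => 0, contMDiff_const, fun _ => le_rfl, fun _ _ => rfl, by simp, by simp⟩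
  · rintro K K' hK ⟨ρ, h1, h2, h3, h4, h5⟩
    exact ⟨ρ, h1, h2, h3, fun x hx => h4 x (hK hx), fun x hx => h5 x (hK hx)⟩
  · rintro K K' ⟨ρ, h1, h2, h3, h4, h5⟩ ⟨ρ', h1', h2', h3', h4', h5'⟩
    refine ⟨fun x => ρ x + ρ' x, h1.add h1', fun x => add_nonneg (h2 x) (h2' x),
      fun x hx => by simp only [h3 x hx, h3' x hx, add_zero], ?_, ?_⟩
    · intro x hx hxb h
      have e1 : ρ x = 0 := by linarith [h2 x, h2' x]
      have e2 : ρ' x = 0 := by linarith [h2 x, h2' x]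
      exact hx.elim (fun hx => h4 x hx hxb e1) fun hx => h4' x hx hxb e2
    -- The differentials cannot cancel in the sum: both are non-negative multiples of the same
    -- functional.
    · intro x hx hxb h
      obtain ⟨c, hc, hcv⟩ := exists_vectorDeriv_eq h1 h2 h3 hxb
      obtain ⟨c', hc', hcv'⟩ := exists_vectorDeriv_eq h1' h2' h3' hxb
      have hadd : vectorDeriv (fun x => ρ x + ρ' x) x = vectorDeriv ρ x + vectorDeriv ρ' x :=
        mfderiv_add (h1.mdifferentiable (by simp) x) (h1'.mdifferentiable (by simp) x)
      rw [hadd] at h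
      have h6 := congrArg (fun L : EuclideanSpace ℝ (Fin n) →L[ℝ] ℝ => L (firstVec n)) h
      simp only [add_apply, hcv, hcv', firstCoord_firstVec hn, zero_apply] at h6
      have e1 : c = 0 := by linarith
      have e2 : c' = 0 := by linarith
      rcases hx with hx | hx
      · exact h5 x hx hxb (ContinuousLinearMap.ext fun v => by rw [hcv, e1]; simp)
      · exact h5' x hx hxb (ContinuousLinearMap.ext fun v => by rw [hcv', e2]; simp)
  · intro z _
    obtain ⟨f⟩ : Nonempty (SmoothBumpFunction (halfModel n) z) := inferInstance
    have hf1 := f.eventuallyEq_one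
    have hsrc := f.tsupport_subset_extChartAt_source
    have hin : ∀ x ∈ (extChartAt (halfModel n) z).source,
        0 ≤ firstCoord n (extChartAt (halfModel n) z x) := by
      intro x hx
      have := extChartAt_target_subset_range (I := halfModel n) z
        ((extChartAt (halfModel n) z).map_source hx)
      rwa [range_halfModel_eq] at this
    have hin' : ∀ x, f x ≠ 0 → x ∈ (extChartAt (halfModel n) z).source := fun x hx =>
      hsrc (subset_tsupport _ hx)
    refine ⟨{x | f =ᶠ[𝓝 x] 1 ∧ x ∈ (extChartAt (halfModel n) z).source}, ?_,
      fun x => f x • firstCoord n (extChartAt (halfModel n) z x), ?_, ?_, ?_, ?_, ?_⟩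
    · refine mem_nhdsWithin_of_mem_nhds ?_
      filter_upwards [hf1.eventuallyEq_nhds, extChartAt_source_mem_nhds (I := halfModel n) z]
        with x h1 h2 using ⟨h1, h2⟩
    · refine f.contMDiff_smul ?_
      exact ((firstCoord n).contDiff (n := ∞)).contMDiff.comp_contMDiffOn contMDiffOn_extChartAt
    · intro x
      by_cases hx : f x = 0
      · simp [hx]
      · exact mul_nonneg f.nonneg (hin x (hin' x hx))
    · intro x hxb
      by_cases hx : f x = 0
      · simp [hx]
      · simp only [((mem_bdry_iff (hin' x hx)).1 hxb).2, smul_zero]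
    · rintro x ⟨hx1, hx2⟩ hxb h
      simp only [hx1.eq_of_nhds, Pi.one_apply, one_smul] at h
      exact hxb ((mem_bdry_iff hx2).2 ⟨hn, h⟩)
    · rintro x ⟨hx1, hx2⟩ hxb h
      have he : (fun x => f x • firstCoord n (extChartAt (halfModel n) z x)) =ᶠ[𝓝 x]
          fun x => firstCoord n (extChartAt (halfModel n) z x) := by
        filter_upwards [hx1] with y hy
        rw [hy, Pi.one_apply, one_smul]
      have hx2' : x ∈ (chartAt (HalfSpace n) z).source := by rwa [extChartAt_source] at hx2
      have h1 : vectorDeriv (fun x => firstCoord n (extChartAt (halfModel n) z x)) x =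
          (firstCoord n).comp (vectorDeriv (extChartAt (halfModel n) z) x) :=
        (HasMFDerivAt.comp x (firstCoord n).hasMFDerivAt
          (mdifferentiableAt_extChartAt hx2').hasMFDerivAt).mfderiv
      have h2 : vectorDeriv (fun x => f x • firstCoord n (extChartAt (halfModel n) z x)) x =
          vectorDeriv (fun x => firstCoord n (extChartAt (halfModel n) z x)) x := he.mfderiv_eq
      rw [h2, h1] at h
      obtain ⟨w, hw⟩ := (isInvertible_mfderiv_extChartAt (I := halfModel n) hx2).surjective
        (firstVec n)
      have h3 : firstCoord n (vectorDeriv (extChartAt (halfModel n) z) x w) = 0 :=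
        congrArg (fun L : EuclideanSpace ℝ (Fin n) →L[ℝ] ℝ => L w) h
      have h4 : vectorDeriv (extChartAt (halfModel n) z) x w = firstVec n := hw
      rw [h4, firstCoord_firstVec hn] at h3
      exact one_ne_zero h3

end Tangent

/-! ### The distance in a Euclidean space near the diagonal -/

section NearDiagonal

variable {n : ℕ} {M : CompactManifold n} {F : Type*} [NormedAddCommGroup F] [InnerProductSpace ℝ F]

/-- With `‖l‖ ≥ 4 r` the inner product is at least `‖l‖² - 2 r ‖l‖ - r² > 0`. -/
theorem inner_pos_of_norm_sub_le {a b l : F} {r : ℝ} (hr : 0 < r) (hl : 4 * r ≤ ‖l‖)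
    (ha : ‖a - l‖ ≤ r) (hb : ‖b - l‖ ≤ r) : 0 < inner ℝ a b := by
  have h : inner ℝ a b = ‖l‖ ^ 2 + inner ℝ (a - l) l + inner ℝ l (b - l)
      + inner ℝ (a - l) (b - l) := by
    simp only [inner_sub_left, inner_sub_right, real_inner_self_eq_norm_sq]
    ring
  have h1 := (abs_le.1 (abs_real_inner_le_norm (a - l) l)).1
  have h2 := (abs_le.1 (abs_real_inner_le_norm l (b - l))).1
  have h3 := (abs_le.1 (abs_real_inner_le_norm (a - l) (b - l))).1
  have h4 : ‖a - l‖ * ‖l‖ ≤ r * ‖l‖ := by gcongr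
  have h5 : ‖l‖ * ‖b - l‖ ≤ ‖l‖ * r := by gcongr
  have h6 : ‖a - l‖ * ‖b - l‖ ≤ r * r := by gcongr
  nlinarith

/-- Near `z` both the chord from `e t` to `e s` and the derivative of `e` at `s` applied to `s - t`
are close to `L (s - t)`, relative to `‖s - t‖`. So moving `s` away from `t` in the chart increases
the distance of the images to first order. -/
theorem exists_nhds_inner_pos {e : M → F} (he : ContMDiff (halfModel n) 𝓘(ℝ, F) ∞ e)
    {z : M} (hz : Function.Injective (vectorDeriv e z)) :
    ∃ O ∈ 𝓝 (extChartAt (halfModel n) z z), ∀ s ∈ O ∩ (extChartAt (halfModel n) z).target,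
      ∀ t ∈ O ∩ (extChartAt (halfModel n) z).target, s ≠ t →
      0 < inner ℝ (e ((extChartAt (halfModel n) z).symm s) - e ((extChartAt (halfModel n) z).symm t))
        (vectorDeriv e ((extChartAt (halfModel n) z).symm s) (coordTangent z s (s - t))) := by
  set φ := extChartAt (halfModel n) z with hφ
  set L := vectorDeriv e z with hL
  have hed := he.mdifferentiable (by simp)
  obtain ⟨K, hK, hKL⟩ := LinearMap.exists_antilipschitzWith
    (L : EuclideanSpace ℝ (Fin n) →ₗ[ℝ] F) (LinearMap.ker_eq_bot.2 hz)
  have hKL' : ∀ v, ‖v‖ ≤ K * ‖L v‖ := fun v => by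
    simpa using hKL.le_mul_dist v 0
  have hK' : (0 : ℝ) < K := hK
  -- Since `‖v‖ ≤ K ‖L v‖`, an error of `η ‖v‖` is at most a quarter of `‖L v‖`, as
  -- `inner_pos_of_norm_sub_le` requires.
  set η : ℝ := 1 / (4 * K) with hη
  have hη0 : 0 < η := by positivity
  have hud := uniqueDiffOn_extChartAt_target (I := halfModel n) z
  have hsub := extChartAt_target_subset_range (I := halfModel n) z
  have hsm : ContDiffOn ℝ ∞ (e ∘ φ.symm) φ.target :=
    (he.comp_contMDiffOn (contMDiffOn_extChartAt_symm (I := halfModel n) (n := ∞) z)).contDiffOn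
  have hder : ∀ s ∈ φ.target, HasFDerivWithinAt (e ∘ φ.symm)
      ((vectorDeriv e (φ.symm s)).comp (coordTangent z s)) φ.target s := fun s hs =>
    (hasFDerivWithinAt_comp_extChartAt_symm hs (hed _)).mono hsub
  have hz' : φ z ∈ φ.target := mem_extChartAt_target z
  have hder0 : fderivWithin ℝ (e ∘ φ.symm) φ.target (φ z) = L :=
    ((hasFDerivWithinAt_extChartAt_symm_self (hed z)).mono hsub).fderivWithin (hud _ hz')
  have hcont := hsm.continuousOn_fderivWithin hud (by norm_cast) (φ z) hz'
  have hnear : ∀ᶠ s in 𝓝[φ.target] (φ z), ‖fderivWithin ℝ (e ∘ φ.symm) φ.target s - L‖ < η := by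
    have := Metric.tendsto_nhds.1 hcont η hη0
    rw [hder0] at this
    simpa only [dist_eq_norm] using this
  rw [nhdsWithin_extChartAt_target_eq] at hnear
  obtain ⟨r, hr, hball⟩ := Metric.mem_nhdsWithin_iff.1
    (hnear.and (extChartAt_target_mem_nhdsWithin (I := halfModel n) z))
  have hconv : Convex ℝ (Metric.ball (φ z) r ∩ range (halfModel n)) :=
    (convex_ball _ _).inter (convex_range_halfModel n)
  refine ⟨Metric.ball (φ z) r, Metric.ball_mem_nhds _ hr, fun s hs t ht hst => ?_⟩
  have hs' : s ∈ Metric.ball (φ z) r ∩ range (halfModel n) := ⟨hs.1, hsub hs.2⟩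
  have ht' : t ∈ Metric.ball (φ z) r ∩ range (halfModel n) := ⟨ht.1, hsub ht.2⟩
  have hw : 0 < ‖s - t‖ := norm_pos_iff.2 (sub_ne_zero.2 hst)
  refine inner_pos_of_norm_sub_le (l := L (s - t)) (r := η * ‖s - t‖) (by positivity) ?_ ?_ ?_
  · have := hKL' (s - t)
    rw [hη]
    rw [show 4 * (1 / (4 * (K : ℝ)) * ‖s - t‖) = ‖s - t‖ / K by field_simp]
    rwa [div_le_iff₀ hK', mul_comm]
  · refine Convex.norm_image_sub_le_of_norm_hasFDerivWithin_le' (f := e ∘ φ.symm)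
      (f' := fderivWithin ℝ (e ∘ φ.symm) φ.target) (fun x hx => ?_)
      (fun x hx => (hball hx).1.le) hconv ht' hs'
    have h1 := (hball hx).2
    exact ((hsm.differentiableOn (by simp)) x h1).hasFDerivWithinAt.mono fun y hy => (hball hy).2
  · have h1 : (vectorDeriv e (φ.symm s)).comp (coordTangent z s) =
        fderivWithin ℝ (e ∘ φ.symm) φ.target s := ((hder s hs.2).fderivWithin (hud _ hs.2)).symm
    have h2 : vectorDeriv e (φ.symm s) (coordTangent z s (s - t)) - L (s - t) =
        (fderivWithin ℝ (e ∘ φ.symm) φ.target s - L) (s - t) := by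
      rw [← h1]; rfl
    rw [h2]
    exact ContinuousLinearMap.le_of_opNorm_le _ (hball hs').1.le _

/-- The squared distance of the images of two points. -/
def sqDist (e : M → F) (q : M × M) : ℝ := ‖e q.1 - e q.2‖ ^ 2

/-- The differential of a function on `M × M`, as a functional on a fixed vector space. -/
abbrev pairDeriv (G : M × M → ℝ) (q : M × M) :
    EuclideanSpace ℝ (Fin n) × EuclideanSpace ℝ (Fin n) →L[ℝ] ℝ :=
  mfderiv (pairModel n) 𝓘(ℝ) G q

theorem contMDiff_sqDist {e : M → F} (he : ContMDiff (halfModel n) 𝓘(ℝ, F) ∞ e) :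
    ContMDiff (pairModel n) 𝓘(ℝ) ∞ (sqDist e) := by
  have h1 : ContMDiff (pairModel n) 𝓘(ℝ, F) ∞ (fun q : M × M => e q.1 - e q.2) :=
    (he.comp contMDiff_fst).sub (he.comp contMDiff_snd)
  exact (contDiff_norm_sq ℝ).contMDiff.comp h1

theorem pairDeriv_sqDist {e : M → F} (he : ContMDiff (halfModel n) 𝓘(ℝ, F) ∞ e) (q : M × M)
    (ξ : EuclideanSpace ℝ (Fin n) × EuclideanSpace ℝ (Fin n)) :
    pairDeriv (sqDist e) q ξ = 2 * inner ℝ (e q.1 - e q.2)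
      (vectorDeriv e q.1 ξ.1 - vectorDeriv e q.2 ξ.2) := by
  have hed := he.mdifferentiable (by simp)
  have h1 : HasMFDerivAt (pairModel n) 𝓘(ℝ, F) (fun q : M × M => e q.1) q
      ((vectorDeriv e q.1).comp (ContinuousLinearMap.fst ℝ _ _)) :=
    HasMFDerivAt.comp q (hed q.1).hasMFDerivAt (hasMFDerivAt_fst q)
  have h2 : HasMFDerivAt (pairModel n) 𝓘(ℝ, F) (fun q : M × M => e q.2) q
      ((vectorDeriv e q.2).comp (ContinuousLinearMap.snd ℝ _ _)) :=
    HasMFDerivAt.comp q (hed q.2).hasMFDerivAt (hasMFDerivAt_snd q)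
  have h3 := h1.sub h2
  have h4 : HasMFDerivAt 𝓘(ℝ, F) 𝓘(ℝ) (fun v : F => ‖v‖ ^ 2) (e q.1 - e q.2)
      ((2 : ℝ) • (innerSL ℝ (e q.1 - e q.2))) :=
    by simpa only [← Nat.cast_smul_eq_nsmul ℝ, Nat.cast_ofNat] using
      (hasStrictFDerivAt_norm_sq (e q.1 - e q.2)).hasFDerivAt.hasMFDerivAt
  have h5 := (HasMFDerivAt.comp q h4 h3).mfderiv
  have h6 : pairDeriv (sqDist e) q = _ := h5
  rw [h6]
  rfl

/-- Transversality of the level sets of the distance to all boundary strata. A point in the interior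
may be moved freely away from the other one. If both points are on the boundary, their first
coordinates in a common chart vanish, so the direction `s - t` is itself tangent to the boundary. -/
theorem exists_direction_near_diagonal {e : M → F} (he : ContMDiff (halfModel n) 𝓘(ℝ, F) ∞ e)
    (hinj : Function.Injective e) (himm : ∀ x, Function.Injective (vectorDeriv e x))
    {ρ : M → ℝ} (hρ : IsBoundaryDefining M ρ) :
    ∃ ε > 0, ∀ q : M × M, q.1 ≠ q.2 → sqDist e q < ε →
      ∃ ξ, pairDeriv (sqDist e) q ξ ≠ 0 ∧ (q.1 ∈ M.bdry → vectorDeriv ρ q.1 ξ.1 = 0) ∧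
        (q.2 ∈ M.bdry → vectorDeriv ρ q.2 ξ.2 = 0) := by
  have hloc : ∀ z : M, ∀ᶠ q in 𝓝 (z, z), q.1 ≠ q.2 →
      ∃ ξ, pairDeriv (sqDist e) q ξ ≠ 0 ∧ (q.1 ∈ M.bdry → vectorDeriv ρ q.1 ξ.1 = 0) ∧
        (q.2 ∈ M.bdry → vectorDeriv ρ q.2 ξ.2 = 0) := by
    intro z
    obtain ⟨O, hO, h⟩ := exists_nhds_inner_pos he (himm z)
    have hs : {x | x ∈ (extChartAt (halfModel n) z).source ∧
        extChartAt (halfModel n) z x ∈ O} ∈ 𝓝 z := by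
      filter_upwards [extChartAt_source_mem_nhds (I := halfModel n) z,
        (continuousAt_extChartAt (I := halfModel n) z).preimage_mem_nhds hO] with x h1 h2
        using ⟨h1, h2⟩
    rw [nhds_prod_eq]
    filter_upwards [Filter.prod_mem_prod hs hs]
    rintro ⟨x, y⟩ ⟨⟨hx, hxO⟩, hy, hyO⟩ hxy
    set φ := extChartAt (halfModel n) z with hφ
    obtain ⟨s, hs, rfl⟩ : ∃ s ∈ φ.target, φ.symm s = x := ⟨φ x, φ.map_source hx, φ.left_inv hx⟩
    obtain ⟨t, ht, rfl⟩ : ∃ t ∈ φ.target, φ.symm t = y := ⟨φ y, φ.map_source hy, φ.left_inv hy⟩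
    simp only [] at hx hy hxO hyO hxy ⊢
    rw [φ.right_inv hs] at hxO
    rw [φ.right_inv ht] at hyO
    have hst : s ≠ t := fun h => hxy (by rw [h])
    have h1 := h s ⟨hxO, hs⟩ t ⟨hyO, ht⟩ hst
    have h2 := h t ⟨hyO, ht⟩ s ⟨hxO, hs⟩ hst.symm
    by_cases hxb : φ.symm s ∈ M.bdry
    · by_cases hyb : φ.symm t ∈ M.bdry
      · refine ⟨(coordTangent z s (s - t), 0), ?_, fun _ => ?_, fun _ => map_zero _⟩
        · rw [pairDeriv_sqDist he]
          simpa using h1.ne'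
        · obtain ⟨c, -, hc⟩ := exists_vectorDeriv_coordTangent hρ.contMDiff hρ.nonneg
            (fun x hx => (hρ.eq_zero_iff x).2 hx) hs hxb
          have e1 := ((mem_bdry_iff hx).1 hxb).2
          have e2 := ((mem_bdry_iff hy).1 hyb).2
          rw [← hφ, φ.right_inv hs] at e1
          rw [← hφ, φ.right_inv ht] at e2
          change vectorDeriv ρ (φ.symm s) (coordTangent z s (s - t)) = 0
          rw [hc, map_sub, e1, e2, sub_zero, mul_zero]
      · refine ⟨(0, coordTangent z t (t - s)), ?_, fun _ => map_zero _, fun h => absurd h hyb⟩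
        rw [pairDeriv_sqDist he]
        have h3 : (2 : ℝ) * inner ℝ (e (φ.symm s) - e (φ.symm t)) (vectorDeriv e (φ.symm s) 0
            - vectorDeriv e (φ.symm t) (coordTangent z t (t - s))) =
            2 * inner ℝ (e (φ.symm t) - e (φ.symm s))
              (vectorDeriv e (φ.symm t) (coordTangent z t (t - s))) := by
          rw [map_zero, zero_sub, inner_neg_right, ← inner_neg_left, neg_sub]
        exact h3.trans_ne (by positivity)
    · refine ⟨(coordTangent z s (s - t), 0), ?_, fun h => absurd h hxb, fun _ => map_zero _⟩
      rw [pairDeriv_sqDist he]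
      simpa using h1.ne'
  -- The distance vanishes only on the diagonal, so compactness puts a sublevel set into the union
  -- of the local neighbourhoods.
  choose O hO hOo hzO using fun z => eventually_nhds_iff.1 (hloc z)
  obtain ⟨ε, hε, h⟩ := exists_pos_sublevel_subset (w := sqDist e)
    (contMDiff_sqDist he).continuous (fun q => sq_nonneg _) (O := ⋃ z, O z)
    (isOpen_iUnion hOo) (fun q hq => by
      have : e q.1 = e q.2 := by
        rw [sqDist, sq_eq_zero_iff, norm_eq_zero, sub_eq_zero] at hq
        exact hq
      refine mem_iUnion.2 ⟨q.1, ?_⟩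
      have h2 : q = (q.1, q.1) := Prod.ext rfl (hinj this).symm
      rw [h2]; exact hzO _)
  refine ⟨ε, hε, fun q hq hqε => ?_⟩
  obtain ⟨z, hz⟩ := mem_iUnion.1 (h q hqε)
  exact hO z q hz hq

end NearDiagonal

/-! ### Charts without boundary coordinates -/

/-- An interior chart is translated so that a unit ball has non-negative coordinates, which makes it
a chart with values in the half-space. -/
theorem CornerAtlas.IsSmooth.exists_k_eq_one {m : ℕ} {Y : Type*} [TopologicalSpace Y]
    {A : CornerAtlas Y m} {c : CornerChart Y m} (hc : A.IsSmooth c) (hk : c.k = 0) {p : Y}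
    (hp : p ∈ c.dom) : ∃ d : CornerChart Y m, A.IsSmooth d ∧ d.k = 1 ∧ p ∈ d.dom := by
  set t₀ := c.toFun p with ht₀
  let w : EuclideanSpace ℝ (Fin m) := WithLp.toLp 2 fun i => 1 + |t₀ i|
  have hw : ∀ t ∈ Metric.ball t₀ 1, ∀ i, 0 ≤ (t + w) i := by
    intro t ht i
    have h1 : |t i - t₀ i| < 1 := by
      refine lt_of_le_of_lt ?_ (mem_ball_iff_norm.1 ht)
      simpa using PiLp.norm_apply_le (t - t₀) i
    have h2 := abs_lt.1 h1
    have h3 := neg_abs_le (t₀ i)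
    change 0 ≤ t i + (1 + |t₀ i|)
    linarith
  have htgt : ∀ t, t ∈ c.tgt ↔ t ∈ c.cod := fun t =>
    ⟨fun h => h.1, fun h => ⟨h, fun i hi => by rw [hk] at hi; omega⟩⟩
  refine ⟨c.reparam 1 (Metric.ball t₀ 1) ((fun y => y - w) ⁻¹' (Metric.ball t₀ 1 ∩ c.cod))
    (fun t => t + w) (fun y => y - w) Metric.isOpen_ball
    ((Metric.isOpen_ball.inter c.isOpen_cod).preimage (by fun_prop)) (by fun_prop) (by fun_prop)
    (fun t ht => ⟨⟨?_, fun i _ => hw t ht.1 i⟩, add_sub_cancel_right t w⟩)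
    (fun y hy => ⟨⟨hy.1.1, (htgt _).2 hy.1.2⟩, sub_add_cancel y w⟩),
    hc.reparam (by fun_prop) (by fun_prop), rfl, hp, Metric.mem_ball_self one_pos⟩
  rw [mem_preimage, add_sub_cancel_right]
  exact ⟨ht.1, ht.2.1⟩

/-! ### From smooth charts of the product atlas back to corner charts in `M × M` -/

section ProductSmooth

variable {n : ℕ} {M : CompactManifold n} {C : Set (M × M)}

-- The charts produced by the straightening are known only to be compatible with the product atlas;
-- this recovers smoothness in `M × M` by comparison with an atlas chart near each point.
open Classical in
theorem isProductSmooth_of_isSmooth {h : ∀ q : C, ∃ c, IsProductSmooth C c ∧ q ∈ c.dom}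
    {c : CornerChart C (2 * n)} (hc : (productAtlas C h).IsSmooth c) : IsProductSmooth C c := by
  refine ⟨⟨fun q => if hq : q ∈ C then c.toFun ⟨q, hq⟩ else 0, ?_, fun q _ => by simp⟩, ?_⟩
  · rintro _ ⟨q, hq, rfl⟩
    obtain ⟨d, hd, hqd⟩ := h q
    obtain ⟨φ, hφ, hdφ⟩ := hd.exists_extension
    have h1 : ContDiffWithinAt ℝ ∞ (fun t => c.toFun (d.inv t)) d.tgt (d.toFun q) :=
      (productAtlas_isSmooth (h := h) hd).smoothVia hc hqd hq
    have h2 := hφ q (mem_image_of_mem _ hqd)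
    rw [hdφ q hqd] at h1
    have h3 : ContMDiffWithinAt (pairModel n) 𝓘(ℝ, EuclideanSpace ℝ (Fin (2 * n))) ∞
        (fun q' => c.toFun (d.inv (φ q'))) (Subtype.val '' d.dom) (q : M × M) :=
      ContMDiffWithinAt.comp (t := d.tgt) (g := fun t => c.toFun (d.inv t)) (q : M × M)
        h1.contMDiffWithinAt h2 (by
        rintro _ ⟨q', hq', rfl⟩
        rw [← hdφ q' hq']
        exact d.map_mem q' hq')
    obtain ⟨O, hO, hOd⟩ := isOpen_induced_iff.1 d.isOpen_dom
    have h4 : (Subtype.val '' d.dom) ∈ 𝓝[Subtype.val '' c.dom] (q : M × M) := by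
      refine mem_nhdsWithin.2 ⟨O, hO, ?_, ?_⟩
      · have : q ∈ Subtype.val ⁻¹' O := by rw [hOd]; exact hqd
        exact this
      · rintro _ ⟨hq'O, q', hq', rfl⟩
        exact mem_image_of_mem _ (by rw [← hOd]; exact hq'O)
    have h5 : ∀ q' ∈ Subtype.val '' d.dom,
        (if hq : q' ∈ C then c.toFun ⟨q', hq⟩ else 0) = c.toFun (d.inv (φ q')) := by
      rintro _ ⟨q', hq', rfl⟩
      rw [dif_pos q'.2, ← hdφ q' hq', d.left_inv q' hq']
    exact (h3.congr h5 (h5 _ (mem_image_of_mem _ hqd))).mono_of_mem_nhdsWithin h4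
  · intro t ht
    obtain ⟨d, hd, hqd⟩ := h (c.inv t)
    have hq : c.inv t ∈ c.dom := c.inv_mem t ht
    have h1 : ContDiffWithinAt ℝ ∞ (fun t => d.toFun (c.inv t)) c.tgt (c.toFun (c.inv t)) :=
      hc.smoothVia (productAtlas_isSmooth (h := h) hd) hq hqd
    have hev := c.eventually_inv hq (d.isOpen_dom.mem_nhds hqd)
    rw [c.right_inv t ht] at h1 hev
    have h2 : ContMDiffWithinAt 𝓘(ℝ, EuclideanSpace ℝ (Fin (2 * n))) (pairModel n) ∞
        (fun t => (d.inv (d.toFun (c.inv t)) : M × M)) (c.tgt ∩ {t | c.inv t ∈ d.dom}) t :=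
      ContMDiffWithinAt.comp (t := d.tgt) t (hd.contMDiffOn_inv _ (d.map_mem _ hqd))
        (h1.mono inter_subset_left).contMDiffWithinAt fun s hs => d.map_mem _ hs.2
    refine ContMDiffWithinAt.mono_of_mem_nhdsWithin (h2.congr (fun s hs => ?_) ?_)
      (Filter.inter_mem self_mem_nhdsWithin hev)
    · rw [d.left_inv _ hs.2]
    · rw [d.left_inv _ hqd]

theorem IsProductSmooth.isCornerChart {c : CornerChart C (2 * n)} (hc : IsProductSmooth C c) :
    ∃ O φ, Subtype.val ⁻¹' O = c.dom ∧ (∀ q ∈ c.dom, c.toFun q = φ q) ∧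
      IsCornerChart (pairModel n) (2 * n) c.k C O φ := by
  obtain ⟨φ, hφ, hcφ⟩ := hc.exists_extension
  obtain ⟨O, hO, hOc⟩ := isOpen_induced_iff.1 c.isOpen_dom
  have hCO : C ∩ O = Subtype.val '' c.dom := by
    rw [← hOc, Subtype.image_preimage_coe]
  have himg : φ '' (C ∩ O) = c.cod ∩ cornerSector (2 * n) c.k := by
    rw [hCO, image_image]
    ext t
    constructor
    · rintro ⟨q, hq, rfl⟩
      change φ q ∈ _
      rw [← hcφ q hq]
      exact c.map_mem q hq
    · intro ht
      exact ⟨c.inv t, c.inv_mem t ht, (hcφ _ (c.inv_mem t ht)).symm.trans (c.right_inv t ht)⟩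
  refine ⟨O, φ, hOc, hcφ, hO, by rwa [hCO], ⟨c.cod, c.isOpen_cod, himg⟩,
    fun t => (c.inv t : M × M), ?_, ?_⟩
  · rw [hCO]
    rintro _ ⟨q, hq, rfl⟩
    simp only [← hcφ q hq, c.left_inv q hq]
  · rw [himg]
    exact hc.contMDiffOn_inv

end ProductSmooth

/-! ### Corner charts for the complement of a neighbourhood of the diagonal -/

/-- Write `dblSin` as the first coordinate times a factor that equals 2 at the point. -/
theorem hasFDerivAt_dblSin_zero_left {b : ℝ} (hb : 0 < b) :
    HasFDerivAt (fun p : ℝ × ℝ => dblSin p.1 p.2) ((2 : ℝ) • ContinuousLinearMap.fst ℝ ℝ ℝ) (0, b) := by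
  have h1 : DifferentiableAt ℝ (fun p : ℝ × ℝ => 2 * p.2 / √(p.1 ^ 2 + p.2 ^ 2)) (0, b) := by
    have h2 : (0 : ℝ) ^ 2 + b ^ 2 ≠ 0 := by positivity
    have e1 : DifferentiableAt ℝ (fun p : ℝ × ℝ => p.1 ^ 2 + p.2 ^ 2) (0, b) := by fun_prop
    have e2 : DifferentiableAt ℝ (fun p : ℝ × ℝ => 2 * p.2) (0, b) := by fun_prop
    have e3 : √((0 : ℝ) ^ 2 + b ^ 2) ≠ 0 := (Real.sqrt_pos.2 (by positivity)).ne'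
    simpa only [div_eq_mul_inv] using e2.fun_mul ((e1.sqrt h2).fun_inv e3)
  have h3 := (hasFDerivAt_fst (𝕜 := ℝ) (p := ((0 : ℝ), b))).mul h1.hasFDerivAt
  have h4 : (fun p : ℝ × ℝ => dblSin p.1 p.2) =
      Prod.fst * fun p : ℝ × ℝ => 2 * p.2 / √(p.1 ^ 2 + p.2 ^ 2) := by
    funext p
    simp only [dblSin, Pi.mul_apply]
    ring
  rw [h4]
  refine h3.congr_fderiv ?_
  have h5 : √((0 : ℝ) ^ 2 + b ^ 2) = b := by
    rw [zero_pow two_ne_zero, zero_add, Real.sqrt_sq hb.le]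
  simp only [zero_smul, zero_add, h5]
  rw [mul_div_assoc, div_self hb.ne', mul_one]

theorem hasFDerivAt_dblSin_zero_right {a : ℝ} (ha : 0 < a) :
    HasFDerivAt (fun p : ℝ × ℝ => dblSin p.1 p.2) ((2 : ℝ) • ContinuousLinearMap.snd ℝ ℝ ℝ) (a, 0) := by
  have h1 : HasFDerivAt (Prod.swap : ℝ × ℝ → ℝ × ℝ)
      ((ContinuousLinearMap.snd ℝ ℝ ℝ).prod (ContinuousLinearMap.fst ℝ ℝ ℝ)) (a, 0) :=
    ((ContinuousLinearMap.snd ℝ ℝ ℝ).prod (ContinuousLinearMap.fst ℝ ℝ ℝ)).hasFDerivAt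
  have h2 := HasFDerivAt.comp (a, (0 : ℝ)) (hasFDerivAt_dblSin_zero_left ha) h1
  have h3 : (fun p : ℝ × ℝ => dblSin p.1 p.2) ∘ Prod.swap = fun p : ℝ × ℝ => dblSin p.1 p.2 :=
    funext fun p => dblSin_comm _ _
  rw [h3] at h2
  exact h2

/-- The hypotheses under which the set of all `q` with `c ≤ D q` has corner charts. -/
structure IsRegularLevel {n : ℕ} (M : CompactManifold n) (ρ : M → ℝ) (D : M × M → ℝ) (c : ℝ) :
    Prop where
  isBoundaryDefining : IsBoundaryDefining M ρ
  contMDiff : ContMDiff (pairModel n) 𝓘(ℝ) ∞ D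
  swap : ∀ q, D q.swap = D q
  diag : ∀ x, D (x, x) < c
  exists_direction : ∀ q, D q = c → ∃ ξ, pairDeriv D q ξ ≠ 0 ∧
    (q.1 ∈ M.bdry → vectorDeriv ρ q.1 ξ.1 = 0) ∧ (q.2 ∈ M.bdry → vectorDeriv ρ q.2 ξ.2 = 0)

/-- The matrix of the values `L i (v j)` is triangular with non-zero diagonal, so the coefficients
of a relation vanish one after the other. -/
theorem linearIndependent_of_triangular {V : Type*} [NormedAddCommGroup V] [NormedSpace ℝ V]
    {k : ℕ} {L : Fin k → V →L[ℝ] ℝ} {v : Fin k → V} (h : ∀ i, L i (v i) ≠ 0)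
    (h0 : ∀ i j, j < i → L i (v j) = 0) : LinearIndependent ℝ L := by
  rw [Fintype.linearIndependent_iff]
  intro g hg j
  induction j using Fin.strong_induction_on with
  | _ j ih =>
    have h1 : (∑ i, g i • L i) (v j) = 0 := by rw [hg]; rfl
    rw [sum_apply, Finset.sum_eq_single j] at h1
    · exact (mul_eq_zero.1 h1).resolve_right (h j)
    · intro i _ hij
      rcases lt_or_gt_of_ne hij with hlt | hlt
      · rw [ih i hlt, zero_smul]; rfl
      · change g i * L i (v j) = 0
        rw [h0 i j hlt, mul_zero]
    · simp

namespace IsRegularLevel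

variable {n : ℕ} {M : CompactManifold n} {ρ : M → ℝ} {D : M × M → ℝ} {c : ℝ}

theorem contMDiff_level (H : IsRegularLevel M ρ D c) :
    ContMDiff (pairModel n) 𝓘(ℝ) ∞ (fun q => D q - c) := H.contMDiff.sub contMDiff_const

theorem contMDiff_fst (H : IsRegularLevel M ρ D c) :
    ContMDiff (pairModel n) 𝓘(ℝ) ∞ (fun q : M × M => ρ q.1) :=
  H.isBoundaryDefining.contMDiff.comp _root_.contMDiff_fst

theorem contMDiff_snd (H : IsRegularLevel M ρ D c) :
    ContMDiff (pairModel n) 𝓘(ℝ) ∞ (fun q : M × M => ρ q.2) :=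
  H.isBoundaryDefining.contMDiff.comp _root_.contMDiff_snd

theorem hasMFDerivAt_level (H : IsRegularLevel M ρ D c) (p : M × M) :
    HasMFDerivAt (pairModel n) 𝓘(ℝ) (fun q => D q - c) p (pairDeriv D p) := by
  have h1 := (H.contMDiff.mdifferentiable (by simp) p).hasMFDerivAt
  have h2 := h1.sub (hasMFDerivAt_const (I := pairModel n) (I' := 𝓘(ℝ)) c p)
  have h3 : (pairDeriv D p - 0 : EuclideanSpace ℝ (Fin n) × EuclideanSpace ℝ (Fin n) →L[ℝ] ℝ) =
    pairDeriv D p := sub_zero _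
  rw [← h3]
  exact h2

theorem hasMFDerivAt_fst (H : IsRegularLevel M ρ D c) (p : M × M) :
    HasMFDerivAt (pairModel n) 𝓘(ℝ) (fun q : M × M => ρ q.1) p
      ((vectorDeriv ρ p.1).comp (ContinuousLinearMap.fst ℝ _ _)) :=
  HasMFDerivAt.comp p (H.isBoundaryDefining.contMDiff.mdifferentiable (by simp) p.1).hasMFDerivAt
    (_root_.hasMFDerivAt_fst p)

theorem hasMFDerivAt_snd (H : IsRegularLevel M ρ D c) (p : M × M) :
    HasMFDerivAt (pairModel n) 𝓘(ℝ) (fun q : M × M => ρ q.2) p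
      ((vectorDeriv ρ p.2).comp (ContinuousLinearMap.snd ℝ _ _)) :=
  HasMFDerivAt.comp p (H.isBoundaryDefining.contMDiff.mdifferentiable (by simp) p.2).hasMFDerivAt
    (_root_.hasMFDerivAt_snd p)

theorem hasMFDerivAt_prod (H : IsRegularLevel M ρ D c) (p : M × M) :
    HasMFDerivAt (pairModel n) 𝓘(ℝ, ℝ × ℝ) (fun q : M × M => (ρ q.1, ρ q.2)) p
      (((vectorDeriv ρ p.1).comp (ContinuousLinearMap.fst ℝ _ _)).prod
        ((vectorDeriv ρ p.2).comp (ContinuousLinearMap.snd ℝ _ _))) :=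
  ⟨(H.hasMFDerivAt_fst p).1.prodMk (H.hasMFDerivAt_snd p).1,
    (H.hasMFDerivAt_fst p).2.prodMk (H.hasMFDerivAt_snd p).2⟩

theorem eventually_contMDiffAt_dblSin (H : IsRegularLevel M ρ D c) {p : M × M}
    (hp : ¬(ρ p.1 = 0 ∧ ρ p.2 = 0)) : ∀ᶠ q in 𝓝 p,
      ContMDiffAt (pairModel n) 𝓘(ℝ) ∞ (fun q : M × M => dblSin (ρ q.1) (ρ q.2)) q := by
  have h1 : ∀ᶠ q in 𝓝 p, (ρ q.1, ρ q.2) ≠ (0, 0) := by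
    refine ContinuousAt.eventually_ne (g := fun q : M × M => (ρ q.1, ρ q.2))
      (H.contMDiff_fst.continuous.prodMk H.contMDiff_snd.continuous).continuousAt ?_
    simpa [Prod.ext_iff] using hp
  filter_upwards [h1] with q hq
  exact ContMDiffAt.comp (g := fun p : ℝ × ℝ => dblSin p.1 p.2) q
    (contDiffAt_dblSin (by simpa [Prod.ext_iff] using hq)).contMDiffAt
    ((H.contMDiff_fst q).prodMk_space (H.contMDiff_snd q))

theorem hasMFDerivAt_dblSin_left (H : IsRegularLevel M ρ D c) {p : M × M} (h1 : ρ p.1 = 0)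
    (h2 : ρ p.2 ≠ 0) : HasMFDerivAt (pairModel n) 𝓘(ℝ) (fun q : M × M => dblSin (ρ q.1) (ρ q.2)) p
      ((2 : ℝ) • (vectorDeriv ρ p.1).comp (ContinuousLinearMap.fst ℝ _ _)) := by
  have h3 := hasFDerivAt_dblSin_zero_left
    (lt_of_le_of_ne (H.isBoundaryDefining.nonneg p.2) h2.symm)
  rw [← h1] at h3
  exact HasMFDerivAt.comp (g := fun p : ℝ × ℝ => dblSin p.1 p.2) p h3.hasMFDerivAt
    (H.hasMFDerivAt_prod p)

theorem hasMFDerivAt_dblSin_right (H : IsRegularLevel M ρ D c) {p : M × M} (h1 : ρ p.1 ≠ 0)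
    (h2 : ρ p.2 = 0) : HasMFDerivAt (pairModel n) 𝓘(ℝ) (fun q : M × M => dblSin (ρ q.1) (ρ q.2)) p
      ((2 : ℝ) • (vectorDeriv ρ p.2).comp (ContinuousLinearMap.snd ℝ _ _)) := by
  have h3 := hasFDerivAt_dblSin_zero_right
    (lt_of_le_of_ne (H.isBoundaryDefining.nonneg p.1) h1.symm)
  rw [← h2] at h3
  exact HasMFDerivAt.comp (g := fun p : ℝ × ℝ => dblSin p.1 p.2) p h3.hasMFDerivAt
    (H.hasMFDerivAt_prod p)

theorem exists_vector (H : IsRegularLevel M ρ D c) {x : M} (hx : ρ x = 0) :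
    ∃ v, vectorDeriv ρ x v ≠ 0 := by
  have := H.isBoundaryDefining.deriv_ne_zero x ((H.isBoundaryDefining.eq_zero_iff x).1 hx)
  by_contra! h
  exact this (ContinuousLinearMap.ext h)

theorem eventually_lt (H : IsRegularLevel M ρ D c) {p : {q | c ≤ D q}}
    (hp : D p - c ≠ 0) : ∀ᶠ q in 𝓝 (p : M × M), 0 < D q - c :=
  H.contMDiff_level.continuous.continuousAt.eventually
    (lt_mem_nhds (lt_of_le_of_ne (sub_nonneg.2 p.2) hp.symm))

/-- At such a point at most one of `h`, `a`, `b` vanishes; that one, if any, is the only boundary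
coordinate. -/
theorem exists_chart_smooth (H : IsRegularLevel M ρ D c) (p : {q | c ≤ D q})
    (h1 : ¬(ρ (p : M × M).1 = 0 ∧ ρ (p : M × M).2 = 0))
    (h2 : ¬(D p - c = 0 ∧ dblSin (ρ (p : M × M).1) (ρ (p : M × M).2) = 0)) :
    ∃ d : CornerChart {q | c ≤ D q} (2 * n), IsProductSmooth _ d ∧ (d.k = 0 ∨ d.k = 1) ∧
      p ∈ d.dom := by
  have hb := H.isBoundaryDefining
  have key : ∀ (f : M × M → ℝ) (hf : ContMDiff (pairModel n) 𝓘(ℝ) ∞ f)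
      (L : EuclideanSpace ℝ (Fin n) × EuclideanSpace ℝ (Fin n) →L[ℝ] ℝ)
      (hL : HasMFDerivAt (pairModel n) 𝓘(ℝ) f p L) (v) (hv : L v ≠ 0)
      (e1 : (p : M × M).1 ∈ M.bdry →
        ∀ᶠ q in 𝓝 (p : M × M), 0 ≤ f q ∧ (f q = 0 ↔ q.1 ∈ M.bdry))
      (e2 : (p : M × M).2 ∈ M.bdry →
        ∀ᶠ q in 𝓝 (p : M × M), 0 ≤ f q ∧ (f q = 0 ↔ q.2 ∈ M.bdry))
      (hC : ∀ᶠ q in 𝓝 (p : M × M), c ≤ D q ↔ 0 ≤ f q),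
      ∃ d : CornerChart {q | c ≤ D q} (2 * n), IsProductSmooth _ d ∧ (d.k = 0 ∨ d.k = 1) ∧
        p ∈ d.dom := by
    intro f hf L hL v hv e1 e2 hC
    obtain ⟨d, hd, hpd, hdb⟩ := exists_isProductSmooth p ![f]
      (by simpa using Filter.Eventually.of_forall hf) (L := ![L])
      (linearIndependent_of_triangular (v := ![v]) (by simpa using hv)
        (fun i j hij => absurd hij (by simp [Subsingleton.elim i j])))
      (by simpa using hL) (fun h => ⟨0, by simpa using e1 h⟩) (fun h => ⟨0, by simpa using e2 h⟩)
      (by simpa using hC)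
    exact ⟨d, hd, Or.inr hdb.k_eq, hpd⟩
  by_cases hh : D p - c = 0
  · have hu : ¬(ρ (p : M × M).1 = 0 ∨ ρ (p : M × M).2 = 0) := fun h =>
      h2 ⟨hh, (dblSin_eq_zero_iff _ _).2 h⟩
    push Not at hu
    obtain ⟨ξ, hξ, -⟩ := H.exists_direction p (sub_eq_zero.1 hh)
    exact key _ H.contMDiff_level _ (H.hasMFDerivAt_level p) ξ hξ
      (fun h => absurd ((hb.eq_zero_iff _).2 h) hu.1)
      (fun h => absurd ((hb.eq_zero_iff _).2 h) hu.2)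
      (Filter.Eventually.of_forall fun q => sub_nonneg.symm)
  have hpos := H.eventually_lt hh
  by_cases ha : ρ (p : M × M).1 = 0
  · have hb' : ρ (p : M × M).2 ≠ 0 := fun h => h1 ⟨ha, h⟩
    obtain ⟨v, hv⟩ := H.exists_vector ha
    refine key _ H.contMDiff_fst _ (H.hasMFDerivAt_fst p) (v, 0) hv
      (fun _ => Filter.Eventually.of_forall fun q => ⟨hb.nonneg _, hb.eq_zero_iff _⟩)
      (fun h => absurd ((hb.eq_zero_iff _).2 h) hb') ?_
    filter_upwards [hpos] with q hq
    exact ⟨fun _ => hb.nonneg _, fun _ => by linarith⟩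
  by_cases hb' : ρ (p : M × M).2 = 0
  · obtain ⟨v, hv⟩ := H.exists_vector hb'
    refine key _ H.contMDiff_snd _ (H.hasMFDerivAt_snd p) (0, v) hv
      (fun h => absurd ((hb.eq_zero_iff _).2 h) ha)
      (fun _ => Filter.Eventually.of_forall fun q => ⟨hb.nonneg _, hb.eq_zero_iff _⟩) ?_
    filter_upwards [hpos] with q hq
    exact ⟨fun _ => hb.nonneg _, fun _ => by linarith⟩
  · obtain ⟨d, hd, hpd, hdb⟩ := exists_isProductSmooth p (k := 0) Fin.elim0 (fun i => i.elim0)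
      (L := Fin.elim0) linearIndependent_empty_type (fun i => i.elim0)
      (fun h => absurd ((hb.eq_zero_iff _).2 h) ha) (fun h => absurd ((hb.eq_zero_iff _).2 h) hb')
      (by
        filter_upwards [hpos] with q hq
        exact ⟨fun _ i => i.elim0, fun _ => show c ≤ D q by linarith⟩)
    exact ⟨d, hd, Or.inl hdb.k_eq, hpd⟩

theorem exists_chart_ab (H : IsRegularLevel M ρ D c) (p : {q | c ≤ D q})
    (h1 : ρ (p : M × M).1 = 0) (h2 : ρ (p : M × M).2 = 0) (h3 : D p - c ≠ 0) :
    ∃ d : CornerChart {q | c ≤ D q} (2 * n), IsProductSmooth _ d ∧ d.HasBoundaryCoords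
      ![fun q => ρ (q : M × M).1, fun q => ρ (q : M × M).2] ∧ p ∈ d.dom := by
  have hb := H.isBoundaryDefining
  obtain ⟨v, hv⟩ := H.exists_vector h1
  obtain ⟨w, hw⟩ := H.exists_vector h2
  obtain ⟨d, hd, hpd, hdb⟩ := exists_isProductSmooth p
    ![fun q : M × M => ρ q.1, fun q : M × M => ρ q.2]
    (Fin.forall_fin_two.2 ⟨Filter.Eventually.of_forall H.contMDiff_fst,
      Filter.Eventually.of_forall H.contMDiff_snd⟩)
    (L := ![(vectorDeriv ρ (p : M × M).1).comp (ContinuousLinearMap.fst ℝ _ _),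
      (vectorDeriv ρ (p : M × M).2).comp (ContinuousLinearMap.snd ℝ _ _)])
    (linearIndependent_of_triangular (v := ![(v, 0), (0, w)])
      (Fin.forall_fin_two.2 ⟨hv, hw⟩) (by simp [Fin.forall_fin_two]))
    (Fin.forall_fin_two.2 ⟨H.hasMFDerivAt_fst p, H.hasMFDerivAt_snd p⟩)
    (fun _ => ⟨0, Filter.Eventually.of_forall fun q => ⟨hb.nonneg _, hb.eq_zero_iff _⟩⟩)
    (fun _ => ⟨1, Filter.Eventually.of_forall fun q => ⟨hb.nonneg _, hb.eq_zero_iff _⟩⟩)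
    (by
      filter_upwards [H.eventually_lt h3] with q hq
      exact ⟨fun _ => Fin.forall_fin_two.2 ⟨hb.nonneg _, hb.nonneg _⟩,
        fun _ => show c ≤ D q by linarith⟩)
  refine ⟨d, hd, ?_, hpd⟩
  convert hdb using 1
  funext i
  fin_cases i <;> rfl

/-- Away from `a = b = 0` the function `dblSin (a, b)` vanishes exactly where `a` or `b` does and is
just as regular, so it can replace whichever of them vanishes. It is symmetric and is the coordinate
left by the first straightening. Independence holds because `ξ` is tangent to the boundary while `D`
varies along it. -/
theorem exists_chart_h (H : IsRegularLevel M ρ D c) (p : {q | c ≤ D q})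
    (h1 : D p - c = 0) (h2 : dblSin (ρ (p : M × M).1) (ρ (p : M × M).2) = 0)
    (h3 : ¬(ρ (p : M × M).1 = 0 ∧ ρ (p : M × M).2 = 0)) :
    ∃ d : CornerChart {q | c ≤ D q} (2 * n), IsProductSmooth _ d ∧ d.HasBoundaryCoords
      ![fun q => D q - c, fun q => dblSin (ρ (q : M × M).1) (ρ (q : M × M).2)] ∧ p ∈ d.dom := by
  have hb := H.isBoundaryDefining
  have hun : ∀ q : M × M, 0 ≤ dblSin (ρ q.1) (ρ q.2) := fun q =>
    dblSin_nonneg (hb.nonneg _) (hb.nonneg _)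
  obtain ⟨ξ, hξ, hξ1, hξ2⟩ := H.exists_direction p (sub_eq_zero.1 h1)
  have key : ∀ (L : EuclideanSpace ℝ (Fin n) × EuclideanSpace ℝ (Fin n) →L[ℝ] ℝ)
      (hL : HasMFDerivAt (pairModel n) 𝓘(ℝ) (fun q : M × M => dblSin (ρ q.1) (ρ q.2)) p L) (v)
      (hv : L v ≠ 0) (hLξ : L ξ = 0)
      (e1 : (p : M × M).1 ∈ M.bdry → ∀ᶠ q in 𝓝 (p : M × M), ρ q.2 ≠ 0)
      (e2 : (p : M × M).2 ∈ M.bdry → ∀ᶠ q in 𝓝 (p : M × M), ρ q.1 ≠ 0),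
      ∃ d : CornerChart {q | c ≤ D q} (2 * n), IsProductSmooth _ d ∧ d.HasBoundaryCoords
      ![fun q => D q - c, fun q => dblSin (ρ (q : M × M).1) (ρ (q : M × M).2)] ∧ p ∈ d.dom := by
    intro L hL v hv hLξ e1 e2
    obtain ⟨d, hd, hpd, hdb⟩ := exists_isProductSmooth p
      ![fun q => D q - c, fun q : M × M => dblSin (ρ q.1) (ρ q.2)]
      (Fin.forall_fin_two.2 ⟨Filter.Eventually.of_forall H.contMDiff_level,
        H.eventually_contMDiffAt_dblSin h3⟩)
      (L := ![pairDeriv D p, L])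
      (linearIndependent_of_triangular (v := ![ξ, v])
        (Fin.forall_fin_two.2 ⟨hξ, hv⟩) (by simpa [Fin.forall_fin_two] using hLξ))
      (Fin.forall_fin_two.2 ⟨H.hasMFDerivAt_level p, hL⟩)
      (fun h => ⟨1, (e1 h).mono fun q hq => ⟨hun q, by
        rw [← hb.eq_zero_iff]
        exact (dblSin_eq_zero_iff _ _).trans (or_iff_left hq)⟩⟩)
      (fun h => ⟨1, (e2 h).mono fun q hq => ⟨hun q, by
        rw [← hb.eq_zero_iff]
        exact (dblSin_eq_zero_iff _ _).trans (or_iff_right hq)⟩⟩)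
      (Filter.Eventually.of_forall fun q => ⟨fun h => Fin.forall_fin_two.2
        ⟨sub_nonneg.2 h, hun q⟩, fun h => sub_nonneg.1 (h 0)⟩)
    refine ⟨d, hd, ?_, hpd⟩
    convert hdb using 1
    funext i
    fin_cases i <;> rfl
  rcases (dblSin_eq_zero_iff _ _).1 h2 with ha | ha
  · have hb' : ρ (p : M × M).2 ≠ 0 := fun h => h3 ⟨ha, h⟩
    obtain ⟨v, hv⟩ := H.exists_vector ha
    refine key _ (H.hasMFDerivAt_dblSin_left ha hb') (v, 0) ?_ ?_ (fun _ => ?_)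
      (fun h => absurd ((hb.eq_zero_iff _).2 h) hb')
    · exact mul_ne_zero two_ne_zero hv
    · exact mul_eq_zero_of_right _ (hξ1 ((hb.eq_zero_iff _).1 ha))
    · exact H.contMDiff_snd.continuous.continuousAt.eventually_ne hb'
  · have hb' : ρ (p : M × M).1 ≠ 0 := fun h => h3 ⟨h, ha⟩
    obtain ⟨v, hv⟩ := H.exists_vector ha
    refine key _ (H.hasMFDerivAt_dblSin_right hb' ha) (0, v) ?_ ?_
      (fun h => absurd ((hb.eq_zero_iff _).2 h) hb') (fun _ => ?_)
    · exact mul_ne_zero two_ne_zero hv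
    · exact mul_eq_zero_of_right _ (hξ2 ((hb.eq_zero_iff _).1 ha))
    · exact H.contMDiff_fst.continuous.continuousAt.eventually_ne hb'

/-- The vectors `ξ`, `(v, 0)`, `(0, w)` make the three differentials triangular, since both boundary
differentials vanish on `ξ`. -/
theorem exists_chart_hab (H : IsRegularLevel M ρ D c) (p : {q | c ≤ D q})
    (h1 : D p - c = 0) (h2 : ρ (p : M × M).1 = 0) (h3 : ρ (p : M × M).2 = 0) :
    ∃ d : CornerChart {q | c ≤ D q} (2 * n), IsProductSmooth _ d ∧ d.HasBoundaryCoords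
      ![fun q => D q - c, fun q => ρ (q : M × M).1, fun q => ρ (q : M × M).2] ∧ p ∈ d.dom := by
  have hb := H.isBoundaryDefining
  obtain ⟨ξ, hξ, hξ1, hξ2⟩ := H.exists_direction p (sub_eq_zero.1 h1)
  obtain ⟨v, hv⟩ := H.exists_vector h2
  obtain ⟨w, hw⟩ := H.exists_vector h3
  have h3' : ∀ {P : Fin 3 → Prop}, P 0 → P 1 → P 2 → ∀ i, P i := by
    intro P p0 p1 p2 i
    fin_cases i
    exacts [p0, p1, p2]
  have hξ1' := hξ1 ((hb.eq_zero_iff _).1 h2)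
  have hξ2' := hξ2 ((hb.eq_zero_iff _).1 h3)
  obtain ⟨d, hd, hpd, hdb⟩ := exists_isProductSmooth p
    ![fun q => D q - c, fun q : M × M => ρ q.1, fun q : M × M => ρ q.2]
    (h3' (Filter.Eventually.of_forall H.contMDiff_level)
      (Filter.Eventually.of_forall H.contMDiff_fst) (Filter.Eventually.of_forall H.contMDiff_snd))
    (L := ![pairDeriv D p, (vectorDeriv ρ (p : M × M).1).comp (ContinuousLinearMap.fst ℝ _ _),
      (vectorDeriv ρ (p : M × M).2).comp (ContinuousLinearMap.snd ℝ _ _)])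
    (linearIndependent_of_triangular (v := ![ξ, (v, 0), (0, w)]) (h3' hξ hv hw)
      (h3' (fun j hj => absurd hj (by simp))
        (h3' (fun _ => hξ1') (fun h => absurd h (by simp)) (fun h => absurd h (by decide)))
        (h3' (fun _ => hξ2') (fun _ => map_zero (vectorDeriv ρ (p : M × M).2))
          (fun h => absurd h (by simp)))))
    (h3' (H.hasMFDerivAt_level p) (H.hasMFDerivAt_fst p) (H.hasMFDerivAt_snd p))
    (fun _ => ⟨1, Filter.Eventually.of_forall fun q => ⟨hb.nonneg _, hb.eq_zero_iff _⟩⟩)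
    (fun _ => ⟨2, Filter.Eventually.of_forall fun q => ⟨hb.nonneg _, hb.eq_zero_iff _⟩⟩)
    (Filter.Eventually.of_forall fun q => ⟨fun h => h3' (sub_nonneg.2 h) (hb.nonneg _)
      (hb.nonneg _), fun h => sub_nonneg.1 (h 0)⟩)
  refine ⟨d, hd, ?_, hpd⟩
  convert hdb using 1
  funext i
  fin_cases i <;> rfl

theorem exists_chart (H : IsRegularLevel M ρ D c) (p : {q | c ≤ D q}) :
    ∃ d : CornerChart {q | c ≤ D q} (2 * n), IsProductSmooth _ d ∧ p ∈ d.dom := by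
  by_cases hab : ρ (p : M × M).1 = 0 ∧ ρ (p : M × M).2 = 0
  · by_cases h : D p - c = 0
    · obtain ⟨d, h1, -, h2⟩ := H.exists_chart_hab p h hab.1 hab.2
      exact ⟨d, h1, h2⟩
    · obtain ⟨d, h1, -, h2⟩ := H.exists_chart_ab p hab.1 hab.2 h
      exact ⟨d, h1, h2⟩
  · by_cases h : D p - c = 0 ∧ dblSin (ρ (p : M × M).1) (ρ (p : M × M).2) = 0
    · obtain ⟨d, h1, -, h2⟩ := H.exists_chart_h p h.1 h.2 hab
      exact ⟨d, h1, h2⟩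
    · obtain ⟨d, h1, -, h2⟩ := H.exists_chart_smooth p hab h
      exact ⟨d, h1, h2⟩

theorem hasCornerCharts (H : IsRegularLevel M ρ D c) :
    HasCornerCharts (productAtlas {q | c ≤ D q} H.exists_chart) (fun q => D q - c)
      (fun q => ρ (q : M × M).1) (fun q => ρ (q : M × M).2) where
  smooth p h1 h2 := by
    obtain ⟨d, hd, hk, hp⟩ := H.exists_chart_smooth p h1 h2
    rcases hk with hk | hk
    · exact (productAtlas_isSmooth hd).exists_k_eq_one hk hp
    · exact ⟨d, productAtlas_isSmooth hd, hk, hp⟩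
  corner_ab p h1 h2 h3 := by
    obtain ⟨d, hd, h⟩ := H.exists_chart_ab p h1 h2 h3
    exact ⟨d, productAtlas_isSmooth hd, h⟩
  corner_h p h1 h2 h3 := by
    obtain ⟨d, hd, h⟩ := H.exists_chart_h p h1 h2 h3
    exact ⟨d, productAtlas_isSmooth hd, h⟩
  corner_hab p h1 h2 h3 := by
    obtain ⟨d, hd, h⟩ := H.exists_chart_hab p h1 h2 h3
    exact ⟨d, productAtlas_isSmooth hd, h⟩

end IsRegularLevel

/-! ### Smooth structures on the complement and its quotient -/

namespace IsRegularLevel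

variable {n : ℕ} {M : CompactManifold n} {ρ : M → ℝ} {D : M × M → ℝ} {c : ℝ}

theorem hasSmoothQuotient (H : IsRegularLevel M ρ D c) : HasSmoothQuotient M {q | c ≤ D q} := by
  set C : Set (M × M) := {q | c ≤ D q} with hC
  have hcomp : IsCompact C := (isClosed_le continuous_const H.contMDiff.continuous).isCompact
  have : CompactSpace C := isCompact_iff_compactSpace.1 hcomp
  let A := productAtlas C H.exists_chart
  let τ : C → C := fun q => ⟨(q : M × M).swap, q.2.trans_eq (H.swap q).symm⟩
  have hτ : ∀ q, A.SmoothMapAt A τ q := by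
    intro q
    obtain ⟨d, hd, hqd⟩ := H.exists_chart q
    obtain ⟨d', hd', hqd'⟩ := H.exists_chart (τ q)
    refine CornerAtlas.smoothMapAt_of_smoothVia ?_ (productAtlas_isSmooth hd)
      (productAtlas_isSmooth hd') hqd hqd'
      (hd.smoothVia hd' (g := Prod.swap) ?_ (fun _ => rfl) hqd hqd')
    · exact (Continuous.subtype_mk (continuous_swap.comp continuous_subtype_val) _).continuousAt
    · exact _root_.contMDiff_snd.prodMk _root_.contMDiff_fst
  -- The fixed points of the swap are the diagonal, where `D < c`.
  have hfree : ∀ q, τ q ≠ q := by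
    intro q hq
    have h1 : (q : M × M).swap = q := congrArg Subtype.val hq
    have h2 : (q : M × M) = ((q : M × M).1, (q : M × M).1) :=
      Prod.ext rfl (congrArg Prod.fst h1)
    have h3 : c ≤ D q := q.2
    rw [h2] at h3
    exact absurd h3 (not_le.2 (H.diag _))
  obtain ⟨A', hτ', hch⟩ := exists_straightened_atlas_of_hasCornerCharts hτ
    (fun q => Subtype.ext (Prod.swap_swap _)) hfree
    (H.contMDiff_level.continuous.comp continuous_subtype_val)
    (H.contMDiff_fst.continuous.comp continuous_subtype_val)
    (H.contMDiff_snd.continuous.comp continuous_subtype_val)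
    (fun q => congrArg (· - c) (H.swap _)) (fun _ => rfl) (fun _ => rfl) H.hasCornerCharts
  have hA' : ∀ p, ∃ d, A'.IsSmooth d ∧ d.k = 1 ∧ p ∈ d.dom := fun p => by
    obtain ⟨d, d', -, h1, h2, h3, h4, -⟩ := hch p
    exact ⟨d', h1, h4, h3 ▸ h2⟩
  have hs : ∀ p q, swapSetoid C p q ↔ p = q ∨ p = τ q := fun p q => by
    have : p = τ q ↔ (p : M × M) = (q : M × M).swap := Subtype.ext_iff
    rw [this]
    rfl
  obtain ⟨hT2, hcs, hman, hloc⟩ := exists_quotient_manifold hA' hτ' hfree hs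
  refine ⟨hcomp, A'.chartedSpace hA', CornerAtlas.isManifold hA', ?_, inferInstance, hT2, hcs,
    hman, hloc⟩
  let _ := A'.chartedSpace hA'
  intro p
  obtain ⟨d, d', hd, hd', hp, hdom, hk, heq⟩ := hch p
  obtain ⟨O, φ, hO, hφ, hcc⟩ := (isProductSmooth_of_isSmooth hd).isCornerChart
  refine ⟨d.k, O, φ, ?_, hcc, d'.toHomeo hk, CornerAtlas.toHomeo_mem_maximalAtlas hA' hd' hk,
    hdom.trans hO.symm, fun q hq => ?_⟩
  · exact (hO ▸ hp : p ∈ Subtype.val ⁻¹' O)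
  · have hq' : q ∈ d.dom := hdom ▸ hq
    rw [CornerChart.halfModel_toHomeo hk hq, heq q hq', hφ q hq']

end IsRegularLevel

/-! ### Immersions -/

/-- The inverse of the chart provides a left inverse of the derivative by the chain rule. -/
theorem injective_mfderiv_extend {n : ℕ} {M : CompactManifold n}
    {φ : OpenPartialHomeomorph M (HalfSpace n)}
    (hφ : φ ∈ IsManifold.maximalAtlas (halfModel n) ∞ M) {x : M} (hx : x ∈ φ.source) :
    Function.Injective (vectorDeriv (φ.extend (halfModel n)) x) := by
  have h1 := ((φ.contMDiffAt_extend hφ hx).mdifferentiableAt (by simp)).hasMFDerivAt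
  have h2 := (((contMDiffOn_extend_symm hφ) (φ.extend (halfModel n) x)
    ⟨φ x, φ.map_source hx, rfl⟩).mdifferentiableWithinAt (by simp)).hasMFDerivWithinAt
  have h3 := h2.comp x (h1.hasMFDerivWithinAt (s := φ.source))
    fun y hy => ⟨φ y, φ.map_source hy, rfl⟩
  have h4 : ∀ y ∈ φ.source,
      id y = ((φ.extend (halfModel n)).symm ∘ φ.extend (halfModel n)) y := fun y hy =>
    (φ.extend_left_inv hy).symm
  have h5 := ((h3.congr_mono h4 (h4 x hx) Subset.rfl).hasMFDerivAt (φ.open_source.mem_nhds hx))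
  have h6 := hasMFDerivAt_unique h5 (hasMFDerivAt_id x)
  refine Function.LeftInverse.injective (g := mfderivWithin 𝓘(ℝ, EuclideanSpace ℝ (Fin n))
    (halfModel n) (φ.extend (halfModel n)).symm (halfModel n '' φ.target)
    (φ.extend (halfModel n) x)) fun v => ?_
  exact congrArg (fun L : EuclideanSpace ℝ (Fin n) →L[ℝ] EuclideanSpace ℝ (Fin n) => L v) h6

/-- In the charts of the local normal form, `f` followed by a linear projection is the domain chart,
whose derivative is injective. -/
theorem injective_mfderiv_of_isImmersionAt {n m : ℕ} {M : CompactManifold n} {W : CompactManifold m}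
    {f : M → W} {x : M} (h : IsImmersionAt (halfModel n) (halfModel m) ∞ f x) :
    Function.Injective (mfderiv (halfModel n) (halfModel m) f x) := by
  have h1 := (h.contMDiffAt.mdifferentiableAt (by simp)).hasMFDerivAt
  have h2 := ((h.codChart.contMDiffAt_extend h.codChart_mem_maximalAtlas
    h.mem_codChart_source).mdifferentiableAt (by simp)).hasMFDerivAt
  let P : EuclideanSpace ℝ (Fin m) →L[ℝ] EuclideanSpace ℝ (Fin n) :=
    (ContinuousLinearMap.fst ℝ _ _).comp
      (h.equiv.symm : EuclideanSpace ℝ (Fin m) →L[ℝ] EuclideanSpace ℝ (Fin n) × h.complement)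
  have h3 := HasMFDerivAt.comp x (P.hasMFDerivAt (x := h.codChart.extend (halfModel m) (f x)))
    (HasMFDerivAt.comp x h2 h1)
  have h4 : ∀ y ∈ h.domChart.source, h.domChart.extend (halfModel n) y =
      (P ∘ h.codChart.extend (halfModel m) ∘ f) y := by
    intro y hy
    have := h.writtenInCharts ((h.domChart.extend (halfModel n)).map_source
      (by rwa [OpenPartialHomeomorph.extend_source]))
    simp only [Function.comp_apply, h.domChart.extend_left_inv hy] at this
    change _ = (h.equiv.symm (h.codChart.extend (halfModel m) (f y))).1
    rw [this, h.equiv.symm_apply_apply]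
  have h5 := (h3.congr_of_eventuallyEq (Filter.eventually_of_mem
    (h.domChart.open_source.mem_nhds h.mem_domChart_source) h4)).mfderiv
  have h6 := injective_mfderiv_extend h.domChart_mem_maximalAtlas h.mem_domChart_source
  rw [injective_iff_map_eq_zero]
  intro v hv
  rw [vectorDeriv, h5] at h6
  refine (injective_iff_map_eq_zero _).1 h6 v ?_
  change P (mfderiv (halfModel m) 𝓘(ℝ, EuclideanSpace ℝ (Fin m)) _ (f x)
    (mfderiv (halfModel n) (halfModel m) f x v)) = 0
  rw [hv, map_zero]
  exact map_zero P

/-! ### Sublevel sets of the distance -/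

theorem sqDist_eq_zero_iff {n : ℕ} {M : CompactManifold n} {F : Type*} [NormedAddCommGroup F]
    {e : M → F} (hinj : Function.Injective e) {q : M × M} : sqDist e q = 0 ↔ q.1 = q.2 := by
  rw [sqDist, sq_eq_zero_iff, norm_eq_zero, sub_eq_zero, hinj.eq_iff]

theorem isAdmissibleNhd_sublevel {n : ℕ} {M : CompactManifold n} {F : Type*}
    [NormedAddCommGroup F] {X : Type*} {f : M → X} {U : Set (X × X)} {e : M → F}
    (he : Continuous e) {c : ℝ} (hc : 0 < c) (hq : HasSmoothQuotient M {q | c ≤ sqDist e q})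
    (hf : ∀ q, sqDist e q < c → Prod.map f f q ∈ U) :
    IsAdmissibleNhd M f U {q | sqDist e q < c} where
  mem_nhdsSet := by
    refine (IsOpen.mem_nhdsSet ?_).2 ?_
    · unfold sqDist
      exact isOpen_lt (by fun_prop) continuous_const
    · intro q hq
      rw [mem_ofPred_eq, sqDist, show q.1 = q.2 from hq, sub_self, norm_zero]
      simpa using hc
  hasSmoothQuotient := by
    have : {q | sqDist e q < c}ᶜ = {q | c ≤ sqDist e q} := by ext q; simp
    rwa [this]
  swap_mem q hq' := by
    have : sqDist e q.swap = sqDist e q := by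
      simp only [sqDist, Prod.fst_swap, Prod.snd_swap, norm_sub_rev]
    rw [mem_ofPred_eq, this]
    exact hq'
  mapsTo := hf

section Sublevel

variable {n : ℕ} {M : CompactManifold n} {F : Type*} [NormedAddCommGroup F] [InnerProductSpace ℝ F]

theorem exists_hasSmoothQuotient {e : M → F} (he : ContMDiff (halfModel n) 𝓘(ℝ, F) ∞ e)
    (hinj : Function.Injective e) (himm : ∀ x, Function.Injective (vectorDeriv e x)) :
    ∃ ε > 0, ∀ c, 0 < c → c < ε → HasSmoothQuotient M {q | c ≤ sqDist e q} := by
  obtain ⟨ρ, hρ⟩ := exists_isBoundaryDefining M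
  obtain ⟨ε, hε, h⟩ := exists_direction_near_diagonal he hinj himm hρ
  refine ⟨ε, hε, fun c hc hcε => IsRegularLevel.hasSmoothQuotient (ρ := ρ)
    ⟨hρ, contMDiff_sqDist he, fun q => ?_, fun x => ?_, fun q hq => h q (fun h' => ?_) (by rwa [hq])⟩⟩
  · simp only [sqDist, Prod.fst_swap, Prod.snd_swap, norm_sub_rev]
  · rwa [(sqDist_eq_zero_iff hinj).2 rfl]
  · rw [(sqDist_eq_zero_iff hinj).2 h'] at hq
    exact hc.ne hq

/-- The composite of `e` with an embedding is again an injective immersion. It is one and the same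
`e` that lets a single sublevel set in `W × W` restrict well to the parts of the boundary. -/
theorem exists_hasSmoothQuotient_comp {m : ℕ} {W : CompactManifold m} {e : W → F}
    (he : ContMDiff (halfModel m) 𝓘(ℝ, F) ∞ e) (hinj : Function.Injective e)
    (himm : ∀ x, Function.Injective (vectorDeriv e x)) {i : M → W}
    (hi : IsSmoothEmbedding (halfModel n) (halfModel m) ∞ i) :
    ∃ ε > 0, ∀ c, 0 < c → c < ε → HasSmoothQuotient M {q | c ≤ sqDist (e ∘ i) q} := by
  refine exists_hasSmoothQuotient (he.comp hi.contMDiff) (hinj.comp hi.isEmbedding.injective)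
    fun x => ?_
  have h1 : vectorDeriv (e ∘ i) x = (vectorDeriv e (i x)).comp
      (mfderiv (halfModel n) (halfModel m) i x : EuclideanSpace ℝ (Fin n) →L[ℝ] _) :=
    mfderiv_comp x (he.mdifferentiable (by simp) _) (hi.contMDiff.mdifferentiable (by simp) x)
  rw [h1]
  exact (himm (i x)).comp (injective_mfderiv_of_isImmersionAt (hi.isImmersion.isImmersionAt x))

end Sublevel

end

/-! ### The neighbourhood of the diagonal for a bordism -/

theorem mainTheorem6 {n : ℕ} {X : Type*} [TopologicalSpace X] {A : Set X}
    {S₀ : RelSingularManifold n X A} {S₁ : RelSingularManifold n X A} (B : RelBordism S₀ S₁)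
    (U : Set (X × X)) (hU : U ∈ 𝓝ˢ (diagonal X)) :
    ∃ V : Set (B.W × B.W),
      IsAdmissibleNhd B.W B.F U V ∧
      IsAdmissibleNhd S₀.M S₀.f U (Prod.map B.incl₀ B.incl₀ ⁻¹' V) ∧
      IsAdmissibleNhd S₁.M S₁.f U (Prod.map B.incl₁ B.incl₁ ⁻¹' V) := by
  obtain ⟨N, e, he, hemb, himm⟩ := exists_embedding_euclidean_of_compact (I := halfModel (n + 1))
    (M := B.W)
  have hinj := hemb.injective
  have himm' : ∀ x, Function.Injective (vectorDeriv e x) := himm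
  obtain ⟨ε, hε, hW⟩ := exists_hasSmoothQuotient he hinj himm'
  obtain ⟨ε₀, hε₀, h₀⟩ := exists_hasSmoothQuotient_comp he hinj himm' B.isSmoothEmbedding_incl₀
  obtain ⟨ε₁, hε₁, h₁⟩ := exists_hasSmoothQuotient_comp he hinj himm' B.isSmoothEmbedding_incl₁
  -- The distance vanishes only on the diagonal, which `F × F` maps into the interior of `U`.
  obtain ⟨δ, hδ, hδU⟩ := exists_pos_sublevel_subset (w := sqDist e)
    (contMDiff_sqDist he).continuous (fun _ => sq_nonneg _)
    (isOpen_interior.preimage (B.continuous_F.prodMap B.continuous_F) :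
      IsOpen (Prod.map B.F B.F ⁻¹' interior U))
    (fun q hq => subset_interior_iff_mem_nhdsSet.2 hU
      (congrArg B.F ((sqDist_eq_zero_iff hinj).1 hq)))
  -- One `c` below all four bounds: the preimages of the sublevel set in the products of the
  -- boundary parts are by definition the sublevel sets of `e ∘ incl₀` and `e ∘ incl₁` for the same
  -- `c`.
  obtain ⟨c, hc, hcm⟩ := exists_between (lt_min (lt_min hε hδ) (lt_min hε₀ hε₁))
  simp only [lt_min_iff] at hcm
  have hmaps : ∀ q, sqDist e q < c → Prod.map B.F B.F q ∈ U := fun q hq =>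
    interior_subset (hδU q (hq.trans hcm.1.2))
  refine ⟨{q | sqDist e q < c}, isAdmissibleNhd_sublevel he.continuous hc (hW c hc hcm.1.1) hmaps,
    isAdmissibleNhd_sublevel (he.continuous.comp B.isSmoothEmbedding_incl₀.contMDiff.continuous) hc
      (h₀ c hc hcm.2.1) fun q hq => ?_,
    isAdmissibleNhd_sublevel (he.continuous.comp B.isSmoothEmbedding_incl₁.contMDiff.continuous) hc
      (h₁ c hc hcm.2.2) fun q hq => ?_⟩
  · rw [← B.F_incl₀]
    exact hmaps (Prod.map B.incl₀ B.incl₀ q) hq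
  · rw [← B.F_incl₁]
    exact hmaps (Prod.map B.incl₁ B.incl₁ q) hq
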